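/- Let $n,m\ge 1$. For $t,\delta>0$ and $\epsilon\ge 0$ put $$\mathcal A_{(t,\delta,\epsilon)}=\Big\{\vec y\in(\mathbb R^n)^m:\ \delta(1-\epsilon)t<\sum_{i=1}^m|y_i|\le 2\delta(1+\epsilon)t\Big\}.$$ Let $\phi\in\mathfrak D$, that is, $\phi:(\mathbb R^n)^m\to[0,\infty)$ is locally integrable and there are constants $\delta,\epsilon,C>0$ such that $$\sup_{\vec v\in\mathcal A_{(2^k,1,0)}}\phi(\vec v)\le \frac{C}{2^{knm}}\int_{\mathcal A_{(2^k,\delta,\epsilon)}}\phi(\vec y)\,d\vec y\qquad\text{for every }k\in\mathbb Z .$$ Fix such $\delta,\epsilon$. For $0<\theta\le1$ and $t>0$ let $$\Phi_\theta(t)=\Big[\sum_{\nu\in\mathbb Z,\ 2^{-\nu}\le t}\Big(\int_{\mathcal A_{(2^{-\nu},\delta,\epsilon)}}\phi(\vec y)\,d\vec y\Big)^{\theta}\Big]^{1/\theta}\in[0,\infty].$$ For a cube $Q$ (with sides parallel to the axes and side length $l(Q)$) and $\ell\in\{0,1\}$ let $$\|f\|_{L(\log L)^\ell,Q}=\inf\Big\{\lambda>0:\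 \frac1{|Q|}\int_Q B_\ell\Big(\frac{|f(y)|}{\lambda}\Big)dy\le 1\Big\},\qquad B_\ell(t)=t(1+\log^+t)^\ell ,$$ so that $\|f\|_{L(\log L)^0,Q}=\|f\|_{L,Q}=\frac1{|Q|}\int_Q|f|$, and for $\vec f=(f_1,\dots,f_m)$ let $$\mathcal M_{\Phi_\theta,L(\log L)^\ell}\vec f(x)=\sup_{Q\ni x}\Phi_\theta(l(Q))\prod_{i=1}^m\|f_i\|_{L(\log L)^\ell,Q}\qquad(0\cdot\infty=0).$$ Let $$\mathcal T_\phi\vec f(x)=\int_{(\mathbb R^n)^m}\phi(x-y_1,\dots,x-y_m)\prod_{i=1}^m f_i(y_i)\,d\vec y ,$$ and, for $\vec b=(b_1,\dots,b_m)\in BMO^m$ with $\|\vec b\|_*=\max_j\|b_j\|_{BMO}$, $$\mathcal T_{\vec b,\phi}\vec f(x)=\sum_{j=1}^m\Big(b_j(x)\,\mathcal T_\phi\vec f(x)-\mathcal T_\phi(f_1,\dots,b_jf_j,\dots,f_m)(x)\Big).$$ Write $\mathcal T_{\vec b^0,\phi}=\mathcal T_\phi$ and $\mathcal T_{\vec b^1,\phi}=\mathcal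 T_{\vec b,\phi}$. Let $w\in A_\infty=\bigcup_{r>1}A_r$. All constants below are finite and independent of $\vec f$, and depend on $\vec b$ only through an upper bound for $\|\vec b\|_*$; the inequalities hold for all $\vec f=(f_1,\dots,f_m)$ with every $f_i$ (measurable,) bounded with compact support. (i) If $0<p\le1$, there is a constant $C_0$ such that $$\int_{\mathbb R^n}|\mathcal T_\phi\vec f|^p\,w\,dx\le C_0\int_{\mathbb R^n}\big[\mathcal M_{\Phi_p,L}\vec f\,\big]^p\,w\,dx .$$ (ii) If $0<p\le 1$ and $w\in RH(1/p)$, i.e. $\big(\frac1{|Q|}\int_Qw^{1/p}\big)^{p}\le \frac{C}{|Q|}\int_Qw$ for all cubes $Q$ with $C$ independent of $Q$ (no condition when $p=1$), there is a constant $C_1$ such that $$\int_{\mathbb R^n}|\mathcal T_{\vec b,\phi}\vec f|^p\,w\,dx\le C_1\int_{\mathbb R^n}\big[\mathcal M_{\Phi_p,L\log L}\vec f\,\big]^p\,w\,dx .$$ (iii) If $1<p<\infty$ and $\ell\in\{0,1\}$, there is a constant $C_\ell$ such that $$\int_{\mathbb R^n}|\mathcal T_{\vec b^\ell,\phi}\vec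 f|^p\,w\,dx\le C_\ell\int_{\mathbb R^n}\big[\mathcal M_{\Phi_1,L(\log L)^\ell}\vec f\,\big]^p\,w\,dx .$$ -/

import Mathlib

open MeasureTheory Real
open scoped ENNReal NNReal

noncomputable section

namespace MultilinearPotential

/-- `ℝⁿ` with the Euclidean norm. -/
abbrev Rn (n : ℕ) : Type := EuclideanSpace ℝ (Fin n)

/-- The closed cube with sides parallel to the axes, lower corner `a` and side length `l`. -/
def cube {n : ℕ} (a : Rn n) (l : ℝ) : Set (Rn n) :=
  {y | ∀ i, a i ≤ y i ∧ y i ≤ a i + l}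

/-- The annulus `δ(1-ε)t < ∑ |yᵢ| ≤ δ(1+ε)2t` in `(ℝⁿ)ᵐ`. -/
def annulus (n m : ℕ) (t δ ε : ℝ) : Set (Fin m → Rn n) :=
  {y | δ * (1 - ε) * t < ∑ i, ‖y i‖ ∧ ∑ i, ‖y i‖ ≤ δ * (1 + ε) * (2 * t)}

/-- `φ ∈ 𝔇`, with the witnessing constants `δ` and `ε` displayed: `φ` is nonnegative, locally
integrable, and `sup_{𝒜(2ᵏ,1,0)} φ ≤ C 2^{-knm} ∫_{𝒜(2ᵏ,δ,ε)} φ` for all `k ∈ ℤ`. -/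
structure CondD {n m : ℕ} (φ : (Fin m → Rn n) → ℝ) (δ ε : ℝ) : Prop where
  nonneg : ∀ y, 0 ≤ φ y
  locallyIntegrable : LocallyIntegrable φ
  delta_pos : 0 < δ
  eps_pos : 0 < ε
  growth : ∃ C : ℝ, 0 < C ∧ ∀ k : ℤ, ∀ v ∈ annulus n m ((2 : ℝ) ^ k) 1 0,
    φ v ≤ C / (2 : ℝ) ^ (k * n * m) * ∫ y in annulus n m ((2 : ℝ) ^ k) δ ε, φ y

/-- `Φ_θ(t) = [∑_{ν ≥ log_{1/2} t} (∫_{𝒜(2^{-ν},δ,ε)} φ)^θ]^{1/θ}`, a value in `[0,∞]`;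
for `t > 0` the condition `ν ≥ log_{1/2} t` says `2^{-ν} ≤ t`. -/
def Phi {n m : ℕ} (φ : (Fin m → Rn n) → ℝ) (δ ε θ t : ℝ) : ℝ≥0∞ :=
  (∑' ν : {ν : ℤ // (2 : ℝ) ^ (-ν) ≤ t},
    (∫⁻ y in annulus n m ((2 : ℝ) ^ (-ν.1)) δ ε, ENNReal.ofReal (φ y)) ^ θ) ^ (1 / θ)

/-- The multilinear potential operator `𝒯_φ`. -/
def potential {n m : ℕ} (φ : (Fin m → Rn n) → ℝ) (f : Fin m → Rn n → ℝ) (x : Rn n) : ℝ :=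
  ∫ y : Fin m → Rn n, φ (fun i => x - y i) * ∏ i, f i (y i)

/-- The commutator `𝒯_{b,φ} f = ∑ⱼ (bⱼ 𝒯_φ f - 𝒯_φ(f₁,…,bⱼfⱼ,…,f_m))`. -/
def commutator {n m : ℕ} (b : Fin m → Rn n → ℝ) (φ : (Fin m → Rn n) → ℝ)
    (f : Fin m → Rn n → ℝ) (x : Rn n) : ℝ :=
  ∑ j, (b j x * potential φ f x
    - potential φ (Function.update f j (fun y => b j y * f j y)) x)

/-- `𝒯_{b^ℓ,φ}`: the potential operator for `ℓ = 0`, the commutator for `ℓ = 1`. -/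
def potentialComm {n m : ℕ} (ℓ : Fin 2) (b : Fin m → Rn n → ℝ) (φ : (Fin m → Rn n) → ℝ)
    (f : Fin m → Rn n → ℝ) (x : Rn n) : ℝ :=
  if ℓ = 0 then potential φ f x else commutator b φ f x

/-- The function `t (1 + log⁺ t)^ℓ` defining `L(log L)^ℓ` (so `L` for `ℓ = 0`). -/
def youngLog (ℓ : ℕ) (t : ℝ) : ℝ := t * (1 + posLog t) ^ ℓ

/-- The Luxemburg average `inf {λ > 0 : |Q|⁻¹ ∫_Q B(|f|/λ) ≤ 1}` of `f` over `Q`. -/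
def luxAvg {n : ℕ} (B : ℝ → ℝ) (f : Rn n → ℝ) (Q : Set (Rn n)) : ℝ≥0∞ :=
  ⨅ (r : ℝ) (_ : 0 < r) (_ : ⨍⁻ y in Q, ENNReal.ofReal (B (|f y| / r)) ∂volume ≤ 1),
    ENNReal.ofReal r

/-- The multilinear maximal operator `sup_{Q ∋ x} Ψ(l(Q)) ∏ᵢ ‖fᵢ‖_{L^B,Q}`. -/
def maximal {n m : ℕ} (Ψ : ℝ → ℝ≥0∞) (B : ℝ → ℝ) (f : Fin m → Rn n → ℝ) (x : Rn n) : ℝ≥0∞ :=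
  ⨆ (a : Rn n) (l : ℝ) (_ : 0 < l) (_ : x ∈ cube a l), Ψ l * ∏ i, luxAvg B (f i) (cube a l)

/-- A weight: a locally integrable function that is positive almost everywhere. -/
structure IsWeight {n : ℕ} (w : Rn n → ℝ) : Prop where
  locallyIntegrable : LocallyIntegrable w
  pos : ∀ᵐ x, 0 < w x

/-- Muckenhoupt's condition `A_r`, `1 < r < ∞`. -/
def MemA {n : ℕ} (r : ℝ) (w : Rn n → ℝ) : Prop :=
  IsWeight w ∧ ∃ C : ℝ≥0, ∀ (a : Rn n) (l : ℝ), 0 < l →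
    (⨍⁻ y in cube a l, ENNReal.ofReal (w y) ∂volume) *
      (⨍⁻ y in cube a l, ENNReal.ofReal (w y) ^ (-(1 / (r - 1))) ∂volume) ^ (r - 1) ≤ C

/-- `A_∞ = ⋃_{r > 1} A_r`. -/
def MemAInfty {n : ℕ} (w : Rn n → ℝ) : Prop := ∃ r : ℝ, 1 < r ∧ MemA r w

/-- The reverse Hölder condition `RH(s)` (no condition on a weight for `s = 1`). -/
def MemRH {n : ℕ} (s : ℝ) (w : Rn n → ℝ) : Prop :=
  IsWeight w ∧ ∃ C : ℝ≥0, ∀ (a : Rn n) (l : ℝ), 0 < l →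
    (⨍⁻ y in cube a l, ENNReal.ofReal (w y) ^ s ∂volume) ^ (1 / s) ≤
      C * ⨍⁻ y in cube a l, ENNReal.ofReal (w y) ∂volume

/-- `‖b‖_* = sup_Q |Q|⁻¹ ∫_Q |b - b_Q|`, for locally integrable `b`. -/
def bmoNorm {n : ℕ} (b : Rn n → ℝ) : ℝ≥0∞ :=
  ⨆ (a : Rn n) (l : ℝ) (_ : 0 < l),
    ⨍⁻ y in cube a l, ‖b y - ⨍ z in cube a l, b z ∂volume‖ₑ ∂volume

/-- `b ∈ BMO`. -/
def MemBMO {n : ℕ} (b : Rn n → ℝ) : Prop := LocallyIntegrable b ∧ bmoNorm b < ∞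

/-- `‖b‖_* = sup_j ‖bⱼ‖_*` for a vector of symbols. -/
def bmoNormVec {n m : ℕ} (b : Fin m → Rn n → ℝ) : ℝ≥0∞ := ⨆ j, bmoNorm (b j)

/-- Every `fᵢ` is measurable and bounded with compact support. -/
def BddCompactSupp {n m : ℕ} (f : Fin m → Rn n → ℝ) : Prop :=
  ∀ i, AEStronglyMeasurable (f i) ∧ (∃ K : ℝ, ∀ x, |f i x| ≤ K) ∧ HasCompactSupport (f i)

end MultilinearPotential

end

/-
Cut the region of integration into the dyadic annuli `∑ᵢ |x - yᵢ| ≈ 2ᵏ`. By `𝔇`, on each of them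
`φ` is at most its mass on a fixed dilate divided by the volume, and by the one-third trick the
projections of the annulus lie in a dyadic cube containing `x` of one of `2ⁿ` shifted grids. Hence
`|𝒯_φ f|` is dominated by `2ⁿ` sums, over the dyadic cubes containing `x`, of the annulus mass times
`∏ᵢ ⨍_Q |fᵢ|`. For the commutator the factor `|bⱼ(x) - bⱼ(yⱼ)|` is split at the average of `bⱼ`
over `Q`: what depends on `yⱼ` is absorbed by an `L log L` average, and what depends on `x` stays as
an oscillation weight.

To bound these dyadic sums, select stopping cubes, where a Luxemburg average of some `fᵢ` or an
average of some `bⱼ` jumps. Between two stopping cubes the product of averages is nearly constant,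
so the annulus masses can be summed, and because `θ ≤ 1` their sum is at most `Φ_θ`. Each stopping
cube keeps half its measure after its stopping descendants are removed, and `w ∈ A_∞` turns this
into a fixed proportion of its `w`-measure: the `Lᵖ(w)` norm of the sparse sum is bounded by that of
the maximal function. The oscillation of `b` at `x` is controlled by the number of stopping cubes
between `Q` and `x`, which decays exponentially as in the John–Nirenberg inequality.
-/

noncomputable section

namespace MultilinearPotential

section Laminar

lemma real_add_rpow_le {a x s : ℝ} (ha : 0 ≤ a) (hx : 0 ≤ x) (hs : 1 ≤ s) :
    (a + x) ^ s ≤ a ^ s + s * (x * (a + x) ^ (s - 1)) := by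
  rcases (add_nonneg ha hx).eq_or_lt with h0 | hpos
  · obtain rfl : a = 0 := by linarith
    obtain rfl : x = 0 := by linarith
    simp
  have bernoulli : 1 + s * -(x / (a + x)) ≤ (1 + -(x / (a + x))) ^ s := by
    refine one_add_mul_self_le_rpow_one_add ?_ hs
    rw [neg_le_neg_iff, div_le_one hpos]
    linarith
  have ratio : 1 + -(x / (a + x)) = a / (a + x) := by field_simp; ring
  rw [ratio, div_rpow ha hpos.le, le_div_iff₀ (rpow_pos_of_pos hpos s)] at bernoulli
  rw [rpow_sub hpos, rpow_one]
  linear_combination bernoulli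

lemma ennreal_add_rpow_le (a x : ℝ≥0∞) {s : ℝ} (hs : 1 ≤ s) :
    (a + x) ^ s ≤ a ^ s + ENNReal.ofReal s * (x * (a + x) ^ (s - 1)) := by
  have hs0 : 0 < s := by linarith
  rcases eq_or_ne a ∞ with rfl | ha
  · simp [hs0]
  rcases eq_or_ne x ∞ with rfl | hx
  · have : (∞ : ℝ≥0∞) ^ (s - 1) ≠ 0 := by simp [hs]
    simp [hs0, ENNReal.top_rpow_of_pos, this]
  lift a to ℝ≥0 using ha
  lift x to ℝ≥0 using hx
  have h := real_add_rpow_le a.coe_nonneg x.coe_nonneg hs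
  rw [← ENNReal.coe_add, ← ENNReal.coe_rpow_of_nonneg _ hs0.le,
    ← ENNReal.coe_rpow_of_nonneg _ hs0.le, ← ENNReal.coe_rpow_of_nonneg _ (sub_nonneg.2 hs),
    ENNReal.ofReal, ← ENNReal.coe_mul, ← ENNReal.coe_mul, ← ENNReal.coe_add, ENNReal.coe_le_coe,
    ← NNReal.coe_le_coe]
  push_cast
  rwa [coe_toNNReal _ hs0.le]

lemma le_rpow_mul_of_le_mul_rpow {u v κ : ℝ≥0∞} {s : ℝ} (hs : 1 ≤ s) (hu : u ≠ ∞)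
    (h : u ≤ κ * (v ^ (1 / s) * u ^ ((s - 1) / s))) : u ≤ κ ^ s * v := by
  have hs0 : 0 < s := by linarith
  rcases eq_or_ne u 0 with rfl | hu0
  · exact bot_le
  have hs' : 0 ≤ (s - 1) / s := div_nonneg (by linarith) hs0.le
  have hsplit : u ^ (1 / s) * u ^ ((s - 1) / s) = u := by
    rw [← ENNReal.rpow_add _ _ hu0 hu, ← add_div, add_sub_cancel, div_self hs0.ne',
      ENNReal.rpow_one]
  have hroot : u ^ (1 / s) ≤ κ * v ^ (1 / s) := by
    rw [← mul_assoc] at h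
    nth_rw 1 [← hsplit] at h
    exact (ENNReal.mul_le_mul_iff_left (ENNReal.rpow_pos (pos_iff_ne_zero.2 hu0) hu).ne'
      (ENNReal.rpow_ne_top_of_nonneg hs' hu)).1 h
  have hpow := ENNReal.rpow_le_rpow hroot hs0.le
  rwa [ENNReal.mul_rpow_of_nonneg _ _ hs0.le, ← ENNReal.rpow_mul, ← ENNReal.rpow_mul,
    one_div_mul_cancel hs0.ne', ENNReal.rpow_one, ENNReal.rpow_one] at hpow

/-- A family of sets any two of which are disjoint or nested, as the cells of a dyadic grid. -/
def IsLaminar {X ι : Type*} (A : ι → Set X) : Prop :=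
  ∀ i j, Disjoint (A i) (A j) ∨ A i ⊆ A j ∨ A j ⊆ A i

variable {X ι : Type*} {A E : ι → Set X}

lemma IsLaminar.exists_forall_mem_subset (hA : IsLaminar A) {T : Finset ι} (hT : T.Nonempty) :
    ∃ a ∈ T, ∀ x ∈ A a, ∀ j ∈ T, x ∈ A j → A a ⊆ A j := by
  obtain ⟨a, ha⟩ := T.exists_minimalFor A hT
  refine ⟨a, ha.1, fun x hxa j hj hxj => ?_⟩
  rcases hA a j with hdisj | hsub | hsub
  · exact absurd hxj (Set.disjoint_left.1 hdisj hxa)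
  · exact hsub
  · exact ha.2 hj hsub

lemma sum_indicator_rpow_le_erase_add {a : ι} {T : Finset ι} [DecidableEq ι] (haT : a ∈ T)
    (hmin : ∀ x ∈ A a, ∀ j ∈ T, x ∈ A j → A a ⊆ A j) (c : ι → ℝ≥0∞) {s : ℝ} (hs : 1 ≤ s) (x : X) :
    (∑ i ∈ T, (A i).indicator (fun _ => c i) x) ^ s ≤
      (∑ i ∈ T.erase a, (A i).indicator (fun _ => c i) x) ^ s +
        (A a).indicator (fun _ => ENNReal.ofReal s * (c a *
          (⨅ y ∈ A a, ∑ i ∈ T, (A i).indicator (fun _ => c i) y) ^ (s - 1))) x := by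
  have : 0 ≤ s - 1 := by linarith
  have hsum := (Finset.sum_erase_add T (fun i => (A i).indicator (fun _ => c i) x) haT).symm
  by_cases hx : x ∈ A a
  · have hle : ∑ i ∈ T, (A i).indicator (fun _ => c i) x ≤
        ⨅ y ∈ A a, ∑ i ∈ T, (A i).indicator (fun _ => c i) y := by
      refine le_iInf₂ fun y hy => Finset.sum_le_sum fun j hj => ?_
      by_cases hxj : x ∈ A j
      · rw [Set.indicator_of_mem hxj, Set.indicator_of_mem (hmin x hx j hj hxj hy)]
      · simp [hxj]
    simp only [Set.indicator_of_mem hx] at hsum ⊢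
    rw [hsum] at hle
    rw [hsum]
    exact (ennreal_add_rpow_le _ _ hs).trans (by gcongr)
  · simp [hsum, hx]

variable [MeasurableSpace X] {μ : Measure X}

lemma measurable_sum_indicator_const (hA : ∀ i, MeasurableSet (A i)) (c : ι → ℝ≥0∞)
    (T : Finset ι) : Measurable fun x => ∑ i ∈ T, (A i).indicator (fun _ => c i) x :=
  Finset.measurable_sum _ fun i _ => measurable_const.indicator (hA i)

-- Peel off a minimal set: it lies in every set it meets, so on it the sum equals its infimum there.
lemma IsLaminar.lintegral_sum_indicator_rpow_le_sum (hlam : IsLaminar A)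
    (hA : ∀ i, MeasurableSet (A i)) (c : ι → ℝ≥0∞) {s : ℝ} (hs : 1 ≤ s) (T : Finset ι) :
    ∫⁻ x, (∑ i ∈ T, (A i).indicator (fun _ => c i) x) ^ s ∂μ ≤
      ENNReal.ofReal s * ∑ i ∈ T, c i *
        (⨅ x ∈ A i, ∑ j ∈ T, (A j).indicator (fun _ => c j) x) ^ (s - 1) * μ (A i) := by
  classical
  have hs0 : 0 < s := by linarith
  have : 0 ≤ s - 1 := by linarith
  induction T using Finset.strongInduction with
  | H T ih =>
  rcases T.eq_empty_or_nonempty with rfl | hT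
  · simp [hs0]
  obtain ⟨a, haT, hmin⟩ := hlam.exists_forall_mem_subset hT
  set G : Finset ι → X → ℝ≥0∞ := fun T x => ∑ i ∈ T, (A i).indicator (fun _ => c i) x
  set inf : Finset ι → ι → ℝ≥0∞ := fun T i => ⨅ x ∈ A i, G T x
  calc ∫⁻ x, G T x ^ s ∂μ
      ≤ ∫⁻ x, (G (T.erase a) x ^ s +
          (A a).indicator (fun _ => ENNReal.ofReal s * (c a * inf T a ^ (s - 1))) x) ∂μ :=
        lintegral_mono (sum_indicator_rpow_le_erase_add haT hmin c hs)
    _ = ∫⁻ x, G (T.erase a) x ^ s ∂μ +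
          ENNReal.ofReal s * (c a * inf T a ^ (s - 1)) * μ (A a) := by
        rw [lintegral_add_left ((measurable_sum_indicator_const hA c _).pow_const s),
          lintegral_indicator_const (hA a)]
    _ ≤ ENNReal.ofReal s * ∑ i ∈ T.erase a, c i * inf T i ^ (s - 1) * μ (A i) +
          ENNReal.ofReal s * (c a * inf T a ^ (s - 1)) * μ (A a) := by
        gcongr
        refine (ih _ (Finset.erase_ssubset haT)).trans ?_
        gcongr
        exact iInf₂_mono fun x _ => Finset.sum_le_sum_of_subset (T.erase_subset a)
    _ = ENNReal.ofReal s * ∑ i ∈ T, c i * inf T i ^ (s - 1) * μ (A i) := by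
        rw [← Finset.sum_erase_add _ _ haT]; ring

lemma IsLaminar.lintegral_sum_indicator_rpow_le_lintegral_mul (hlam : IsLaminar A)
    (hA : ∀ i, MeasurableSet (A i)) (hE : ∀ i, MeasurableSet (E i)) (hEA : ∀ i, E i ⊆ A i)
    {C : ℝ≥0} (hC : ∀ i, μ (A i) ≤ C * μ (E i)) (c : ι → ℝ≥0∞) {s : ℝ} (hs : 1 ≤ s)
    (T : Finset ι) :
    ∫⁻ x, (∑ i ∈ T, (A i).indicator (fun _ => c i) x) ^ s ∂μ ≤ ENNReal.ofReal s * C *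
      ∫⁻ x, (∑ i ∈ T, (E i).indicator (fun _ => c i) x) *
        (∑ i ∈ T, (A i).indicator (fun _ => c i) x) ^ (s - 1) ∂μ := by
  have : 0 ≤ s - 1 := by linarith
  set G : X → ℝ≥0∞ := fun x => ∑ i ∈ T, (A i).indicator (fun _ => c i) x
  have hG : Measurable G := measurable_sum_indicator_const hA c T
  rw [mul_assoc]
  refine (hlam.lintegral_sum_indicator_rpow_le_sum hA c hs T).trans ?_
  gcongr
  calc ∑ i ∈ T, c i * (⨅ x ∈ A i, G x) ^ (s - 1) * μ (A i)
      ≤ ∑ i ∈ T, C * ∫⁻ x, (E i).indicator (fun _ => c i) x * G x ^ (s - 1) ∂μ := by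
        refine Finset.sum_le_sum fun i _ => ?_
        calc c i * (⨅ x ∈ A i, G x) ^ (s - 1) * μ (A i)
            ≤ c i * (⨅ x ∈ A i, G x) ^ (s - 1) * (C * μ (E i)) := by gcongr; exact hC i
          _ = C * ∫⁻ x, (E i).indicator (fun _ => c i * (⨅ x ∈ A i, G x) ^ (s - 1)) x ∂μ := by
              rw [lintegral_indicator_const (hE i)]; ring
          _ ≤ C * ∫⁻ x, (E i).indicator (fun _ => c i) x * G x ^ (s - 1) ∂μ := by
              gcongr with x
              by_cases hx : x ∈ E i
              · rw [Set.indicator_of_mem hx, Set.indicator_of_mem hx]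
                gcongr
                exact iInf₂_le x (hEA i hx)
              · simp [hx]
    _ = C * ∫⁻ x, (∑ i ∈ T, (E i).indicator (fun _ => c i) x) * G x ^ (s - 1) ∂μ := by
        simp_rw [← Finset.mul_sum, Finset.sum_mul]
        rw [lintegral_finsetSum]
        exact fun i _ => (measurable_const.indicator (hE i)).mul (hG.pow_const _)

lemma lintegral_sum_indicator_rpow_ne_top (hA : ∀ i, MeasurableSet (A i)) {c : ι → ℝ≥0∞} {s : ℝ}
    (hs : 1 ≤ s) {T : Finset ι} (hfin : ∀ i ∈ T, c i ^ s * μ (A i) ≠ ∞) :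
    ∫⁻ x, (∑ i ∈ T, (A i).indicator (fun _ => c i) x) ^ s ∂μ ≠ ∞ := by
  have hs0 : 0 < s := by linarith
  have hbound : ∫⁻ x, (∑ i ∈ T, (A i).indicator (fun _ => c i) x) ^ s ∂μ ≤
      (T.card : ℝ≥0∞) ^ (s - 1) * ∑ i ∈ T, c i ^ s * μ (A i) := by
    calc ∫⁻ x, (∑ i ∈ T, (A i).indicator (fun _ => c i) x) ^ s ∂μ
        ≤ ∫⁻ x, (T.card : ℝ≥0∞) ^ (s - 1) * ∑ i ∈ T, (A i).indicator (fun _ => c i ^ s) x ∂μ := by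
          refine lintegral_mono fun x => (ENNReal.rpow_sum_le_const_mul_sum_rpow T
            (fun i => (A i).indicator (fun _ => c i) x) hs).trans_eq ?_
          congr! 2 with i
          by_cases hx : x ∈ A i <;> simp [hx, hs0]
      _ = (T.card : ℝ≥0∞) ^ (s - 1) * ∑ i ∈ T, c i ^ s * μ (A i) := by
          rw [lintegral_const_mul _ (measurable_sum_indicator_const hA _ T),
            lintegral_finsetSum _ fun i _ => measurable_const.indicator (hA i)]
          simp_rw [lintegral_indicator_const (hA _)]
  refine ne_top_of_le_ne_top (ENNReal.mul_ne_top ?_ (ENNReal.sum_ne_top.2 hfin)) hbound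
  exact ENNReal.rpow_ne_top_of_nonneg (by linarith) (ENNReal.natCast_ne_top _)

lemma rpow_mul_measure_le_lintegral_sum_indicator_rpow (hE : ∀ i, MeasurableSet (E i))
    (c : ι → ℝ≥0∞) {s : ℝ} (hs : 0 ≤ s) {T : Finset ι} {i : ι} (hi : i ∈ T) :
    c i ^ s * μ (E i) ≤ ∫⁻ x, (∑ i ∈ T, (E i).indicator (fun _ => c i) x) ^ s ∂μ := by
  rw [← lintegral_indicator_const (hE i)]
  refine lintegral_mono fun x => ?_
  by_cases hx : x ∈ E i
  · rw [Set.indicator_of_mem hx]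
    gcongr
    calc c i = (E i).indicator (fun _ => c i) x := (Set.indicator_of_mem hx fun _ => c i).symm
      _ ≤ ∑ i ∈ T, (E i).indicator (fun _ => c i) x := Finset.single_le_sum
          (f := fun i => (E i).indicator (fun _ => c i) x) (fun _ _ => bot_le) hi
  · simp [hx]

lemma IsLaminar.lintegral_sum_indicator_rpow_le (hlam : IsLaminar A)
    (hA : ∀ i, MeasurableSet (A i)) (hE : ∀ i, MeasurableSet (E i)) (hEA : ∀ i, E i ⊆ A i)
    {C : ℝ≥0} (hC : ∀ i, μ (A i) ≤ C * μ (E i)) (c : ι → ℝ≥0∞) {s : ℝ} (hs : 1 ≤ s)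
    (T : Finset ι) :
    ∫⁻ x, (∑ i ∈ T, (A i).indicator (fun _ => c i) x) ^ s ∂μ ≤ (ENNReal.ofReal s * C) ^ s *
      ∫⁻ x, (∑ i ∈ T, (E i).indicator (fun _ => c i) x) ^ s ∂μ := by
  have hmain := hlam.lintegral_sum_indicator_rpow_le_lintegral_mul hA hE hEA hC c hs T
  rcases hs.eq_or_lt with rfl | hs1
  · simpa using hmain
  have hs0 : 0 < s := by linarith
  set G : X → ℝ≥0∞ := fun x => ∑ i ∈ T, (A i).indicator (fun _ => c i) x
  set H : X → ℝ≥0∞ := fun x => ∑ i ∈ T, (E i).indicator (fun _ => c i) x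
  have hG : Measurable G := measurable_sum_indicator_const hA c T
  have hH : Measurable H := measurable_sum_indicator_const hE c T
  have hholder : ∫⁻ x, H x * G x ^ (s - 1) ∂μ ≤
      (∫⁻ x, H x ^ s ∂μ) ^ (1 / s) * (∫⁻ x, G x ^ s ∂μ) ^ ((s - 1) / s) := by
    have h := ENNReal.lintegral_mul_le_Lp_mul_Lq μ (HolderConjugate.conjExponent hs1)
      hH.aemeasurable (hG.pow_const (s - 1)).aemeasurable
    simpa only [Pi.mul_apply, conjExponent, ← ENNReal.rpow_mul,
      mul_div_cancel₀ s (sub_pos.2 hs1).ne', one_div_div] using h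
  by_cases hfin : ∀ i ∈ T, c i ^ s * μ (A i) ≠ ∞
  · exact le_rpow_mul_of_le_mul_rpow hs (lintegral_sum_indicator_rpow_ne_top hA hs hfin)
      (hmain.trans (by gcongr))
  · push Not at hfin
    obtain ⟨i, hi, htop⟩ := hfin
    have hCH : (C : ℝ≥0∞) * ∫⁻ x, H x ^ s ∂μ = ∞ := by
      refine top_le_iff.1 (htop ▸ ?_)
      calc c i ^ s * μ (A i) ≤ c i ^ s * (C * μ (E i)) := by gcongr; exact hC i
        _ = C * (c i ^ s * μ (E i)) := by ring
        _ ≤ C * ∫⁻ x, H x ^ s ∂μ := by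
            gcongr
            exact rpow_mul_measure_le_lintegral_sum_indicator_rpow hE c hs0.le hi
    obtain ⟨hC0, hHtop⟩ | ⟨hCtop, -⟩ := ENNReal.mul_eq_top.1 hCH
    · have : ENNReal.ofReal s * C ≠ 0 := mul_ne_zero (by simpa using hs0) hC0
      rw [hHtop, ENNReal.mul_top (ENNReal.rpow_pos (pos_iff_ne_zero.2 this) (by finiteness)).ne']
      exact le_top
    · exact absurd hCtop ENNReal.coe_ne_top

lemma IsLaminar.lintegral_tsum_indicator_rpow_le (hlam : IsLaminar A)
    (hA : ∀ i, MeasurableSet (A i)) (hE : ∀ i, MeasurableSet (E i)) (hEA : ∀ i, E i ⊆ A i)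
    {C : ℝ≥0} (hC : ∀ i, μ (A i) ≤ C * μ (E i)) [Countable ι] (c : ι → ℝ≥0∞) {s : ℝ}
    (hs : 1 ≤ s) :
    ∫⁻ x, (∑' i, (A i).indicator (fun _ => c i) x) ^ s ∂μ ≤ (ENNReal.ofReal s * C) ^ s *
      ∫⁻ x, (∑' i, (E i).indicator (fun _ => c i) x) ^ s ∂μ := by
  have hs0 : 0 < s := by linarith
  have hsup : ∀ x, (∑' i, (A i).indicator (fun _ => c i) x) ^ s =
      ⨆ T : Finset ι, (∑ i ∈ T, (A i).indicator (fun _ => c i) x) ^ s := fun x => by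
    rw [ENNReal.tsum_eq_iSup_sum, ← ENNReal.orderIsoRpow_apply s hs0, OrderIso.map_iSup]
    rfl
  simp_rw [hsup]
  rw [lintegral_iSup_directed]
  · refine iSup_le fun T => (hlam.lintegral_sum_indicator_rpow_le hA hE hEA hC c hs T).trans ?_
    gcongr
    exact ENNReal.sum_le_tsum _
  · exact fun T => ((measurable_sum_indicator_const hA c T).pow_const s).aemeasurable
  · refine Monotone.directed_le fun T T' hT x => ?_
    exact ENNReal.rpow_le_rpow (Finset.sum_le_sum_of_subset hT) hs0.le

end Laminar

/-- A refining sequence of partitions: `x` lies in the cell of generation `t` labelled `label t x`,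
and `parent t` sends the label of a cell of generation `t + 1` to that of the generation-`t` cell
containing it. -/
structure CellTree (X Z : Type*) where
  label : ℕ → X → Z
  parent : ℕ → Z → Z
  label_eq_parent : ∀ t x, label t x = parent t (label (t + 1) x)

namespace CellTree

variable {X Z : Type*} (𝒯 : CellTree X Z) (bad : ℕ × Z → ℕ × Z → Prop)

/-- The cell with generation `S.1` and label `S.2`. -/
def cell (S : ℕ × Z) : Set X := {x | 𝒯.label S.1 x = S.2}

open Classical in
/-- The principal cell of a cell: the smallest stopping cell containing it. Going down the tree, a
cell becomes a new stopping cell when it is `bad` relative to the current one. -/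
def principal : ℕ → Z → ℕ × Z
  | 0, z => (0, z)
  | t + 1, z => if bad (t + 1, z) (principal t (𝒯.parent t z)) then (t + 1, z)
      else principal t (𝒯.parent t z)

/-- The principal cell of the generation-`t` cell containing `x`. -/
def principalAt (t : ℕ) (x : X) : ℕ × Z := 𝒯.principal bad t (𝒯.label t x)

/-- The stopping cells, that is, the cells which are their own principal cell. -/
abbrev StopCell : Type _ := {S : ℕ × Z // 𝒯.principal bad S.1 S.2 = S}

/-- The points of a stopping cell that lie in no smaller stopping cell. -/
def coreSet (S : ℕ × Z) : Set X := {x | ∀ t, S.1 ≤ t → 𝒯.principalAt bad t x = S}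

/-- The maximal stopping cells strictly inside the stopping cell `S`. -/
def stopChildren (S : ℕ × Z) : Set (ℕ × Z) :=
  {C | ∃ t z, C = (t + 1, z) ∧ S.1 ≤ t ∧ 𝒯.principal bad t (𝒯.parent t z) = S ∧ bad C S}

open Classical in
/-- The number of stopping cells of generation at least `u` that contain `x`. -/
def stopCount (u : ℕ) (x : X) : ℝ≥0∞ :=
  ∑' v, if u ≤ v ∧ 𝒯.principalAt bad v x = (v, 𝒯.label v x) then 1 else 0

variable {𝒯 bad}

lemma principalAt_zero (x : X) : 𝒯.principalAt bad 0 x = (0, 𝒯.label 0 x) := rfl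

lemma principalAt_succ_of_bad {t : ℕ} {x : X}
    (h : bad (t + 1, 𝒯.label (t + 1) x) (𝒯.principalAt bad t x)) :
    𝒯.principalAt bad (t + 1) x = (t + 1, 𝒯.label (t + 1) x) := by
  rw [principalAt, 𝒯.label_eq_parent t] at h
  exact if_pos h

lemma principalAt_succ_of_not_bad {t : ℕ} {x : X}
    (h : ¬ bad (t + 1, 𝒯.label (t + 1) x) (𝒯.principalAt bad t x)) :
    𝒯.principalAt bad (t + 1) x = 𝒯.principalAt bad t x := by
  rw [principalAt, 𝒯.label_eq_parent t] at h
  rw [principalAt, principalAt, 𝒯.label_eq_parent t]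
  exact if_neg h

lemma principalAt_succ_eq_or (t : ℕ) (x : X) :
    𝒯.principalAt bad (t + 1) x = (t + 1, 𝒯.label (t + 1) x) ∨
      𝒯.principalAt bad (t + 1) x = 𝒯.principalAt bad t x := by
  by_cases h : bad (t + 1, 𝒯.label (t + 1) x) (𝒯.principalAt bad t x)
  · exact .inl (principalAt_succ_of_bad h)
  · exact .inr (principalAt_succ_of_not_bad h)

lemma principalAt_eq_or_not_bad (t : ℕ) (x : X) :
    𝒯.principalAt bad t x = (t, 𝒯.label t x) ∨
      ¬ bad (t, 𝒯.label t x) (𝒯.principalAt bad t x) := by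
  cases t with
  | zero => exact .inl rfl
  | succ t =>
    by_cases h : bad (t + 1, 𝒯.label (t + 1) x) (𝒯.principalAt bad t x)
    · exact .inl (principalAt_succ_of_bad h)
    · exact .inr (by rwa [principalAt_succ_of_not_bad h])

lemma principalAt_fst_le (t : ℕ) (x : X) : (𝒯.principalAt bad t x).1 ≤ t := by
  induction t with
  | zero => exact le_rfl
  | succ t ih =>
    rcases principalAt_succ_eq_or (𝒯 := 𝒯) (bad := bad) t x with h | h <;> rw [h]
    exact ih.trans t.le_succ

lemma mem_cell_principalAt (t : ℕ) (x : X) : x ∈ 𝒯.cell (𝒯.principalAt bad t x) := by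
  induction t with
  | zero => rfl
  | succ t ih =>
    rcases principalAt_succ_eq_or (𝒯 := 𝒯) (bad := bad) t x with h | h <;> rw [h]
    · rfl
    · exact ih

lemma principalAt_principalAt (t : ℕ) (x : X) :
    𝒯.principalAt bad (𝒯.principalAt bad t x).1 x = 𝒯.principalAt bad t x := by
  induction t with
  | zero => rfl
  | succ t ih =>
    rcases principalAt_succ_eq_or (𝒯 := 𝒯) (bad := bad) t x with h | h
    · simp only [h]
    · rw [h, ih]

lemma principalAt_fst_mono (x : X) : Monotone fun t => (𝒯.principalAt bad t x).1 := by
  refine monotone_nat_of_le_succ fun t => ?_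
  rcases principalAt_succ_eq_or (𝒯 := 𝒯) (bad := bad) t x with h | h <;> rw [h]
  exact (principalAt_fst_le t x).trans t.le_succ

lemma principalAt_of_mem_cell (S : 𝒯.StopCell bad) {x : X} (hx : x ∈ 𝒯.cell S.1) :
    𝒯.principalAt bad S.1.1 x = S.1 := by
  rw [principalAt, show 𝒯.label S.1.1 x = S.1.2 from hx, S.2]

lemma label_eq_of_le {t u : ℕ} (htu : t ≤ u) {x y : X} (h : 𝒯.label u x = 𝒯.label u y) :
    𝒯.label t x = 𝒯.label t y := by
  induction u, htu using Nat.le_induction with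
  | base => exact h
  | succ u _ ih => exact ih (by rw [𝒯.label_eq_parent u x, 𝒯.label_eq_parent u y, h])

lemma disjoint_or_cell_subset {S T : ℕ × Z} (h : S.1 ≤ T.1) :
    Disjoint (𝒯.cell S) (𝒯.cell T) ∨ 𝒯.cell T ⊆ 𝒯.cell S := by
  refine or_iff_not_imp_left.2 fun hdisj y hy => ?_
  obtain ⟨x, hxS, hxT⟩ := Set.not_disjoint_iff.1 hdisj
  have hyx : 𝒯.label T.1 y = 𝒯.label T.1 x := Eq.trans hy (Eq.symm hxT)
  exact (label_eq_of_le h hyx).trans hxS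

lemma isLaminar_cell {ι : Type*} (u : ι → ℕ × Z) : IsLaminar fun i => 𝒯.cell (u i) := by
  intro i j
  rcases le_total (u i).1 (u j).1 with h | h
  · exact (disjoint_or_cell_subset h).imp_right .inr
  · exact (disjoint_or_cell_subset h).imp (fun hd => hd.symm) .inl

lemma coreSet_subset_cell (S : ℕ × Z) : 𝒯.coreSet bad S ⊆ 𝒯.cell S := by
  intro x hx
  have h := mem_cell_principalAt (𝒯 := 𝒯) (bad := bad) S.1 x
  rwa [hx S.1 le_rfl] at h

lemma disjoint_coreSet {S T : ℕ × Z} (h : S ≠ T) :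
    Disjoint (𝒯.coreSet bad S) (𝒯.coreSet bad T) :=
  Set.disjoint_left.2 fun _ hS hT =>
    h ((hS _ (le_max_left S.1 T.1)).symm.trans (hT _ (le_max_right S.1 T.1)))

lemma tsum_indicator_coreSet_le (c : 𝒯.StopCell bad → ℝ≥0∞) {x : X} {g : ℝ≥0∞}
    (h : ∀ S, x ∈ 𝒯.coreSet bad S.1 → c S ≤ g) :
    ∑' S : 𝒯.StopCell bad, (𝒯.coreSet bad S.1).indicator (fun _ => c S) x ≤ g := by
  by_cases hex : ∃ S : 𝒯.StopCell bad, x ∈ 𝒯.coreSet bad S.1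
  · obtain ⟨S, hS⟩ := hex
    rw [tsum_eq_single S fun T hT => Set.indicator_of_notMem (fun hxT =>
      Set.disjoint_left.1 (disjoint_coreSet fun h => hT (Subtype.ext h)) hxT hS) _,
      Set.indicator_of_mem hS]
    exact h S hS
  · push Not at hex
    simp [hex]

lemma cell_diff_coreSet_subset (S : 𝒯.StopCell bad) :
    𝒯.cell S.1 \ 𝒯.coreSet bad S.1 ⊆ ⋃ C ∈ 𝒯.stopChildren bad S.1, 𝒯.cell C := by
  rintro x ⟨hx, hcore⟩
  by_contra hchild
  refine hcore fun t ht => ?_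
  induction t, ht using Nat.le_induction with
  | base => exact principalAt_of_mem_cell S hx
  | succ t ht ih =>
    rw [principalAt_succ_of_not_bad, ih]
    intro h
    refine hchild (Set.mem_biUnion (x := (t + 1, 𝒯.label (t + 1) x)) ⟨t, _, rfl, ht, ?_, ?_⟩ rfl)
    · rw [← 𝒯.label_eq_parent t x]; exact ih
    · rwa [ih] at h

lemma principalAt_of_mem_cell_stopChildren {S C : ℕ × Z} (hC : C ∈ 𝒯.stopChildren bad S)
    {x : X} (hx : x ∈ 𝒯.cell C) : ∃ t, C.1 = t + 1 ∧
      𝒯.principalAt bad t x = S ∧ 𝒯.principalAt bad (t + 1) x = C := by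
  obtain ⟨t, z, rfl, -, hS, hbad⟩ := hC
  have hz : 𝒯.label (t + 1) x = z := hx
  have hxS : 𝒯.principalAt bad t x = S := by rw [principalAt, 𝒯.label_eq_parent t x, hz, hS]
  refine ⟨t, rfl, hxS, ?_⟩
  rw [principalAt_succ_of_bad (by rwa [hxS, hz]), hz]

lemma cell_subset_of_mem_stopChildren {S C : ℕ × Z} (hC : C ∈ 𝒯.stopChildren bad S) :
    𝒯.cell C ⊆ 𝒯.cell S := by
  intro x hx
  obtain ⟨t, -, hxS, -⟩ := principalAt_of_mem_cell_stopChildren hC hx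
  exact hxS ▸ mem_cell_principalAt t x

lemma pairwiseDisjoint_cell_stopChildren (S : ℕ × Z) :
    (𝒯.stopChildren bad S).PairwiseDisjoint 𝒯.cell := by
  refine fun C hC D hD hne => Set.disjoint_left.2 fun x hxC hxD => hne ?_
  obtain ⟨t, htC, hSt, hCt⟩ := principalAt_of_mem_cell_stopChildren hC hxC
  obtain ⟨u, huD, hSu, hDu⟩ := principalAt_of_mem_cell_stopChildren hD hxD
  have hmono := principalAt_fst_mono (𝒯 := 𝒯) (bad := bad) x
  have hle : ∀ {t u : ℕ}, t + 1 ≤ u →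
      (𝒯.principalAt bad (t + 1) x).1 ≤ (𝒯.principalAt bad u x).1 := fun h => hmono h
  have hSlt := principalAt_fst_le (𝒯 := 𝒯) (bad := bad) t x
  have hSle := principalAt_fst_le (𝒯 := 𝒯) (bad := bad) u x
  rw [hSt] at hSlt
  rw [hSu] at hSle
  rcases lt_trichotomy t u with h | rfl | h
  · have := hle h
    rw [hCt, hSu] at this
    omega
  · rw [← hCt, hDu]
  · have := hle h
    rw [hDu, hSt] at this
    omega

lemma one_le_stopCount_principalAt (t : ℕ) (x : X) :
    1 ≤ 𝒯.stopCount bad (𝒯.principalAt bad t x).1 x := by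
  classical
  refine le_trans ?_ (ENNReal.le_tsum (𝒯.principalAt bad t x).1)
  rw [if_pos ⟨le_rfl, (principalAt_principalAt t x).trans
    (Prod.ext rfl (mem_cell_principalAt t x).symm)⟩]

lemma stopCount_le_tsum (u : ℕ) (x : X) : 𝒯.stopCount bad u x ≤
    ∑' S : 𝒯.StopCell bad, if u ≤ S.1.1 then (𝒯.cell S.1).indicator (fun _ => 1) x else 0 := by
  classical
  let s : Set ℕ := {v | u ≤ v ∧ 𝒯.principalAt bad v x = (v, 𝒯.label v x)}
  let g : s → 𝒯.StopCell bad := fun v => ⟨(v.1, 𝒯.label v.1 x), v.2.2⟩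
  have hg : Function.Injective g := fun v w h => Subtype.ext (congrArg (fun S => S.1.1) h)
  calc 𝒯.stopCount bad u x = ∑' _ : s, 1 := by
        rw [tsum_subtype s fun _ => 1]
        exact tsum_congr fun v => (Set.indicator_apply s (fun _ => 1) v).symm
    _ = ∑' v : s, if u ≤ (g v).1.1 then (𝒯.cell (g v).1).indicator (fun _ => 1) x else 0 :=
        tsum_congr fun v => by
          rw [if_pos v.2.1, Set.indicator_of_mem (show x ∈ 𝒯.cell (g v).1 from rfl)]
    _ ≤ _ := ENNReal.tsum_comp_le_tsum_of_injective hg _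

open Classical in
lemma abs_principalAt_sub_le_sum (β : ℕ → ℝ) {κ κ' : ℝ} {x : X}
    (hκ : ∀ t, |β t - β (𝒯.principalAt bad t x).1| ≤ κ) (hstep : ∀ t, |β (t + 1) - β t| ≤ κ')
    {u : ℕ} (hu : 𝒯.principalAt bad u x = (u, 𝒯.label u x)) {t : ℕ} (hut : u ≤ t) :
    |β (𝒯.principalAt bad t x).1 - β u| ≤ (κ + κ') *
      ∑ v ∈ Finset.Ioc u t, if 𝒯.principalAt bad v x = (v, 𝒯.label v x) then 1 else 0 := by
  induction t, hut using Nat.le_induction with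
  | base => simp [hu]
  | succ t ht ih =>
    rw [Finset.sum_Ioc_succ_top ht, mul_add]
    have hnonneg : 0 ≤ κ + κ' :=
      add_nonneg ((abs_nonneg _).trans (hκ 0)) ((abs_nonneg _).trans (hstep 0))
    rcases principalAt_succ_eq_or (𝒯 := 𝒯) (bad := bad) t x with h | h
    · rw [if_pos h, h]
      have h1 := abs_sub_le (β (t + 1)) (β t) (β u)
      have h2 := abs_sub_le (β t) (β (𝒯.principalAt bad t x).1) (β u)
      linarith [hκ t, hstep t]
    · rw [h]
      refine ih.trans (le_add_of_nonneg_right (mul_nonneg hnonneg ?_))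
      split_ifs <;> norm_num

lemma ofReal_abs_sub_le_stopCount (β : ℕ → ℝ) {κ κ' : ℝ≥0} {x : X}
    (hκ : ∀ t, |β t - β (𝒯.principalAt bad t x).1| ≤ κ) (hstep : ∀ t, |β (t + 1) - β t| ≤ κ')
    {u : ℕ} (hu : 𝒯.principalAt bad u x = (u, 𝒯.label u x)) {t : ℕ} (hut : u ≤ t) :
    ENNReal.ofReal |β t - β u| ≤ (κ + κ') * 𝒯.stopCount bad u x := by
  classical
  set p : ℕ → Prop := fun v => 𝒯.principalAt bad v x = (v, 𝒯.label v x)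
  set N : ℝ := ∑ v ∈ Finset.Icc u t, if p v then 1 else 0 with hN
  have hreal : |β t - β u| ≤ (κ + κ' : ℝ≥0) * N := by
    rw [hN, ← Finset.sum_Ioc_add_eq_sum_Icc hut, if_pos hu, mul_add, mul_one, NNReal.coe_add]
    have h1 := abs_principalAt_sub_le_sum β hκ hstep hu hut
    have h2 := abs_sub_le (β t) (β (𝒯.principalAt bad t x).1) (β u)
    linarith [hκ t, κ'.coe_nonneg]
  have hcount : ENNReal.ofReal N ≤ 𝒯.stopCount bad u x := by
    rw [hN, ENNReal.ofReal_sum_of_nonneg fun v _ => by split_ifs <;> norm_num]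
    refine le_trans (Finset.sum_le_sum fun v hv => ?_) (ENNReal.sum_le_tsum (Finset.Icc u t))
    rw [if_congr (and_iff_right (Finset.mem_Icc.1 hv).1) rfl rfl]
    split_ifs <;> simp
  calc ENNReal.ofReal |β t - β u| ≤ ENNReal.ofReal ((κ + κ' : ℝ≥0) * N) :=
        ENNReal.ofReal_le_ofReal hreal
    _ = (κ + κ') * ENNReal.ofReal N := by
        rw [ENNReal.ofReal_mul NNReal.zero_le_coe, ENNReal.ofReal_coe_nnreal, ENNReal.coe_add]
    _ ≤ (κ + κ') * 𝒯.stopCount bad u x := by gcongr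

open Classical in
/-- The sum of the coefficients of all stopping cells containing a given one. -/
def ancestorSum (c : 𝒯.StopCell bad → ℝ≥0∞) (S : 𝒯.StopCell bad) : ℝ≥0∞ :=
  ∑' R, if 𝒯.cell S.1 ⊆ 𝒯.cell R.1 then c R else 0

lemma tsum_indicator_cell_mul_stopCount_le (c : 𝒯.StopCell bad → ℝ≥0∞) (x : X) :
    ∑' S : 𝒯.StopCell bad,
      (𝒯.cell S.1).indicator (fun _ => c S) x * 𝒯.stopCount bad S.1.1 x ≤
    ∑' S : 𝒯.StopCell bad, (𝒯.cell S.1).indicator (fun _ => ancestorSum c S) x := by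
  calc ∑' R : 𝒯.StopCell bad,
        (𝒯.cell R.1).indicator (fun _ => c R) x * 𝒯.stopCount bad R.1.1 x
      ≤ ∑' R : 𝒯.StopCell bad, (𝒯.cell R.1).indicator (fun _ => c R) x *
          ∑' S : 𝒯.StopCell bad,
            if R.1.1 ≤ S.1.1 then (𝒯.cell S.1).indicator (fun _ => 1) x else 0 := by
        gcongr with R
        exact stopCount_le_tsum R.1.1 x
    _ = ∑' S : 𝒯.StopCell bad, ∑' R : 𝒯.StopCell bad,
          (𝒯.cell R.1).indicator (fun _ => c R) x *
            if R.1.1 ≤ S.1.1 then (𝒯.cell S.1).indicator (fun _ => 1) x else 0 := by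
        simp_rw [← ENNReal.tsum_mul_left]
        exact ENNReal.tsum_comm
    _ ≤ _ := by
        refine ENNReal.tsum_le_tsum fun S => ?_
        by_cases hS : x ∈ 𝒯.cell S.1
        · simp only [Set.indicator_of_mem hS]
          refine ENNReal.tsum_le_tsum fun R => ?_
          by_cases hR : x ∈ 𝒯.cell R.1
          · by_cases hle : R.1.1 ≤ S.1.1
            · have hsub : 𝒯.cell S.1 ⊆ 𝒯.cell R.1 :=
                (disjoint_or_cell_subset hle).resolve_left
                  fun hd => Set.disjoint_left.1 hd hR hS
              rw [if_pos hle, if_pos hsub, Set.indicator_of_mem hR, mul_one]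
            · rw [if_neg hle, mul_zero]
              exact bot_le
          · rw [Set.indicator_of_notMem hR, zero_mul]
            exact bot_le
        · simp [hS]

lemma tsum_indicator_coreSet_ancestorSum_le (c : 𝒯.StopCell bad → ℝ≥0∞) (x : X) :
    ∑' S : 𝒯.StopCell bad, (𝒯.coreSet bad S.1).indicator (fun _ => ancestorSum c S) x ≤
      ∑' S : 𝒯.StopCell bad, (𝒯.cell S.1).indicator (fun _ => c S) x := by
  refine tsum_indicator_coreSet_le _ fun S hxS => ENNReal.tsum_le_tsum fun R => ?_
  split_ifs with hsub
  · rw [Set.indicator_of_mem (hsub (coreSet_subset_cell S.1 hxS))]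
  · exact bot_le

variable [MeasurableSpace X] {μ : Measure X}

lemma measurableSet_cell [MeasurableSpace Z] [MeasurableSingletonClass Z]
    (hlabel : ∀ t, Measurable (𝒯.label t)) (S : ℕ × Z) : MeasurableSet (𝒯.cell S) :=
  hlabel S.1 (measurableSet_singleton S.2)

lemma measurableSet_coreSet [MeasurableSpace Z] [DiscreteMeasurableSpace Z]
    (hlabel : ∀ t, Measurable (𝒯.label t)) (S : ℕ × Z) : MeasurableSet (𝒯.coreSet bad S) := by
  have : 𝒯.coreSet bad S = ⋂ t, ⋂ (_ : S.1 ≤ t), 𝒯.label t ⁻¹' {z | 𝒯.principal bad t z = S} := by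
    ext x; simp [coreSet, principalAt]
  rw [this]
  exact MeasurableSet.iInter fun t => MeasurableSet.iInter fun _ => hlabel t (.of_discrete)

lemma two_mul_tsum_measure_stopChildren_le {S : ℕ × Z}
    (hbad : ∀ T : Finset (ℕ × Z), (∀ C ∈ T, 𝒯.cell C ⊆ 𝒯.cell S) → (∀ C ∈ T, bad C S) →
      (T : Set (ℕ × Z)).PairwiseDisjoint 𝒯.cell → 2 * ∑ C ∈ T, μ (𝒯.cell C) ≤ μ (𝒯.cell S)) :
    2 * ∑' C : 𝒯.stopChildren bad S, μ (𝒯.cell C) ≤ μ (𝒯.cell S) := by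
  rw [ENNReal.tsum_eq_iSup_sum, ENNReal.mul_iSup]
  refine iSup_le fun T => ?_
  have hT : (T.map (Function.Embedding.subtype _) : Set (ℕ × Z)) ⊆ 𝒯.stopChildren bad S := by
    simp
  have h := hbad (T.map (Function.Embedding.subtype _))
    (fun C hC => cell_subset_of_mem_stopChildren (hT hC))
    (fun C hC => let ⟨_, _, _, _, _, h⟩ := hT hC; h)
    ((pairwiseDisjoint_cell_stopChildren S).subset hT)
  simpa using h

lemma measure_cell_le_two_mul_coreSet [Countable Z] (S : 𝒯.StopCell bad)
    (hfin : μ (𝒯.cell S.1) ≠ ∞)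
    (hbad : ∀ T : Finset (ℕ × Z), (∀ C ∈ T, 𝒯.cell C ⊆ 𝒯.cell S.1) → (∀ C ∈ T, bad C S.1) →
      (T : Set (ℕ × Z)).PairwiseDisjoint 𝒯.cell → 2 * ∑ C ∈ T, μ (𝒯.cell C) ≤ μ (𝒯.cell S.1)) :
    μ (𝒯.cell S.1) ≤ 2 * μ (𝒯.coreSet bad S.1) := by
  have hdiff : μ (𝒯.cell S.1 \ 𝒯.coreSet bad S.1) ≤
      ∑' C : 𝒯.stopChildren bad S.1, μ (𝒯.cell C) :=
    (measure_mono (cell_diff_coreSet_subset S)).trans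
      (measure_biUnion_le μ (Set.to_countable _) _)
  have hle : 2 * μ (𝒯.cell S.1) ≤ μ (𝒯.cell S.1) + 2 * μ (𝒯.coreSet bad S.1) := by
    calc 2 * μ (𝒯.cell S.1)
        ≤ 2 * (μ (𝒯.cell S.1 \ 𝒯.coreSet bad S.1) + μ (𝒯.coreSet bad S.1)) := by
          gcongr
          exact (measure_mono (Set.subset_sdiff_union _ _)).trans (measure_union_le _ _)
      _ ≤ 2 * ∑' C : 𝒯.stopChildren bad S.1, μ (𝒯.cell C) + 2 * μ (𝒯.coreSet bad S.1) := by
          rw [mul_add]; gcongr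
      _ ≤ μ (𝒯.cell S.1) + 2 * μ (𝒯.coreSet bad S.1) := by
          gcongr
          exact two_mul_tsum_measure_stopChildren_le hbad
  rw [two_mul] at hle
  exact (ENNReal.add_le_add_iff_left hfin).1 hle

variable [Countable Z] [MeasurableSpace Z] [DiscreteMeasurableSpace Z]

lemma lintegral_tsum_indicator_cell_rpow_le (hlabel : ∀ t, Measurable (𝒯.label t)) {C : ℝ≥0}
    (hC : ∀ S : 𝒯.StopCell bad, μ (𝒯.cell S.1) ≤ C * μ (𝒯.coreSet bad S.1))
    (c : 𝒯.StopCell bad → ℝ≥0∞) {s : ℝ} (hs : 1 ≤ s) :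
    ∫⁻ x, (∑' S : 𝒯.StopCell bad, (𝒯.cell S.1).indicator (fun _ => c S) x) ^ s ∂μ ≤
      (ENNReal.ofReal s * C) ^ s * ∫⁻ x, (∑' S : 𝒯.StopCell bad,
        (𝒯.coreSet bad S.1).indicator (fun _ => c S) x) ^ s ∂μ :=
  IsLaminar.lintegral_tsum_indicator_rpow_le (isLaminar_cell Subtype.val)
    (fun S => measurableSet_cell hlabel S.1) (fun S => measurableSet_coreSet hlabel S.1)
    (fun S => coreSet_subset_cell S.1) hC c hs

lemma lintegral_tsum_indicator_cell_mul_stopCount_rpow_le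
    (hlabel : ∀ t, Measurable (𝒯.label t)) {C : ℝ≥0}
    (hC : ∀ S : 𝒯.StopCell bad, μ (𝒯.cell S.1) ≤ C * μ (𝒯.coreSet bad S.1))
    (c : 𝒯.StopCell bad → ℝ≥0∞) {s : ℝ} (hs : 1 ≤ s) :
    ∫⁻ x, (∑' S : 𝒯.StopCell bad,
      (𝒯.cell S.1).indicator (fun _ => c S) x * 𝒯.stopCount bad S.1.1 x) ^ s ∂μ ≤
      (ENNReal.ofReal s * C) ^ s * ((ENNReal.ofReal s * C) ^ s *
        ∫⁻ x, (∑' S : 𝒯.StopCell bad, (𝒯.coreSet bad S.1).indicator (fun _ => c S) x) ^ s ∂μ) := by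
  have hs0 : 0 ≤ s := by linarith
  calc ∫⁻ x, (∑' S : 𝒯.StopCell bad,
        (𝒯.cell S.1).indicator (fun _ => c S) x * 𝒯.stopCount bad S.1.1 x) ^ s ∂μ
      ≤ ∫⁻ x, (∑' S : 𝒯.StopCell bad,
          (𝒯.cell S.1).indicator (fun _ => ancestorSum c S) x) ^ s ∂μ := by
        refine lintegral_mono fun x => ENNReal.rpow_le_rpow ?_ hs0
        exact tsum_indicator_cell_mul_stopCount_le c x
    _ ≤ (ENNReal.ofReal s * C) ^ s * ∫⁻ x, (∑' S : 𝒯.StopCell bad,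
          (𝒯.coreSet bad S.1).indicator (fun _ => ancestorSum c S) x) ^ s ∂μ :=
        lintegral_tsum_indicator_cell_rpow_le hlabel hC _ hs
    _ ≤ (ENNReal.ofReal s * C) ^ s * ∫⁻ x, (∑' S : 𝒯.StopCell bad,
          (𝒯.cell S.1).indicator (fun _ => c S) x) ^ s ∂μ := by
        refine mul_le_mul_right (lintegral_mono fun x => ENNReal.rpow_le_rpow ?_ hs0) _
        exact tsum_indicator_coreSet_ancestorSum_le c x
    _ ≤ _ := by
        gcongr
        exact lintegral_tsum_indicator_cell_rpow_le hlabel hC c hs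

lemma setLIntegral_stopCount_pow_le (hlabel : ∀ t, Measurable (𝒯.label t)) {C : ℝ≥0}
    (hC : ∀ S : 𝒯.StopCell bad, μ (𝒯.cell S.1) ≤ C * μ (𝒯.coreSet bad S.1)) (z : Z) (s : ℕ) :
    ∫⁻ x in 𝒯.cell (0, z), 𝒯.stopCount bad 0 x ^ s ∂μ ≤ (s * C) ^ s * μ (𝒯.cell (0, z)) := by
  rcases Nat.eq_zero_or_pos s with rfl | hs
  · simp
  set Q := 𝒯.cell (0, z)
  have hcell : ∀ S : 𝒯.StopCell bad, MeasurableSet (𝒯.cell S.1) :=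
    fun S => measurableSet_cell hlabel S.1
  have hcore : ∀ S : 𝒯.StopCell bad, MeasurableSet (𝒯.coreSet bad S.1) :=
    fun S => measurableSet_coreSet hlabel S.1
  have hrestrict : ∀ S : 𝒯.StopCell bad,
      μ.restrict Q (𝒯.cell S.1) ≤ C * μ.restrict Q (𝒯.coreSet bad S.1) := by
    intro S
    rw [Measure.restrict_apply (hcell S), Measure.restrict_apply (hcore S)]
    rcases disjoint_or_cell_subset (𝒯 := 𝒯) (S := (0, z)) (T := S.1) S.1.1.zero_le with hd | hsub
    · rw [Set.disjoint_iff_inter_eq_empty.1 hd.symm, measure_empty]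
      exact bot_le
    · rw [Set.inter_eq_left.2 hsub, Set.inter_eq_left.2 ((coreSet_subset_cell S.1).trans hsub)]
      exact hC S
  have hsparse := lintegral_tsum_indicator_cell_rpow_le hlabel hrestrict (fun _ => 1)
    (Nat.one_le_cast.2 hs)
  simp only [ENNReal.rpow_natCast, ENNReal.ofReal_natCast] at hsparse
  calc ∫⁻ x in Q, 𝒯.stopCount bad 0 x ^ s ∂μ
      ≤ ∫⁻ x in Q, (∑' S : 𝒯.StopCell bad, (𝒯.cell S.1).indicator (fun _ => 1) x) ^ s ∂μ := by
        gcongr with x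
        simpa only [zero_le, if_true] using stopCount_le_tsum (𝒯 := 𝒯) (bad := bad) 0 x
    _ ≤ (s * C) ^ s * ∫⁻ x in Q, (∑' S : 𝒯.StopCell bad,
          (𝒯.coreSet bad S.1).indicator (fun _ => 1) x) ^ s ∂μ := hsparse
    _ ≤ (s * C) ^ s * ∫⁻ x in Q, 1 ^ s ∂μ := by
        gcongr with x
        exact tsum_indicator_coreSet_le _ fun _ _ => le_rfl
    _ = (s * C) ^ s * μ Q := by simp

end CellTree

section Cubes

variable {n : ℕ}

lemma cube_eq_preimage_Icc (a : Rn n) (l : ℝ) :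
    cube a l = WithLp.ofLp ⁻¹' Set.Icc (WithLp.ofLp a) (fun i => a i + l) := by
  ext y
  simp only [cube, Set.mem_ofPred_eq, Set.mem_preimage, Set.mem_Icc, Pi.le_def, forall_and]

lemma measurableSet_cube (a : Rn n) (l : ℝ) : MeasurableSet (cube a l) := by
  rw [cube_eq_preimage_Icc]
  exact (PiLp.volume_preserving_ofLp (Fin n)).measurable measurableSet_Icc

lemma volume_cube (a : Rn n) (l : ℝ) : volume (cube a l) = ENNReal.ofReal l ^ n := by
  rw [cube_eq_preimage_Icc, (PiLp.volume_preserving_ofLp (Fin n)).measure_preimage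
    measurableSet_Icc.nullMeasurableSet, Real.volume_Icc_pi]
  simp

lemma volume_cube_ne_top (a : Rn n) (l : ℝ) : volume (cube a l) ≠ ∞ := by
  rw [volume_cube]; exact ENNReal.pow_ne_top ENNReal.ofReal_ne_top

lemma volume_cube_ne_zero (a : Rn n) {l : ℝ} (hl : 0 < l) : volume (cube a l) ≠ 0 := by
  rw [volume_cube]; exact pow_ne_zero _ (by simpa using hl)

lemma isCompact_cube (a : Rn n) (l : ℝ) : IsCompact (cube a l) := by
  rw [cube_eq_preimage_Icc]
  exact (PiLp.homeomorph 2 fun _ : Fin n => ℝ).isCompact_preimage.2 isCompact_Icc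

lemma cube_eq_preimage_closedBall (a : Rn n) {l : ℝ} (hl : 0 ≤ l) :
    cube a l = WithLp.ofLp ⁻¹' Metric.closedBall (fun i => a i + l / 2) (l / 2) := by
  ext y
  simp only [cube, Set.mem_ofPred_eq, Set.mem_preimage, closedBall_pi _ (by linarith : 0 ≤ l / 2),
    Set.mem_pi, Set.mem_univ, true_imp_iff, Real.closedBall_eq_Icc, Set.mem_Icc]
  refine forall_congr' fun i => ?_
  constructor <;> rintro ⟨h1, h2⟩ <;> constructor <;> linarith

lemma setAverage_cube_eq {E : Type*} [NormedAddCommGroup E] [NormedSpace ℝ E] (b : Rn n → E)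
    (a : Rn n) {l : ℝ} (hl : 0 ≤ l) :
    ⨍ y in cube a l, b y =
      ⨍ y in Metric.closedBall (fun i => a i + l / 2) (l / 2), b (WithLp.toLp 2 y) := by
  have hemb : MeasurableEmbedding (WithLp.ofLp : Rn n → (Fin n → ℝ)) :=
    (MeasurableEquiv.toLp 2 (Fin n → ℝ)).symm.measurableEmbedding
  rw [cube_eq_preimage_closedBall a hl, setAverage_eq, setAverage_eq, measureReal_def,
    measureReal_def, (PiLp.volume_preserving_ofLp (Fin n)).measure_preimage
    Metric.isClosed_closedBall.measurableSet.nullMeasurableSet,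
    ← (PiLp.volume_preserving_ofLp (Fin n)).setIntegral_preimage_emb hemb]

lemma locallyIntegrable_comp_toLp {E : Type*} [NormedAddCommGroup E] {b : Rn n → E}
    (hb : LocallyIntegrable b) :
    LocallyIntegrable fun y : Fin n → ℝ => b (WithLp.toLp 2 y) := by
  rw [locallyIntegrable_iff] at hb ⊢
  intro K hK
  have hemb : MeasurableEmbedding (WithLp.toLp 2 : (Fin n → ℝ) → Rn n) :=
    (MeasurableEquiv.toLp 2 (Fin n → ℝ)).measurableEmbedding
  exact ((PiLp.volume_preserving_toLp (Fin n)).integrableOn_image hemb).1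
    (hb _ (hK.image (PiLp.continuous_toLp 2 _)))

end Cubes

section Grid

variable {n : ℕ}

/-- The sign `(-1)ᵏ`, which makes the grids shifted by `gridSign k / 3` at scale `2ᵏ` nested. -/
def gridSign (k : ℤ) : ℤ := if Even k then 1 else -1

lemma gridSign_eq_or (k : ℤ) : gridSign k = 1 ∨ gridSign k = -1 := by
  unfold gridSign; split_ifs <;> simp

lemma gridSign_succ (k : ℤ) : gridSign (k + 1) = -gridSign k := by
  unfold gridSign
  by_cases h : Even k
  · have : ¬ Even (k + 1) := by simpa [Int.even_add_one] using h
    rw [if_pos h, if_neg this]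
  · have : Even (k + 1) := by simpa [Int.even_add_one] using h
    rw [if_neg h, if_pos this]; norm_num

/-- The index of the cube of side `2ᵏ` containing `x` in the dyadic grid shifted by a third of
the side length in the directions `i` with `α i = 1`. -/
def gridIndex (α : Fin n → Fin 2) (k : ℤ) (x : Rn n) : Fin n → ℤ :=
  fun i => ⌊x i / 2 ^ k - gridSign k * (α i : ℕ) / 3⌋

/-- The index of the cube of side `2ᵏ⁺¹` containing the cube of side `2ᵏ` with index `z`. -/
def gridParent (α : Fin n → Fin 2) (k : ℤ) (z : Fin n → ℤ) : Fin n → ℤ :=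
  fun i => (z i + gridSign k * (α i : ℕ)) / 2

/-- The lower corner of the cube of side `2ᵏ` with index `z` in the grid `α`. -/
def gridCorner (α : Fin n → Fin 2) (k : ℤ) (z : Fin n → ℤ) : Rn n :=
  WithLp.toLp 2 fun i => 2 ^ k * (z i + gridSign k * (α i : ℕ) / 3)

/-- The closed cube of side `2ᵏ` with index `z` in the grid `α`. -/
def gridCube (α : Fin n → Fin 2) (k : ℤ) (z : Fin n → ℤ) : Set (Rn n) :=
  cube (gridCorner α k z) (2 ^ k)

lemma gridIndex_succ (α : Fin n → Fin 2) (k : ℤ) (x : Rn n) :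
    gridIndex α (k + 1) x = gridParent α k (gridIndex α k x) := by
  ext i
  have h := Int.floor_div_natCast
    (x i / 2 ^ k - gridSign k * (α i : ℕ) / 3 + ((gridSign k * (α i : ℕ) : ℤ) : ℝ)) 2
  rw [Int.floor_add_intCast] at h
  simp only [gridIndex, gridParent]
  rw [← Nat.cast_ofNat (R := ℤ) (n := 2), ← h, gridSign_succ, zpow_add_one₀ two_ne_zero]
  congr 1
  push_cast
  field_simp
  ring

lemma gridIndex_eq_iff (α : Fin n → Fin 2) (k : ℤ) (x : Rn n) (z : Fin n → ℤ) :
    gridIndex α k x = z ↔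
      ∀ i, gridCorner α k z i ≤ x i ∧ x i < gridCorner α k z i + 2 ^ k := by
  rw [funext_iff]
  refine forall_congr' fun i => ?_
  have h2 : (0 : ℝ) < 2 ^ k := by positivity
  simp only [gridIndex, gridCorner, Int.floor_eq_iff]
  set u : ℝ := gridSign k * (α i : ℕ) / 3
  rw [le_sub_iff_add_le, le_div_iff₀ h2, sub_lt_iff_lt_add, div_lt_iff₀ h2]
  constructor <;> rintro ⟨h3, h4⟩ <;> constructor <;> linarith

lemma setOf_gridIndex_subset (α : Fin n → Fin 2) (k : ℤ) (z : Fin n → ℤ) :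
    {x | gridIndex α k x = z} ⊆ gridCube α k z := by
  intro x hx i
  have := (gridIndex_eq_iff α k x z).1 hx i
  exact ⟨this.1, this.2.le⟩

lemma setOf_gridIndex_ae_eq (α : Fin n → Fin 2) (k : ℤ) (z : Fin n → ℤ) :
    ({x | gridIndex α k x = z} : Set (Rn n)) =ᵐ[volume] gridCube α k z := by
  have h1 : ({x | gridIndex α k x = z} : Set (Rn n)) = WithLp.ofLp ⁻¹' (Set.univ.pi fun i =>
      Set.Ico (gridCorner α k z i) (gridCorner α k z i + 2 ^ k)) := by
    ext x
    simp [gridIndex_eq_iff]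
  have h2 : gridCube α k z = WithLp.ofLp ⁻¹' (Set.Icc (fun i => gridCorner α k z i)
      (fun i => gridCorner α k z i + 2 ^ k)) := by
    rw [gridCube, cube_eq_preimage_Icc]
  rw [h1, h2]
  exact (PiLp.volume_preserving_ofLp (Fin n)).quasiMeasurePreserving.preimage_ae_eq
    (Measure.univ_pi_Ico_ae_eq_Icc (μ := fun _ : Fin n => (volume : Measure ℝ)))

lemma measurable_gridIndex (α : Fin n → Fin 2) (k : ℤ) :
    Measurable (gridIndex (n := n) α k) := by
  refine measurable_pi_lambda _ fun i => Int.measurable_floor.comp ?_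
  have : Measurable fun x : Rn n => x i :=
    (measurable_pi_apply i).comp (PiLp.volume_preserving_ofLp (Fin n)).measurable
  exact (this.div_const _).sub_const _

/-- The intervals of length `1/4` around the integers and around the integers shifted by `1/3` are
disjoint. -/
lemma exists_floor_sub_third_eq (u : ℝ) {s : ℤ} (hs : s = 1 ∨ s = -1) :
    ∃ e : Fin 2, ∀ v : ℝ, |u - v| ≤ 1 / 8 →
      ⌊v - s * (e : ℕ) / 3⌋ = ⌊u - s * (e : ℕ) / 3⌋ := by
  have hfl := Int.floor_le u
  have hfl' := Int.lt_floor_add_one u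
  by_cases hfar : (⌊u⌋ : ℝ) + 1 / 8 ≤ u ∧ u < ⌊u⌋ + 7 / 8
  · refine ⟨0, fun v hv => ?_⟩
    have hv := abs_le.1 hv
    simp only [Fin.val_zero, Nat.cast_zero, mul_zero, zero_div, sub_zero]
    rw [Int.floor_eq_iff]
    constructor <;> linarith [hfar.1, hfar.2, hv.1, hv.2]
  obtain ⟨k, hk, hk'⟩ : ∃ k : ℤ, (k : ℝ) - 1 / 8 ≤ u ∧ u < k + 1 / 8 := by
    by_cases h : (⌊u⌋ : ℝ) + 1 / 8 ≤ u
    · have := not_lt.1 fun h' => hfar ⟨h, h'⟩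
      refine ⟨⌊u⌋ + 1, ?_, ?_⟩ <;> push_cast <;> linarith
    · exact ⟨⌊u⌋, by linarith, by linarith [not_le.1 h]⟩
  obtain ⟨k', hk'⟩ : ∃ k' : ℤ, ∀ v : ℝ, |u - v| ≤ 1 / 8 → ⌊v - s / 3⌋ = k' := by
    refine hs.elim (fun h => ⟨k - 1, fun v hv => ?_⟩) fun h => ⟨k, fun v hv => ?_⟩ <;>
    · have hv := abs_le.1 hv
      rw [h, Int.floor_eq_iff]
      push_cast
      constructor <;> linarith [hv.1, hv.2]
  refine ⟨1, fun v hv => ?_⟩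
  simp only [Fin.val_one, Nat.cast_one, mul_one]
  rw [hk' v hv, hk' u (by norm_num)]

lemma exists_forall_norm_sub_le_gridIndex_eq (k : ℤ) (x : Rn n) :
    ∃ α : Fin n → Fin 2, ∀ y : Rn n, ‖x - y‖ ≤ 2 * 2 ^ k →
      gridIndex α (k + 4) y = gridIndex α (k + 4) x := by
  choose α hα using fun i => exists_floor_sub_third_eq (x i / 2 ^ (k + 4)) (gridSign_eq_or (k + 4))
  refine ⟨α, fun y hy => funext fun i => hα i _ ?_⟩
  have hcoord : |x i - y i| ≤ 2 * 2 ^ k := by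
    simpa using (PiLp.norm_apply_le (x - y) i).trans hy
  have hk : (0 : ℝ) < 2 ^ (k + 4) := by positivity
  rw [← sub_div, abs_div, abs_of_pos hk, div_le_iff₀ hk, zpow_add₀ two_ne_zero,
    show (2 : ℝ) ^ (4 : ℤ) = 16 by norm_num]
  linarith

lemma mem_gridCube_gridIndex (α : Fin n → Fin 2) (k : ℤ) (x : Rn n) :
    x ∈ gridCube α k (gridIndex α k x) := setOf_gridIndex_subset α k _ rfl

lemma ae_tendsto_average_gridCube {E : Type*} [NormedAddCommGroup E] [NormedSpace ℝ E]
    [CompleteSpace E] (α : Fin n → Fin 2) (N : ℤ) {b : Rn n → E} (hb : LocallyIntegrable b) :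
    ∀ᵐ x, Filter.Tendsto
      (fun t : ℕ => ⨍ y in gridCube α (N - t) (gridIndex α (N - t) x), b y) Filter.atTop
      (nhds (b x)) := by
  have hdiff := (PiLp.volume_preserving_ofLp (Fin n)).quasiMeasurePreserving.ae
    (IsUnifLocDoublingMeasure.ae_tendsto_average (volume : Measure (Fin n → ℝ))
      (locallyIntegrable_comp_toLp hb) 1)
  have hpos : ∀ t : ℕ, (0 : ℝ) < 2 ^ (N - t) := fun t => by positivity
  have hside : Filter.Tendsto (fun t : ℕ => (2 : ℝ) ^ (N - (t : ℤ)) / 2) Filter.atTop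
      (nhdsWithin 0 (Set.Ioi 0)) := by
    refine tendsto_nhdsWithin_iff.2 ⟨?_, Filter.Eventually.of_forall fun t => half_pos (hpos t)⟩
    have hgeom : ∀ t : ℕ, (2 : ℝ) ^ (N - (t : ℤ)) / 2 = 2 ^ N / 2 * (1 / 2) ^ t := fun t => by
      rw [zpow_sub₀ two_ne_zero, zpow_natCast, one_div, inv_pow]; field_simp
    simp_rw [hgeom]
    simpa using (tendsto_pow_atTop_nhds_zero_of_lt_one (r := (1 / 2 : ℝ)) (by norm_num)
      (by norm_num)).const_mul (2 ^ N / 2 : ℝ)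
  filter_upwards [hdiff] with x hx
  refine (hx (fun (t : ℕ) i =>
    gridCorner α (N - t) (gridIndex α (N - t) x) i + 2 ^ (N - (t : ℤ)) / 2) _ hside
    (Filter.Eventually.of_forall fun t => ?_)).congr fun t =>
      (setAverage_cube_eq b _ (hpos t).le).symm
  rw [one_mul]
  have hmem := mem_gridCube_gridIndex α (N - t) x
  rwa [gridCube, cube_eq_preimage_closedBall _ (hpos t).le] at hmem

end Grid

section Weights

lemma measure_univ_rpow_le_lintegral_mul {X : Type*} [MeasurableSpace X] {μ : Measure X} {r : ℝ}
    (hr : 1 < r) {W : X → ℝ≥0∞} (hW : AEMeasurable W μ) (hW0 : ∀ᵐ x ∂μ, W x ≠ 0)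
    (hWt : ∀ᵐ x ∂μ, W x ≠ ∞) :
    μ Set.univ ^ r ≤ (∫⁻ x, W x ∂μ) * (∫⁻ x, W x ^ (-(1 / (r - 1))) ∂μ) ^ (r - 1) := by
  have hr0 : 0 < r := by linarith
  have hr1 : r - 1 ≠ 0 := by linarith
  have hconj : r.HolderConjugate (r / (r - 1)) := .conjExponent hr
  have hone : μ Set.univ = ∫⁻ x, W x ^ (1 / r) * W x ^ (-(1 / r)) ∂μ := by
    rw [← lintegral_one]
    refine lintegral_congr_ae ?_
    filter_upwards [hW0, hWt] with x h0 ht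
    rw [← ENNReal.rpow_add _ _ h0 ht, add_neg_cancel, ENNReal.rpow_zero]
  have holder : μ Set.univ ≤
      (∫⁻ x, W x ∂μ) ^ (1 / r) * (∫⁻ x, W x ^ (-(1 / (r - 1))) ∂μ) ^ ((r - 1) / r) := by
    rw [hone]
    refine (ENNReal.lintegral_mul_le_Lp_mul_Lq μ hconj (hW.pow_const _)
      (hW.pow_const _)).trans (le_of_eq ?_)
    simp_rw [← ENNReal.rpow_mul]
    rw [one_div_mul_cancel hr0.ne', one_div_div,
      show -(1 / r) * (r / (r - 1)) = -(1 / (r - 1)) by field_simp]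
    simp only [ENNReal.rpow_one]
  have h := ENNReal.rpow_le_rpow holder hr0.le
  rwa [ENNReal.mul_rpow_of_nonneg _ _ hr0.le, ← ENNReal.rpow_mul, ← ENNReal.rpow_mul,
    one_div_mul_cancel hr0.ne', ENNReal.rpow_one, div_mul_cancel₀ _ hr0.ne'] at h

variable {n : ℕ} {w : Rn n → ℝ}

lemma IsWeight.aemeasurable_ofReal (hw : IsWeight w) :
    AEMeasurable fun x => ENNReal.ofReal (w x) :=
  hw.locallyIntegrable.aestronglyMeasurable.aemeasurable.ennreal_ofReal

lemma IsWeight.volume_rpow_le_lintegral_mul (hw : IsWeight w) {r : ℝ} (hr : 1 < r)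
    (E : Set (Rn n)) :
    volume E ^ r ≤ (∫⁻ x in E, ENNReal.ofReal (w x)) *
      (∫⁻ x in E, ENNReal.ofReal (w x) ^ (-(1 / (r - 1)))) ^ (r - 1) := by
  have hpos : ∀ᵐ x, ENNReal.ofReal (w x) ≠ 0 := hw.pos.mono fun x hx => by simpa using hx
  simpa only [Measure.restrict_apply_univ] using
    measure_univ_rpow_le_lintegral_mul hr hw.aemeasurable_ofReal.restrict
      (ae_restrict_of_ae (s := E) hpos) (.of_forall fun _ => ENNReal.ofReal_ne_top)

lemma MemA.exists_lintegral_mul_le {r : ℝ} (hr : 1 < r) (hw : MemA r w) :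
    ∃ C : ℝ≥0, ∀ (a : Rn n) (l : ℝ), 0 < l →
      (∫⁻ y in cube a l, ENNReal.ofReal (w y)) *
        (∫⁻ y in cube a l, ENNReal.ofReal (w y) ^ (-(1 / (r - 1)))) ^ (r - 1) ≤
      C * volume (cube a l) ^ r := by
  obtain ⟨-, C, hC⟩ := hw
  refine ⟨C, fun a l hl => ?_⟩
  have hr1 : 0 < r - 1 := by linarith
  have hV0 := volume_cube_ne_zero a hl
  have hVt := volume_cube_ne_top a l
  have hpow : volume (cube a l) * volume (cube a l) ^ (r - 1) = volume (cube a l) ^ r := by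
    conv_rhs => rw [← add_sub_cancel 1 r, ENNReal.rpow_add _ _ hV0 hVt, ENNReal.rpow_one]
  have h := hC a l hl
  rwa [setLAverage_eq, setLAverage_eq, ENNReal.div_rpow_of_nonneg _ _ hr1.le,
    ← ENNReal.mul_div_mul_comm (.inl hV0) (.inl hVt), hpow, ENNReal.div_le_iff
      (ENNReal.rpow_pos (pos_iff_ne_zero.2 hV0) hVt).ne'
      (ENNReal.rpow_ne_top_of_nonneg (by linarith) hVt)] at h

lemma MemAInfty.exists_withDensity_cube_le (hw : MemAInfty w) :
    ∃ C : ℝ≥0, ∀ (a : Rn n) (l : ℝ), 0 < l → ∀ E ⊆ cube a l, MeasurableSet E →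
      volume (cube a l) ≤ 2 * volume E →
      volume.withDensity (fun x => ENNReal.ofReal (w x)) (cube a l) ≤
        C * volume.withDensity (fun x => ENNReal.ofReal (w x)) E := by
  obtain ⟨r, hr, hwr⟩ := hw
  obtain ⟨C, hC⟩ := hwr.exists_lintegral_mul_le hr
  have hr0 : 0 < r := by linarith
  refine ⟨(2 : ℝ≥0) ^ r * C, fun a l hl E hEQ hE hvol => ?_⟩
  rw [withDensity_apply _ (measurableSet_cube a l), withDensity_apply _ hE]
  set W : Rn n → ℝ≥0∞ := fun x => ENNReal.ofReal (w x)
  set σ := ∫⁻ y in cube a l, W y ^ (-(1 / (r - 1)))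
  set V := volume (cube a l)
  have hE_le : volume E ^ r ≤ (∫⁻ x in E, W x) * σ ^ (r - 1) := by
    have hσ : ∫⁻ x in E, W x ^ (-(1 / (r - 1))) ≤ σ := lintegral_mono_set hEQ
    exact (hwr.1.volume_rpow_le_lintegral_mul hr E).trans (by gcongr)
  have hV_le : V ^ r ≤ 2 ^ r * volume E ^ r := by
    rw [← ENNReal.mul_rpow_of_nonneg _ _ hr0.le]
    exact ENNReal.rpow_le_rpow hvol hr0.le
  have hV0 : V ^ r ≠ 0 :=
    (ENNReal.rpow_pos (pos_iff_ne_zero.2 (volume_cube_ne_zero a hl)) (volume_cube_ne_top a l)).ne'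
  have hVt : V ^ r ≠ ∞ := ENNReal.rpow_ne_top_of_nonneg hr0.le (volume_cube_ne_top a l)
  rw [← ENNReal.mul_le_mul_iff_left hV0 hVt]
  calc (∫⁻ x in cube a l, W x) * V ^ r
      ≤ (∫⁻ x in cube a l, W x) * (2 ^ r * ((∫⁻ x in E, W x) * σ ^ (r - 1))) := by
        gcongr; exact hV_le.trans (by gcongr)
    _ = 2 ^ r * (∫⁻ x in E, W x) * ((∫⁻ x in cube a l, W x) * σ ^ (r - 1)) := by ring
    _ ≤ 2 ^ r * (∫⁻ x in E, W x) * (C * V ^ r) := by gcongr _ * ?_; exact hC a l hl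
    _ = _ := by
        rw [ENNReal.coe_mul, ENNReal.coe_rpow_of_nonneg _ hr0.le]
        push_cast
        ring

end Weights

section GridTree

variable {n : ℕ}

/-- The cubes of side at most `2ᴺ` of the grid `α`; those of generation `t` have side `2ᴺ⁻ᵗ`. -/
def gridTree (α : Fin n → Fin 2) (N : ℤ) : CellTree (Rn n) (Fin n → ℤ) where
  label t := gridIndex α (N - t)
  parent t := gridParent α (N - (t + 1 : ℕ))
  label_eq_parent t x := by
    rw [← gridIndex_succ, Nat.cast_succ, sub_add_eq_sub_sub, sub_add_cancel]

/-- The closed cube which agrees, up to a null set, with the cell `S` of `gridTree α N`. -/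
def treeCube (α : Fin n → Fin 2) (N : ℤ) (S : ℕ × (Fin n → ℤ)) : Set (Rn n) :=
  gridCube α (N - S.1) S.2

variable (α : Fin n → Fin 2) (N : ℤ)

lemma measurable_gridTree_label (t : ℕ) : Measurable ((gridTree α N).label t) :=
  measurable_gridIndex α _

lemma measurableSet_gridTree_cell (S : ℕ × (Fin n → ℤ)) : MeasurableSet ((gridTree α N).cell S) :=
  CellTree.measurableSet_cell (measurable_gridTree_label α N) S

lemma cell_ae_eq_treeCube (S : ℕ × (Fin n → ℤ)) :
    (gridTree α N).cell S =ᵐ[volume] treeCube α N S :=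
  setOf_gridIndex_ae_eq α (N - S.1) S.2

lemma volume_cell (S : ℕ × (Fin n → ℤ)) :
    volume ((gridTree α N).cell S) = volume (treeCube α N S) :=
  measure_congr (cell_ae_eq_treeCube α N S)

lemma cell_subset_treeCube (S : ℕ × (Fin n → ℤ)) : (gridTree α N).cell S ⊆ treeCube α N S :=
  setOf_gridIndex_subset α (N - S.1) S.2

lemma volume_treeCube (S : ℕ × (Fin n → ℤ)) :
    volume (treeCube α N S) = ENNReal.ofReal (2 ^ (N - S.1)) ^ n := volume_cube _ _

lemma volume_treeCube_ne_zero (S : ℕ × (Fin n → ℤ)) : volume (treeCube α N S) ≠ 0 :=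
  volume_cube_ne_zero _ (by positivity)

lemma volume_treeCube_ne_top (S : ℕ × (Fin n → ℤ)) : volume (treeCube α N S) ≠ ∞ :=
  volume_cube_ne_top _ _

lemma setLIntegral_cell_eq (S : ℕ × (Fin n → ℤ)) (g : Rn n → ℝ≥0∞) :
    ∫⁻ y in (gridTree α N).cell S, g y = ∫⁻ y in treeCube α N S, g y :=
  setLIntegral_congr (cell_ae_eq_treeCube α N S)

lemma sum_setLIntegral_treeCube_le (S : ℕ × (Fin n → ℤ)) (T : Finset (ℕ × (Fin n → ℤ)))
    (hsub : ∀ C ∈ T, (gridTree α N).cell C ⊆ (gridTree α N).cell S)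
    (hdisj : (T : Set (ℕ × (Fin n → ℤ))).PairwiseDisjoint (gridTree α N).cell)
    (g : Rn n → ℝ≥0∞) :
    ∑ C ∈ T, ∫⁻ y in treeCube α N C, g y ≤ ∫⁻ y in treeCube α N S, g y := by
  simp_rw [← setLIntegral_cell_eq]
  rw [← lintegral_biUnion_finset hdisj fun C _ => measurableSet_gridTree_cell α N C]
  exact lintegral_mono_set (Set.iUnion₂_subset hsub)

end GridTree

section Luxemburg

lemma youngLog_div_le (ℓ : ℕ) {u A : ℝ} (hu : 0 ≤ u) (hA : 1 ≤ A) :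
    youngLog ℓ (u / A) ≤ youngLog ℓ u / A := by
  have hA0 : 0 < A := by linarith
  have hlog : posLog (u / A) ≤ posLog u :=
    posLog_le_posLog (div_nonneg hu hA0.le) (div_le_self hu hA)
  have hnonneg : (0 : ℝ) ≤ posLog (u / A) := posLog_nonneg
  unfold youngLog
  rw [div_mul_eq_mul_div]
  gcongr

lemma le_youngLog (ℓ : ℕ) {u : ℝ} (hu : 0 ≤ u) : u ≤ youngLog ℓ u :=
  le_mul_of_one_le_right hu (one_le_pow₀ (by linarith [posLog_nonneg (x := u)]))

lemma mul_le_exp_add_youngLog {s t : ℝ} (hs : 0 ≤ s) : s * t ≤ exp t + youngLog 1 s := by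
  rcases eq_or_lt_of_le hs with rfl | hs0
  · simp [youngLog, (exp_pos t).le]
  have hexp : s * (1 + (t - log s)) ≤ exp t := by
    have h := add_one_le_exp (t - log s)
    rw [exp_sub, exp_log hs0, le_div_iff₀ hs0] at h
    linarith
  have hlog : s * log s ≤ s * posLog s := mul_le_mul_of_nonneg_left (le_max_right _ _) hs
  simp only [youngLog, pow_one]
  linarith

variable {n : ℕ} {f : Rn n → ℝ} {Q : Set (Rn n)}

lemma luxAvg_le_ofReal {B : ℝ → ℝ} (hV0 : volume Q ≠ 0) (hVt : volume Q ≠ ∞) {r : ℝ}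
    (hr : 0 < r) (h : ∫⁻ y in Q, ENNReal.ofReal (B (|f y| / r)) ≤ volume Q) :
    luxAvg B f Q ≤ ENNReal.ofReal r := by
  refine iInf_le_of_le r (iInf₂_le hr ?_)
  rwa [setLAverage_eq, ENNReal.div_le_iff hV0 hVt, one_mul]

lemma exists_setLIntegral_le_of_luxAvg_lt {B : ℝ → ℝ} (hV0 : volume Q ≠ 0)
    (hVt : volume Q ≠ ∞) {c : ℝ≥0∞} (h : luxAvg B f Q < c) :
    ∃ r : ℝ, 0 < r ∧ ∫⁻ y in Q, ENNReal.ofReal (B (|f y| / r)) ≤ volume Q ∧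
      ENNReal.ofReal r < c := by
  simp only [luxAvg, iInf_lt_iff] at h
  obtain ⟨r, hr, hadm, hlt⟩ := h
  rw [setLAverage_eq, ENNReal.div_le_iff hV0 hVt, one_mul] at hadm
  exact ⟨r, hr, hadm, hlt⟩

lemma mul_volume_le_of_lt_luxAvg (ℓ : ℕ) (hV0 : volume Q ≠ 0) (hVt : volume Q ≠ ∞) {A : ℝ≥0}
    (hA : 1 ≤ A) {r : ℝ} (hr : 0 < r) (h : A * ENNReal.ofReal r < luxAvg (youngLog ℓ) f Q) :
    A * volume Q ≤ ∫⁻ y in Q, ENNReal.ofReal (youngLog ℓ (|f y| / r)) := by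
  have hA1 : (1 : ℝ) ≤ A := hA
  have hA0 : (0 : ℝ) < A := by linarith
  have hlarge : volume Q < ∫⁻ y in Q, ENNReal.ofReal (youngLog ℓ (|f y| / (r * A))) := by
    by_contra! hle
    have hlux := luxAvg_le_ofReal hV0 hVt (mul_pos hr hA0) hle
    rw [mul_comm, ENNReal.ofReal_mul A.coe_nonneg, ENNReal.ofReal_coe_nnreal] at hlux
    exact hlux.not_gt h
  calc A * volume Q
      ≤ A * ∫⁻ y in Q, ENNReal.ofReal (youngLog ℓ (|f y| / (r * A))) := by gcongr
    _ = ∫⁻ y in Q, A * ENNReal.ofReal (youngLog ℓ (|f y| / (r * A))) := by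
        rw [lintegral_const_mul' _ _ ENNReal.coe_ne_top]
    _ ≤ _ := by
        refine lintegral_mono fun y => ?_
        have hy := youngLog_div_le ℓ (div_nonneg (abs_nonneg (f y)) hr.le) hA1
        rw [le_div_iff₀' hA0, div_div] at hy
        rw [← ENNReal.ofReal_coe_nnreal, ← ENNReal.ofReal_mul A.coe_nonneg]
        exact ENNReal.ofReal_le_ofReal hy

lemma laverage_enorm_le_luxAvg (ℓ : ℕ) (f : Rn n → ℝ) (Q : Set (Rn n)) :
    ⨍⁻ y in Q, ‖f y‖ₑ ∂volume ≤ luxAvg (youngLog ℓ) f Q := by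
  refine le_iInf fun r => le_iInf₂ fun hr hadm => ?_
  calc ⨍⁻ y in Q, ‖f y‖ₑ ∂volume
      ≤ ⨍⁻ y in Q, ENNReal.ofReal r * ENNReal.ofReal (youngLog ℓ (|f y| / r)) ∂volume := by
        refine lintegral_mono fun y => ?_
        rw [← ENNReal.ofReal_mul hr.le, Real.enorm_eq_ofReal_abs]
        refine ENNReal.ofReal_le_ofReal ?_
        have := le_youngLog ℓ (div_nonneg (abs_nonneg (f y)) hr.le)
        rwa [div_le_iff₀' hr] at this
    _ = ENNReal.ofReal r * ⨍⁻ y in Q, ENNReal.ofReal (youngLog ℓ (|f y| / r)) ∂volume := by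
        unfold laverage
        rw [lintegral_const_mul' _ _ ENNReal.ofReal_ne_top]
    _ ≤ ENNReal.ofReal r * 1 := by gcongr
    _ = _ := mul_one _

lemma setLIntegral_mul_le_luxAvg_of_setLIntegral_exp_le (hV0 : volume Q ≠ 0)
    (hVt : volume Q ≠ ∞) {g : Rn n → ℝ} (hg : AEMeasurable g (volume.restrict Q)) {c : ℝ}
    (hc : 0 < c) (hexp : ∫⁻ y in Q, ENNReal.ofReal (exp (c * |g y|)) ≤ 2 * volume Q)
    (f : Rn n → ℝ) :
    ∫⁻ y in Q, ‖g y‖ₑ * ‖f y‖ₑ ≤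
      ENNReal.ofReal (3 / c) * luxAvg (youngLog 1) f Q * volume Q := by
  have hC0 : ENNReal.ofReal (3 / c) ≠ 0 := by simpa using by positivity
  rw [← ENNReal.div_le_iff hV0 hVt, mul_comm,
    ← ENNReal.div_le_iff hC0 ENNReal.ofReal_ne_top]
  refine le_iInf fun r => le_iInf₂ fun hr hadm => ?_
  rw [ENNReal.div_le_iff hC0 ENNReal.ofReal_ne_top, ENNReal.div_le_iff hV0 hVt]
  rw [setLAverage_eq, ENNReal.div_le_iff hV0 hVt, one_mul] at hadm
  have hexpm : AEMeasurable (fun y => ENNReal.ofReal (exp (c * |g y|))) (volume.restrict Q) :=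
    (measurable_exp.comp_aemeasurable
      ((continuous_abs.measurable.comp_aemeasurable hg).const_mul c)).ennreal_ofReal
  calc ∫⁻ y in Q, ‖g y‖ₑ * ‖f y‖ₑ
      ≤ ∫⁻ y in Q, ENNReal.ofReal (r / c) * (ENNReal.ofReal (exp (c * |g y|)) +
          ENNReal.ofReal (youngLog 1 (|f y| / r))) := by
        refine lintegral_mono fun y => ?_
        have hy0 : 0 ≤ |f y| / r := by positivity
        rw [Real.enorm_eq_ofReal_abs, Real.enorm_eq_ofReal_abs,
          ← ENNReal.ofReal_mul (abs_nonneg _),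
          ← ENNReal.ofReal_add (exp_pos _).le (hy0.trans (le_youngLog 1 hy0)),
          ← ENNReal.ofReal_mul (by positivity)]
        refine ENNReal.ofReal_le_ofReal ?_
        calc |g y| * |f y| = r / c * (|f y| / r * (c * |g y|)) := by field_simp
          _ ≤ _ := by gcongr; exact mul_le_exp_add_youngLog hy0
    _ = ENNReal.ofReal (r / c) * ((∫⁻ y in Q, ENNReal.ofReal (exp (c * |g y|))) +
          ∫⁻ y in Q, ENNReal.ofReal (youngLog 1 (|f y| / r))) := by
        rw [lintegral_const_mul' _ _ ENNReal.ofReal_ne_top, lintegral_add_left' hexpm]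
    _ ≤ ENNReal.ofReal (r / c) * (2 * volume Q + volume Q) := by gcongr
    _ = ENNReal.ofReal r * ENNReal.ofReal (3 / c) * volume Q := by
        rw [← ENNReal.ofReal_mul hr.le, show r * (3 / c) = r / c * 3 by ring,
          ENNReal.ofReal_mul (by positivity), ENNReal.ofReal_ofNat]
        ring

lemma mul_sum_volume_le_of_lt_luxAvg (α : Fin n → Fin 2) (N : ℤ) (ℓ : ℕ) (f : Rn n → ℝ)
    {A : ℝ≥0} (hA : 1 ≤ A) (S : ℕ × (Fin n → ℤ)) (T : Finset (ℕ × (Fin n → ℤ)))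
    (hsub : ∀ C ∈ T, (gridTree α N).cell C ⊆ (gridTree α N).cell S)
    (hdisj : (T : Set (ℕ × (Fin n → ℤ))).PairwiseDisjoint (gridTree α N).cell)
    (hT : ∀ C ∈ T, A * luxAvg (youngLog ℓ) f (treeCube α N S) <
      luxAvg (youngLog ℓ) f (treeCube α N C)) :
    A * ∑ C ∈ T, volume (treeCube α N C) ≤ volume (treeCube α N S) := by
  rcases T.eq_empty_or_nonempty with rfl | hne
  · simp
  have hA0 : (A : ℝ≥0∞) ≠ 0 := by simpa using (zero_lt_one.trans_le hA).ne'
  have hV0 := volume_treeCube_ne_zero α N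
  have hVt := volume_treeCube_ne_top α N
  obtain ⟨D, hD, hmin⟩ := T.exists_min_image (fun C => luxAvg (youngLog ℓ) f (treeCube α N C)) hne
  obtain ⟨r, hr, hadm, hlt⟩ := exists_setLIntegral_le_of_luxAvg_lt (hV0 S) (hVt S)
    ((ENNReal.lt_div_iff_mul_lt (.inl hA0) (.inl ENNReal.coe_ne_top)).2
      (mul_comm (A : ℝ≥0∞) _ ▸ hT D hD))
  rw [ENNReal.lt_div_iff_mul_lt (.inl hA0) (.inl ENNReal.coe_ne_top), mul_comm] at hlt
  calc A * ∑ C ∈ T, volume (treeCube α N C)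
      ≤ ∑ C ∈ T, ∫⁻ y in treeCube α N C, ENNReal.ofReal (youngLog ℓ (|f y| / r)) := by
        rw [Finset.mul_sum]
        exact Finset.sum_le_sum fun C hC =>
          mul_volume_le_of_lt_luxAvg ℓ (hV0 C) (hVt C) hA hr (hlt.trans_le (hmin C hC))
    _ ≤ ∫⁻ y in treeCube α N S, ENNReal.ofReal (youngLog ℓ (|f y| / r)) :=
        sum_setLIntegral_treeCube_le α N S T hsub hdisj _
    _ ≤ volume (treeCube α N S) := hadm

end Luxemburg

section BMO

lemma enorm_setAverage_sub_mul_le {X E : Type*} [MeasurableSpace X] [NormedAddCommGroup E]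
    [NormedSpace ℝ E] [CompleteSpace E] {μ : Measure X} {Q : Set X} (hV0 : μ Q ≠ 0)
    (hVt : μ Q ≠ ∞) {b : X → E} (hb : IntegrableOn b Q μ) (c : E) :
    ‖(⨍ y in Q, b y ∂μ) - c‖ₑ * μ Q ≤ ∫⁻ y in Q, ‖b y - c‖ₑ ∂μ := by
  have hV : μ.real Q ≠ 0 := (ENNReal.toReal_pos hV0 hVt).ne'
  have hsub : μ.real Q • ((⨍ y in Q, b y ∂μ) - c) = ∫ y in Q, (b y - c) ∂μ := by
    rw [integral_sub hb (integrableOn_const hVt), setAverage_eq, setIntegral_const, smul_sub,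
      smul_inv_smul₀ hV]
  calc ‖(⨍ y in Q, b y ∂μ) - c‖ₑ * μ Q = ‖μ.real Q • ((⨍ y in Q, b y ∂μ) - c)‖ₑ := by
        rw [enorm_smul, Real.enorm_of_nonneg measureReal_nonneg, ofReal_measureReal hVt, mul_comm]
    _ ≤ ∫⁻ y in Q, ‖b y - c‖ₑ ∂μ := hsub ▸ enorm_integral_le_lintegral_enorm _

variable {n : ℕ} {b : Rn n → ℝ} {K : ℝ≥0}

lemma setLIntegral_sub_average_le (hK : bmoNorm b ≤ K) (a : Rn n) {l : ℝ} (hl : 0 < l) :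
    ∫⁻ y in cube a l, ‖b y - ⨍ z in cube a l, b z ∂volume‖ₑ ≤ K * volume (cube a l) := by
  have h : ⨍⁻ y in cube a l, ‖b y - ⨍ z in cube a l, b z ∂volume‖ₑ ∂volume ≤ K :=
    le_trans (le_iSup₂_of_le a l (le_iSup (fun _ : 0 < l => _) hl)) hK
  rwa [setLAverage_eq, ENNReal.div_le_iff (volume_cube_ne_zero a hl) (volume_cube_ne_top a l)] at h

/-- The average of `b` over a cube of `gridTree α N`. -/
def treeAvg (b : Rn n → ℝ) (α : Fin n → Fin 2) (N : ℤ) (S : ℕ × (Fin n → ℤ)) : ℝ :=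
  ⨍ y in treeCube α N S, b y ∂volume

variable {α : Fin n → Fin 2} {N : ℤ}

lemma sum_enorm_treeAvg_sub_mul_volume_le (hb : LocallyIntegrable b) (hK : bmoNorm b ≤ K)
    (S : ℕ × (Fin n → ℤ)) (T : Finset (ℕ × (Fin n → ℤ)))
    (hsub : ∀ C ∈ T, (gridTree α N).cell C ⊆ (gridTree α N).cell S)
    (hdisj : (T : Set (ℕ × (Fin n → ℤ))).PairwiseDisjoint (gridTree α N).cell) :
    ∑ C ∈ T, ‖treeAvg b α N C - treeAvg b α N S‖ₑ * volume (treeCube α N C) ≤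
      K * volume (treeCube α N S) :=
  calc ∑ C ∈ T, ‖treeAvg b α N C - treeAvg b α N S‖ₑ * volume (treeCube α N C)
      ≤ ∑ C ∈ T, ∫⁻ y in treeCube α N C, ‖b y - treeAvg b α N S‖ₑ :=
        Finset.sum_le_sum fun C _ => enorm_setAverage_sub_mul_le (volume_treeCube_ne_zero α N C)
          (volume_treeCube_ne_top α N C) (hb.integrableOn_isCompact (isCompact_cube _ _)) _
    _ ≤ ∫⁻ y in treeCube α N S, ‖b y - treeAvg b α N S‖ₑ :=
        sum_setLIntegral_treeCube_le α N S T hsub hdisj _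
    _ ≤ _ := setLIntegral_sub_average_le hK _ (by positivity)

lemma abs_treeAvg_succ_sub_le (hb : LocallyIntegrable b) (hK : bmoNorm b ≤ K) (t : ℕ)
    (x : Rn n) :
    |treeAvg b α N (t + 1, (gridTree α N).label (t + 1) x) -
      treeAvg b α N (t, (gridTree α N).label t x)| ≤ (2 ^ n * K : ℝ≥0) := by
  set C : ℕ × (Fin n → ℤ) := (t + 1, (gridTree α N).label (t + 1) x)
  set S : ℕ × (Fin n → ℤ) := (t, (gridTree α N).label t x)
  have hsub : (gridTree α N).cell C ⊆ (gridTree α N).cell S :=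
    fun _ hy => CellTree.label_eq_of_le (Nat.le_succ t) hy
  have hvol : volume (treeCube α N S) = 2 ^ n * volume (treeCube α N C) := by
    have hside : (2 : ℝ) ^ (N - t) = 2 * 2 ^ (N - (t + 1 : ℕ)) := by
      rw [← zpow_one_add₀ two_ne_zero]
      congr 1
      push_cast; ring
    rw [volume_treeCube, volume_treeCube, ← mul_pow, hside, ENNReal.ofReal_mul zero_le_two,
      ENNReal.ofReal_ofNat]
  have h := sum_enorm_treeAvg_sub_mul_volume_le hb hK S {C} (by simpa using hsub) (by simp)
  rw [Finset.sum_singleton, hvol, ← mul_assoc, ENNReal.mul_le_mul_iff_left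
    (volume_treeCube_ne_zero α N C) (volume_treeCube_ne_top α N C)] at h
  have hnn : ‖treeAvg b α N C - treeAvg b α N S‖₊ ≤ 2 ^ n * K := by
    rw [mul_comm]; exact_mod_cast h
  exact_mod_cast hnn

end BMO

section Stopping

lemma four_mul_sum_filter_exists_le {ι β : Type*} [Fintype ι] (T : Finset β) (p : ι → β → Prop)
    [∀ i, DecidablePred (p i)] [DecidablePred fun C => ∃ i, p i C] (v : β → ℝ≥0∞) {V : ℝ≥0∞}
    (h : ∀ i, (4 * (Fintype.card ι + 1) : ℝ≥0) * ∑ C ∈ T with p i C, v C ≤ V) :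
    4 * ∑ C ∈ T with ∃ i, p i C, v C ≤ V := by
  have hcover : ∑ C ∈ T with ∃ i, p i C, v C ≤ ∑ i, ∑ C ∈ T with p i C, v C := by
    simp only [Finset.sum_filter]
    rw [Finset.sum_comm]
    refine Finset.sum_le_sum fun C _ => ?_
    split_ifs with hC
    · obtain ⟨i, hi⟩ := hC
      calc v C = if p i C then v C else 0 := (if_pos hi).symm
        _ ≤ _ := Finset.single_le_sum_of_canonicallyOrdered
          (f := fun i => if p i C then v C else 0) (Finset.mem_univ i)
    · exact bot_le
  have hcard0 : (Fintype.card ι + 1 : ℝ≥0∞) ≠ 0 := by simp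
  have hcardt : (Fintype.card ι + 1 : ℝ≥0∞) ≠ ∞ := by finiteness
  rw [← ENNReal.mul_le_mul_iff_right hcard0 hcardt]
  calc (Fintype.card ι + 1 : ℝ≥0∞) * (4 * ∑ C ∈ T with ∃ i, p i C, v C)
      ≤ (Fintype.card ι + 1) * (4 * ∑ i, ∑ C ∈ T with p i C, v C) := by gcongr
    _ = ∑ i, (4 * (Fintype.card ι + 1) : ℝ≥0) * ∑ C ∈ T with p i C, v C := by
        rw [← mul_assoc, mul_comm _ (4 : ℝ≥0∞), Finset.mul_sum]
        push_cast
        rfl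
    _ ≤ ∑ _i : ι, V := Finset.sum_le_sum fun i _ => h i
    _ ≤ (Fintype.card ι + 1) * V := by
        rw [Finset.sum_const, Finset.card_univ, nsmul_eq_mul]
        gcongr
        exact le_self_add

variable {n m m' : ℕ}

/-- The stopping rule: relative to `S`, the cube `C` is bad if the Luxemburg average of some `fᵢ`
is much larger over `C` than over `S`, or the averages of some symbol `bⱼ` over `C` and `S` are far
apart. The thresholds are such that disjoint bad subcubes fill at most half of `S`. -/
def stopRel (α : Fin n → Fin 2) (N : ℤ) (ℓ : ℕ) (f : Fin m → Rn n → ℝ) (b : Fin m' → Rn n → ℝ)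
    (K : ℝ≥0) (C S : ℕ × (Fin n → ℤ)) : Prop :=
  (∃ i, (4 * (m + 1) : ℝ≥0) * luxAvg (youngLog ℓ) (f i) (treeCube α N S) <
    luxAvg (youngLog ℓ) (f i) (treeCube α N C)) ∨
  ∃ j, (4 * (m' + 1) * (K + 1) : ℝ≥0) < |treeAvg (b j) α N C - treeAvg (b j) α N S|

variable {α : Fin n → Fin 2} {N : ℤ} {ℓ : ℕ} {f : Fin m → Rn n → ℝ} {b : Fin m' → Rn n → ℝ}
  {K : ℝ≥0}

lemma mul_sum_volume_le_of_lt_abs_treeAvg_sub {b : Rn n → ℝ} (hb : LocallyIntegrable b)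
    (hK : bmoNorm b ≤ K) (A : ℝ≥0) (S : ℕ × (Fin n → ℤ)) (T : Finset (ℕ × (Fin n → ℤ)))
    (hsub : ∀ C ∈ T, (gridTree α N).cell C ⊆ (gridTree α N).cell S)
    (hdisj : (T : Set (ℕ × (Fin n → ℤ))).PairwiseDisjoint (gridTree α N).cell)
    (hT : ∀ C ∈ T, (A * (K + 1) : ℝ≥0) < |treeAvg b α N C - treeAvg b α N S|) :
    A * ∑ C ∈ T, volume (treeCube α N C) ≤ volume (treeCube α N S) := by
  have hK0 : (K + 1 : ℝ≥0∞) ≠ 0 := by simp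
  have hKt : (K + 1 : ℝ≥0∞) ≠ ∞ := by finiteness
  rw [← ENNReal.mul_le_mul_iff_right hK0 hKt]
  calc (K + 1 : ℝ≥0∞) * (A * ∑ C ∈ T, volume (treeCube α N C))
      = ∑ C ∈ T, (A * (K + 1) : ℝ≥0) * volume (treeCube α N C) := by
        rw [← Finset.mul_sum]; push_cast; ring
    _ ≤ ∑ C ∈ T, ‖treeAvg b α N C - treeAvg b α N S‖ₑ * volume (treeCube α N C) := by
        refine Finset.sum_le_sum fun C hC => ?_
        gcongr
        exact ENNReal.coe_le_coe.2 (hT C hC).le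
    _ ≤ K * volume (treeCube α N S) := sum_enorm_treeAvg_sub_mul_volume_le hb hK S T hsub hdisj
    _ ≤ (K + 1) * volume (treeCube α N S) := by gcongr; exact le_self_add

lemma two_mul_sum_volume_le_of_stopRel
    (hb : ∀ j, LocallyIntegrable (b j)) (hK : ∀ j, bmoNorm (b j) ≤ K)
    (S : ℕ × (Fin n → ℤ)) (T : Finset (ℕ × (Fin n → ℤ)))
    (hsub : ∀ C ∈ T, (gridTree α N).cell C ⊆ (gridTree α N).cell S)
    (hT : ∀ C ∈ T, stopRel α N ℓ f b K C S)
    (hdisj : (T : Set (ℕ × (Fin n → ℤ))).PairwiseDisjoint (gridTree α N).cell) :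
    2 * ∑ C ∈ T, volume (treeCube α N C) ≤ volume (treeCube α N S) := by
  classical
  set V := volume (treeCube α N S)
  let largeAvg (i : Fin m) (C : ℕ × (Fin n → ℤ)) : Prop :=
    (4 * (m + 1) : ℝ≥0) * luxAvg (youngLog ℓ) (f i) (treeCube α N S) <
      luxAvg (youngLog ℓ) (f i) (treeCube α N C)
  let farMean (j : Fin m') (C : ℕ × (Fin n → ℤ)) : Prop :=
    (4 * (m' + 1) * (K + 1) : ℝ≥0) < |treeAvg (b j) α N C - treeAvg (b j) α N S|
  have hlux : 4 * ∑ C ∈ T with ∃ i, largeAvg i C, volume (treeCube α N C) ≤ V := by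
    refine four_mul_sum_filter_exists_le T largeAvg (fun C => volume (treeCube α N C)) fun i => ?_
    rw [Fintype.card_fin]
    exact mul_sum_volume_le_of_lt_luxAvg α N ℓ (f i)
      (one_le_mul (by norm_num) (le_add_of_nonneg_left bot_le)) S _
      (fun C hC => hsub C (Finset.mem_filter.1 hC).1)
      (hdisj.subset (Finset.coe_subset.2 (Finset.filter_subset _ _)))
      (fun C hC => (Finset.mem_filter.1 hC).2)
  have hmean : 4 * ∑ C ∈ T with ∃ j, farMean j C, volume (treeCube α N C) ≤ V := by
    refine four_mul_sum_filter_exists_le T farMean (fun C => volume (treeCube α N C)) fun j => ?_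
    rw [Fintype.card_fin]
    exact mul_sum_volume_le_of_lt_abs_treeAvg_sub (hb j) (hK j) _ S _
      (fun C hC => hsub C (Finset.mem_filter.1 hC).1)
      (hdisj.subset (Finset.coe_subset.2 (Finset.filter_subset _ _)))
      (fun C hC => (Finset.mem_filter.1 hC).2)
  rw [← ENNReal.mul_le_mul_iff_right two_ne_zero ENNReal.ofNat_ne_top, ← mul_assoc, two_mul V,
    show (2 : ℝ≥0∞) * 2 = 4 by norm_num]
  refine le_trans ?_ (add_le_add hlux hmean)
  rw [← mul_add, Finset.sum_filter, Finset.sum_filter, ← Finset.sum_add_distrib]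
  gcongr with C hC
  rcases hT C hC with hi | hj
  · rw [if_pos hi]
    exact le_self_add
  · rw [if_pos hj]
    exact le_add_self

lemma volume_cell_le_two_mul_coreSet
    (hb : ∀ j, LocallyIntegrable (b j)) (hK : ∀ j, bmoNorm (b j) ≤ K)
    (S : (gridTree α N).StopCell (stopRel α N ℓ f b K)) :
    volume ((gridTree α N).cell S.1) ≤
      2 * volume ((gridTree α N).coreSet (stopRel α N ℓ f b K) S.1) := by
  refine CellTree.measure_cell_le_two_mul_coreSet S ?_ fun T hsub hT hdisj => ?_
  · rw [volume_cell]
    exact volume_treeCube_ne_top α N S.1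
  · simpa only [volume_cell] using two_mul_sum_volume_le_of_stopRel hb hK S.1 T hsub hT hdisj

/-- A bound for the oscillation of a symbol per stopping cube: the threshold of `stopRel` plus the
jump of its averages between a cube and its parent. -/
def oscConst (n m' : ℕ) (K : ℝ≥0) : ℝ≥0 := 4 * (m' + 1) * (K + 1) + 2 ^ n * K

lemma abs_treeAvg_sub_principalAt_le (j : Fin m') (t : ℕ) (x : Rn n) :
    |treeAvg (b j) α N (t, (gridTree α N).label t x) -
      treeAvg (b j) α N ((gridTree α N).principalAt (stopRel α N ℓ f b K) t x)| ≤
      (4 * (m' + 1) * (K + 1) : ℝ≥0) := by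
  rcases CellTree.principalAt_eq_or_not_bad (𝒯 := gridTree α N) (bad := stopRel α N ℓ f b K) t x
    with h | h
  · rw [h, sub_self, abs_zero]
    exact NNReal.coe_nonneg _
  · exact not_lt.1 fun hj => h (.inr ⟨j, hj⟩)

lemma enorm_sub_treeAvg_principalAt_le (hb : ∀ j, LocallyIntegrable (b j))
    (hK : ∀ j, bmoNorm (b j) ≤ K) (j : Fin m') {x : Rn n}
    (hx : Filter.Tendsto (fun t => treeAvg (b j) α N (t, (gridTree α N).label t x)) Filter.atTop
      (nhds (b j x))) (t : ℕ) :
    ‖b j x - treeAvg (b j) α N ((gridTree α N).principalAt (stopRel α N ℓ f b K) t x)‖ₑ ≤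
      oscConst n m' K * (gridTree α N).stopCount (stopRel α N ℓ f b K)
        ((gridTree α N).principalAt (stopRel α N ℓ f b K) t x).1 x := by
  set P := (gridTree α N).principalAt (stopRel α N ℓ f b K)
  set β : ℕ → ℝ := fun u => treeAvg (b j) α N (u, (gridTree α N).label u x)
  have hP : ∀ t, P t x = ((P t x).1, (gridTree α N).label (P t x).1 x) := fun t =>
    Prod.ext rfl (CellTree.mem_cell_principalAt t x).symm
  have hPβ : ∀ t, treeAvg (b j) α N (P t x) = β (P t x).1 := fun t =>
    congrArg (treeAvg (b j) α N) (hP t)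
  have hosc : ∀ u, (P t x).1 ≤ u → ‖β u - β (P t x).1‖ₑ ≤ oscConst n m' K *
      (gridTree α N).stopCount (stopRel α N ℓ f b K) (P t x).1 x := by
    intro u hu
    rw [Real.enorm_eq_ofReal_abs, oscConst, ENNReal.coe_add]
    refine CellTree.ofReal_abs_sub_le_stopCount β (fun v => ?_)
      (fun v => abs_treeAvg_succ_sub_le (hb j) (hK j) v x)
      ((CellTree.principalAt_principalAt t x).trans (hP t)) hu
    rw [← hPβ]
    exact abs_treeAvg_sub_principalAt_le j v x
  rw [hPβ]
  exact le_of_tendsto (hx.sub_const _).enorm ((Filter.eventually_ge_atTop _).mono hosc)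

lemma ae_tendsto_treeAvg (hb : ∀ j, LocallyIntegrable (b j)) :
    ∀ᵐ x, ∀ j, Filter.Tendsto (fun t => treeAvg (b j) α N (t, (gridTree α N).label t x))
      Filter.atTop (nhds (b j x)) :=
  ae_all_iff.2 fun j => ae_tendsto_average_gridCube α N (hb j)

end Stopping

section JohnNirenberg

lemma ofReal_exp_mul_eq_tsum {c u : ℝ} (hc : 0 ≤ c) (hu : 0 ≤ u) :
    ENNReal.ofReal (exp (c * u)) =
      ∑' s : ℕ, ENNReal.ofReal (c ^ s / s.factorial) * ENNReal.ofReal u ^ s := by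
  have hsum : HasSum (fun s : ℕ => (c * u) ^ s / s.factorial) (exp (c * u)) := by
    rw [Real.exp_eq_exp_ℝ]
    exact NormedSpace.expSeries_div_hasSum_exp (c * u)
  rw [← hsum.tsum_eq, ENNReal.ofReal_tsum_of_nonneg (fun s => by positivity) hsum.summable]
  refine tsum_congr fun s => ?_
  rw [← ENNReal.ofReal_pow hu, ← ENNReal.ofReal_mul (by positivity), mul_pow]
  congr 1; ring

-- The constant comes from `sˢ / s! ≤ eˢ`, which turns the exponential series into a geometric one.
lemma lintegral_ofReal_exp_le_of_lintegral_pow_le {X : Type*} [MeasurableSpace X] {μ : Measure X}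
    {g : X → ℝ} (hg : AEMeasurable g μ) (hg0 : ∀ x, 0 ≤ g x) {A : ℝ≥0} (hA : 0 < A)
    {V : ℝ≥0∞} (h : ∀ s : ℕ, ∫⁻ x, ENNReal.ofReal (g x) ^ s ∂μ ≤ (A * s) ^ s * V) :
    ∫⁻ x, ENNReal.ofReal (exp (1 / (2 * exp 1 * A) * g x)) ∂μ ≤ 2 * V := by
  set c : ℝ := 1 / (2 * exp 1 * A) with hc
  have hc0 : 0 < c := by positivity
  simp_rw [ofReal_exp_mul_eq_tsum hc0.le (hg0 _)]
  rw [lintegral_tsum fun s => (hg.ennreal_ofReal.pow_const s).const_mul _]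
  have hcoeff : ∀ s : ℕ, c ^ s / s.factorial * (A * s) ^ s ≤ (1 / 2 : ℝ) ^ s := by
    intro s
    have hfact := Real.pow_div_factorial_le_exp (s : ℝ) s.cast_nonneg s
    rw [← mul_one (s : ℝ), Real.exp_nat_mul, mul_one] at hfact
    calc c ^ s / s.factorial * ((A : ℝ) * s) ^ s
        = (c * A) ^ s * ((s : ℝ) ^ s / s.factorial) := by simp only [mul_pow]; ring
      _ ≤ (c * A) ^ s * exp 1 ^ s := by gcongr
      _ = (1 / 2) ^ s := by
          rw [← mul_pow, hc]
          congr 1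
          field_simp
  have hterm : ∀ s : ℕ, ∫⁻ x, ENNReal.ofReal (c ^ s / s.factorial) * ENNReal.ofReal (g x) ^ s ∂μ ≤
      2⁻¹ ^ s * V := by
    intro s
    rw [lintegral_const_mul' _ _ ENNReal.ofReal_ne_top]
    calc ENNReal.ofReal (c ^ s / s.factorial) * ∫⁻ x, ENNReal.ofReal (g x) ^ s ∂μ
        ≤ ENNReal.ofReal (c ^ s / s.factorial) * ((A * s) ^ s * V) := by gcongr; exact h s
      _ = ENNReal.ofReal (c ^ s / s.factorial * (A * s) ^ s) * V := by
          rw [ENNReal.ofReal_mul (by positivity), ENNReal.ofReal_pow (by positivity),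
            ENNReal.ofReal_mul A.coe_nonneg, ENNReal.ofReal_coe_nnreal, ENNReal.ofReal_natCast,
            mul_assoc]
      _ ≤ ENNReal.ofReal ((1 / 2) ^ s) * V := by gcongr; exact hcoeff s
      _ = 2⁻¹ ^ s * V := by
          rw [ENNReal.ofReal_pow (by norm_num), one_div, ENNReal.ofReal_inv_of_pos two_pos,
            ENNReal.ofReal_ofNat]
  refine (ENNReal.tsum_le_tsum hterm).trans (le_of_eq ?_)
  rw [ENNReal.tsum_mul_right, ENNReal.tsum_geometric, ENNReal.one_sub_inv_two, inv_inv]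

variable {n : ℕ}

lemma ae_enorm_sub_treeAvg_le_stopCount (α : Fin n → Fin 2) (k : ℤ) (z : Fin n → ℤ)
    {b : Rn n → ℝ} {K : ℝ≥0} (hb : LocallyIntegrable b) (hK : bmoNorm b ≤ K) :
    ∀ᵐ x ∂volume.restrict ((gridTree α k).cell (0, z)),
      ‖b x - treeAvg b α k (0, z)‖ₑ ≤ oscConst n 1 K * (gridTree α k).stopCount
        (stopRel α k 0 (fun _ : Fin 0 => 0) (fun _ : Fin 1 => b) K) 0 x := by
  rw [ae_restrict_iff' (measurableSet_gridTree_cell α k (0, z))]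
  filter_upwards [ae_tendsto_treeAvg (α := α) (N := k) (b := fun _ : Fin 1 => b) fun _ => hb]
    with x hx hxQ
  have h := enorm_sub_treeAvg_principalAt_le (ℓ := 0) (f := fun _ : Fin 0 => 0)
    (b := fun _ : Fin 1 => b) (fun _ => hb) (fun _ => hK) 0 (hx 0) 0
  rwa [CellTree.principalAt_zero, show (gridTree α k).label 0 x = z from hxQ] at h

lemma exists_setLIntegral_exp_sub_average_le (K : ℝ≥0) : ∃ c : ℝ, 0 < c ∧
    ∀ b : Rn n → ℝ, LocallyIntegrable b → bmoNorm b ≤ K →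
    ∀ (α : Fin n → Fin 2) (k : ℤ) (z : Fin n → ℤ),
    ∫⁻ y in gridCube α k z,
      ENNReal.ofReal (exp (c * |b y - ⨍ u in gridCube α k z, b u ∂volume|)) ≤
      2 * volume (gridCube α k z) := by
  have hA : 0 < 2 * oscConst n 1 K := by unfold oscConst; positivity
  refine ⟨1 / (2 * exp 1 * (2 * oscConst n 1 K : ℝ≥0)), by positivity, fun b hb hK α k z => ?_⟩
  have hcube : gridCube α k z = treeCube α k (0, z) := by simp [treeCube]
  have hg : AEMeasurable (fun y => |b y - treeAvg b α k (0, z)|) :=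
    (hb.aestronglyMeasurable.sub aestronglyMeasurable_const).norm.aemeasurable
  rw [hcube]
  refine lintegral_ofReal_exp_le_of_lintegral_pow_le hg.restrict (fun _ => abs_nonneg _) hA
    fun s => ?_
  set bad := stopRel α k 0 (fun _ : Fin 0 => 0) (fun _ : Fin 1 => b) K
  rw [← setLIntegral_cell_eq, ← volume_cell]
  simp_rw [← Real.enorm_eq_ofReal_abs]
  calc ∫⁻ y in (gridTree α k).cell (0, z), ‖b y - treeAvg b α k (0, z)‖ₑ ^ s
      ≤ ∫⁻ y in (gridTree α k).cell (0, z),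
          (oscConst n 1 K * (gridTree α k).stopCount bad 0 y) ^ s := by
        refine lintegral_mono_ae ?_
        filter_upwards [ae_enorm_sub_treeAvg_le_stopCount α k z hb hK] with y hy
        gcongr
    _ = oscConst n 1 K ^ s *
          ∫⁻ y in (gridTree α k).cell (0, z), (gridTree α k).stopCount bad 0 y ^ s := by
        simp_rw [mul_pow]
        exact lintegral_const_mul' _ _ (ENNReal.pow_ne_top ENNReal.coe_ne_top)
    _ ≤ oscConst n 1 K ^ s *
          ((s * (2 : ℝ≥0)) ^ s * volume ((gridTree α k).cell (0, z))) := by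
        gcongr
        exact CellTree.setLIntegral_stopCount_pow_le (measurable_gridTree_label α k)
          (volume_cell_le_two_mul_coreSet (fun _ => hb) fun _ => hK) z s
    _ = _ := by push_cast; ring

lemma exists_setLIntegral_sub_average_mul_le_luxAvg (K : ℝ≥0) : ∃ C : ℝ≥0,
    ∀ b : Rn n → ℝ, LocallyIntegrable b → bmoNorm b ≤ K →
    ∀ (f : Rn n → ℝ) (α : Fin n → Fin 2) (k : ℤ) (z : Fin n → ℤ),
    ∫⁻ y in gridCube α k z, ‖b y - ⨍ u in gridCube α k z, b u ∂volume‖ₑ * ‖f y‖ₑ ≤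
      C * luxAvg (youngLog 1) f (gridCube α k z) * volume (gridCube α k z) := by
  obtain ⟨c, hc, hJN⟩ := exists_setLIntegral_exp_sub_average_le (n := n) K
  refine ⟨(3 / c).toNNReal, fun b hb hK f α k z => ?_⟩
  exact setLIntegral_mul_le_luxAvg_of_setLIntegral_exp_le (volume_cube_ne_zero _ (by positivity))
    (volume_cube_ne_top _ _)
    (hb.aestronglyMeasurable.sub aestronglyMeasurable_const).aemeasurable.restrict hc
    (hJN b hb hK α k z) f

end JohnNirenberg

section Domination

lemma ennreal_tsum_rpow_le {ι : Type*} (u : ι → ℝ≥0∞) {θ : ℝ} (hθ : 0 < θ) (hθ1 : θ ≤ 1) :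
    (∑' i, u i) ^ θ ≤ ∑' i, u i ^ θ := by
  classical
  have hfin : ∀ T : Finset ι, (∑ i ∈ T, u i) ^ θ ≤ ∑ i ∈ T, u i ^ θ := fun T => by
    induction T using Finset.induction_on with
    | empty => simp [hθ]
    | insert i T hi ih =>
      rw [Finset.sum_insert hi, Finset.sum_insert hi]
      exact (ENNReal.rpow_add_le_add_rpow _ _ hθ.le hθ1).trans (by gcongr)
  rw [ENNReal.tsum_eq_iSup_sum, ← ENNReal.orderIsoRpow_apply θ hθ, OrderIso.map_iSup]
  exact iSup_le fun T => (hfin T).trans (ENNReal.sum_le_tsum T)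

lemma tsum_ite_le_eq_tsum_add (g : ℕ → ℝ≥0∞) (u : ℕ) :
    ∑' t, (if u ≤ t then g t else 0) = ∑' t, g (t + u) := by
  have hsplit := Summable.sum_add_tsum_nat_add' (f := fun t => if u ≤ t then g t else 0) (k := u)
    ENNReal.summable
  rw [← hsplit, Finset.sum_eq_zero fun t ht => if_neg (Finset.mem_range.1 ht).not_ge, zero_add]
  exact tsum_congr fun t => if_pos (Nat.le_add_left u t)

variable {n m m' : ℕ}

/-- The product of the Luxemburg averages of the `fᵢ` over a cube of the tree. -/
def treeProd (α : Fin n → Fin 2) (N : ℤ) (ℓ : ℕ) (f : Fin m → Rn n → ℝ)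
    (S : ℕ × (Fin n → ℤ)) : ℝ≥0∞ :=
  ∏ i, luxAvg (youngLog ℓ) (f i) (treeCube α N S)

/-- The product of the Luxemburg averages over the cube of side `2ᵏ` containing `x`, weighted by the
oscillation of the symbols at `x`. Taking `m' = 0` symbols covers the operator without
commutators. -/
def gridTerm (α : Fin n → Fin 2) (ℓ : ℕ) (f : Fin m → Rn n → ℝ) (b : Fin m' → Rn n → ℝ) (k : ℤ)
    (x : Rn n) : ℝ≥0∞ :=
  (1 + ∑ j, ‖b j x - ⨍ y in gridCube α k (gridIndex α k x), b j y ∂volume‖ₑ) *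
    ∏ i, luxAvg (youngLog ℓ) (f i) (gridCube α k (gridIndex α k x))

/-- The factor lost in `gridTerm` when a cube is replaced by its principal cube and the oscillation
by the number of stopping cubes. -/
def gridTermConst (n m m' : ℕ) (K : ℝ≥0) : ℝ≥0 :=
  (1 + m' * (2 * oscConst n m' K)) * (4 * (m + 1)) ^ m

/-- The coefficient of a stopping cube. The cubes of generation `t` have side length `2^(N-t)`. -/
def stopCoeff (Ψ : ℝ → ℝ≥0∞) (θ : ℝ) (α : Fin n → Fin 2) (N : ℤ) (ℓ : ℕ) (f : Fin m → Rn n → ℝ)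
    (S : ℕ × (Fin n → ℤ)) : ℝ≥0∞ :=
  (Ψ (2 ^ (N - S.1)) * treeProd α N ℓ f S) ^ θ

variable {α : Fin n → Fin 2} {N : ℤ} {ℓ : ℕ} {f : Fin m → Rn n → ℝ} {b : Fin m' → Rn n → ℝ}
  {K : ℝ≥0}

lemma enorm_sub_treeAvg_le_stopCount (hb : ∀ j, LocallyIntegrable (b j))
    (hK : ∀ j, bmoNorm (b j) ≤ K) (j : Fin m') {x : Rn n}
    (hx : Filter.Tendsto (fun t => treeAvg (b j) α N (t, (gridTree α N).label t x)) Filter.atTop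
      (nhds (b j x))) (t : ℕ) :
    ‖b j x - treeAvg (b j) α N (t, (gridTree α N).label t x)‖ₑ ≤
      2 * oscConst n m' K * (gridTree α N).stopCount (stopRel α N ℓ f b K)
        ((gridTree α N).principalAt (stopRel α N ℓ f b K) t x).1 x := by
  set P := (gridTree α N).principalAt (stopRel α N ℓ f b K) t x
  set c := (gridTree α N).stopCount (stopRel α N ℓ f b K) P.1 x
  have hprincipal : ‖treeAvg (b j) α N P - treeAvg (b j) α N (t, (gridTree α N).label t x)‖ₑ ≤
      oscConst n m' K * c := by
    rw [Real.enorm_eq_ofReal_abs, abs_sub_comm]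
    calc _ ≤ ENNReal.ofReal ((4 * (m' + 1) * (K + 1) : ℝ≥0) : ℝ) :=
          ENNReal.ofReal_le_ofReal (abs_treeAvg_sub_principalAt_le j t x)
      _ ≤ oscConst n m' K * 1 := by
          rw [ENNReal.ofReal_coe_nnreal, mul_one]
          exact ENNReal.coe_le_coe.2 le_self_add
      _ ≤ oscConst n m' K * c := by
          gcongr
          exact CellTree.one_le_stopCount_principalAt t x
  calc ‖b j x - treeAvg (b j) α N (t, (gridTree α N).label t x)‖ₑ
      = ‖(b j x - treeAvg (b j) α N P) +
          (treeAvg (b j) α N P - treeAvg (b j) α N (t, (gridTree α N).label t x))‖ₑ := by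
        rw [sub_add_sub_cancel]
    _ ≤ oscConst n m' K * c + oscConst n m' K * c :=
        (enorm_add_le _ _).trans
          (add_le_add (enorm_sub_treeAvg_principalAt_le hb hK j hx t) hprincipal)
    _ = 2 * oscConst n m' K * c := by ring

lemma treeProd_le_treeProd_principalAt (t : ℕ) (x : Rn n) :
    treeProd α N ℓ f (t, (gridTree α N).label t x) ≤ ((4 * (m + 1)) ^ m : ℝ≥0) *
      treeProd α N ℓ f ((gridTree α N).principalAt (stopRel α N ℓ f b K) t x) := by
  set P := (gridTree α N).principalAt (stopRel α N ℓ f b K) t x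
  have hfactor : ∀ i, luxAvg (youngLog ℓ) (f i) (treeCube α N (t, (gridTree α N).label t x)) ≤
      (4 * (m + 1) : ℝ≥0) * luxAvg (youngLog ℓ) (f i) (treeCube α N P) := by
    intro i
    rcases CellTree.principalAt_eq_or_not_bad (𝒯 := gridTree α N) (bad := stopRel α N ℓ f b K) t x
      with h | h
    · rw [show P = _ from h]
      refine le_mul_of_one_le_left bot_le (ENNReal.one_le_coe_iff.2 ?_)
      exact one_le_mul (by norm_num) (le_add_of_nonneg_left bot_le)
    · exact not_lt.1 fun hi => h (.inl ⟨i, hi⟩)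
  calc treeProd α N ℓ f (t, (gridTree α N).label t x)
      ≤ ∏ i, (4 * (m + 1) : ℝ≥0) * luxAvg (youngLog ℓ) (f i) (treeCube α N P) :=
        Finset.prod_le_prod' fun i _ => hfactor i
    _ = _ := by
        rw [Finset.prod_mul_distrib, Finset.prod_const, Finset.card_univ, Fintype.card_fin,
          treeProd, ENNReal.coe_pow]

lemma gridTerm_le (hb : ∀ j, LocallyIntegrable (b j)) (hK : ∀ j, bmoNorm (b j) ≤ K) {x : Rn n}
    (hx : ∀ j, Filter.Tendsto (fun t => treeAvg (b j) α N (t, (gridTree α N).label t x))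
      Filter.atTop (nhds (b j x))) (t : ℕ) :
    gridTerm α ℓ f b (N - t) x ≤ gridTermConst n m m' K *
      ((gridTree α N).stopCount (stopRel α N ℓ f b K)
          ((gridTree α N).principalAt (stopRel α N ℓ f b K) t x).1 x *
        treeProd α N ℓ f ((gridTree α N).principalAt (stopRel α N ℓ f b K) t x)) := by
  set P := (gridTree α N).principalAt (stopRel α N ℓ f b K) t x
  set c := (gridTree α N).stopCount (stopRel α N ℓ f b K) P.1 x
  have hosc : 1 + ∑ j, ‖b j x - treeAvg (b j) α N (t, (gridTree α N).label t x)‖ₑ ≤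
      (1 + m' * (2 * oscConst n m' K)) * c := by
    calc _ ≤ c + ∑ _j : Fin m', 2 * oscConst n m' K * c :=
          add_le_add (CellTree.one_le_stopCount_principalAt t x)
            (Finset.sum_le_sum fun j _ => enorm_sub_treeAvg_le_stopCount hb hK j (hx j) t)
      _ = _ := by
          rw [Finset.sum_const, Finset.card_univ, Fintype.card_fin, nsmul_eq_mul]
          ring
  calc gridTerm α ℓ f b (N - t) x
      = (1 + ∑ j, ‖b j x - treeAvg (b j) α N (t, (gridTree α N).label t x)‖ₑ) *
          treeProd α N ℓ f (t, (gridTree α N).label t x) := rfl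
    _ ≤ ((1 + m' * (2 * oscConst n m' K)) * c) *
          (((4 * (m + 1)) ^ m : ℝ≥0) * treeProd α N ℓ f P) := by
        gcongr
        exact treeProd_le_treeProd_principalAt t x
    _ = _ := by
        rw [gridTermConst]
        push_cast
        ring

lemma mul_gridTerm_rpow_le_tsum {θ : ℝ} (hθ : 0 < θ) (hθ1 : θ ≤ 1) (a : ℝ≥0∞)
    (hb : ∀ j, LocallyIntegrable (b j)) (hK : ∀ j, bmoNorm (b j) ≤ K) {x : Rn n}
    (hx : ∀ j, Filter.Tendsto (fun t => treeAvg (b j) α N (t, (gridTree α N).label t x))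
      Filter.atTop (nhds (b j x))) (t : ℕ) :
    (a * gridTerm α ℓ f b (N - t) x) ^ θ ≤ gridTermConst n m m' K ^ θ *
      ∑' S : (gridTree α N).StopCell (stopRel α N ℓ f b K),
        ((gridTree α N).cell S.1).indicator (fun _ => treeProd α N ℓ f S.1 ^ θ) x *
          (gridTree α N).stopCount (stopRel α N ℓ f b K) S.1.1 x *
          if S.1.1 ≤ t then a ^ θ else 0 := by
  set bad := stopRel α N ℓ f b K
  set P := (gridTree α N).principalAt bad t x
  set c := (gridTree α N).stopCount bad P.1 x
  set D := (gridTermConst n m m' K : ℝ≥0∞)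
  have hPstop : (gridTree α N).principal bad P.1 P.2 = P := by
    rw [← CellTree.mem_cell_principalAt t x]
    exact CellTree.principalAt_principalAt t x
  refine le_trans ?_ (mul_le_mul_right (ENNReal.le_tsum ⟨P, hPstop⟩) _)
  rw [if_pos (CellTree.principalAt_fst_le t x),
    Set.indicator_of_mem (CellTree.mem_cell_principalAt t x)]
  have hc : c ^ θ ≤ c := by
    conv_rhs => rw [← ENNReal.rpow_one c]
    exact ENNReal.rpow_le_rpow_of_exponent_le (CellTree.one_le_stopCount_principalAt t x) hθ1
  calc (a * gridTerm α ℓ f b (N - t) x) ^ θ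
      ≤ (a * (D * (c * treeProd α N ℓ f P))) ^ θ := by
        gcongr
        exact gridTerm_le hb hK hx t
    _ = D ^ θ * (treeProd α N ℓ f P ^ θ * c ^ θ * a ^ θ) := by
        simp only [ENNReal.mul_rpow_of_nonneg _ _ hθ.le]
        ring
    _ ≤ D ^ θ * (treeProd α N ℓ f P ^ θ * c * a ^ θ) := by gcongr

lemma tsum_mul_gridTerm_rpow_le {θ : ℝ} (hθ : 0 < θ) (hθ1 : θ ≤ 1) {a : ℤ → ℝ≥0∞}
    {Ψ : ℝ → ℝ≥0∞} (hΨ : ∀ k : ℤ, ∑' t : ℕ, a (k - t) ^ θ ≤ Ψ (2 ^ k) ^ θ)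
    (hb : ∀ j, LocallyIntegrable (b j)) (hK : ∀ j, bmoNorm (b j) ≤ K) {x : Rn n}
    (hx : ∀ j, Filter.Tendsto (fun t => treeAvg (b j) α N (t, (gridTree α N).label t x))
      Filter.atTop (nhds (b j x))) :
    (∑' t : ℕ, a (N - t) * gridTerm α ℓ f b (N - t) x) ^ θ ≤ gridTermConst n m m' K ^ θ *
      ∑' S : (gridTree α N).StopCell (stopRel α N ℓ f b K),
        ((gridTree α N).cell S.1).indicator (fun _ => stopCoeff Ψ θ α N ℓ f S.1) x *
          (gridTree α N).stopCount (stopRel α N ℓ f b K) S.1.1 x := by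
  refine (ennreal_tsum_rpow_le _ hθ hθ1).trans ((ENNReal.tsum_le_tsum fun t : ℕ =>
    mul_gridTerm_rpow_le_tsum hθ hθ1 (a (N - t)) hb hK hx t).trans ?_)
  rw [ENNReal.tsum_mul_left, ENNReal.tsum_comm]
  gcongr with S
  have hmass : ∑' t : ℕ, (if S.1.1 ≤ t then a (N - t) ^ θ else 0) ≤
      Ψ (2 ^ (N - S.1.1)) ^ θ := by
    rw [tsum_ite_le_eq_tsum_add fun t => a (N - t) ^ θ]
    refine (tsum_congr fun t => ?_).trans_le (hΨ (N - S.1.1))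
    rw [Nat.cast_add, ← sub_sub, sub_right_comm]
  rw [ENNReal.tsum_mul_left]
  by_cases hS : x ∈ (gridTree α N).cell S.1
  · simp only [Set.indicator_of_mem hS]
    refine (mul_le_mul_right hmass _).trans_eq ?_
    rw [stopCoeff, ENNReal.mul_rpow_of_nonneg _ _ hθ.le]
    ring
  · simp only [Set.indicator_of_notMem hS, zero_mul]
    exact le_rfl

lemma tsum_indicator_coreSet_stopCoeff_le_maximal (Ψ : ℝ → ℝ≥0∞) {θ : ℝ} (hθ : 0 ≤ θ) (x : Rn n) :
    ∑' S : (gridTree α N).StopCell (stopRel α N ℓ f b K),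
      ((gridTree α N).coreSet (stopRel α N ℓ f b K) S.1).indicator
        (fun _ => stopCoeff Ψ θ α N ℓ f S.1) x ≤ maximal Ψ (youngLog ℓ) f x ^ θ := by
  refine CellTree.tsum_indicator_coreSet_le _ fun S hS => ENNReal.rpow_le_rpow ?_ hθ
  have hxS := cell_subset_treeCube α N S.1 (CellTree.coreSet_subset_cell S.1 hS)
  refine le_iSup₂_of_le (gridCorner α (N - S.1.1) S.1.2) (2 ^ (N - S.1.1)) ?_
  exact le_iSup₂ (f := fun (_ : (0 : ℝ) < 2 ^ (N - S.1.1)) (_ : x ∈ cube _ _) => _)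
    (by positivity) hxS

lemma lintegral_tsum_nat_mul_gridTerm_rpow_le {μ : Measure (Rn n)} (hμ : μ ≪ volume) {θ p : ℝ}
    (hθ : 0 < θ) (hθ1 : θ ≤ 1) (hp : θ ≤ p) {A : ℝ≥0}
    (hA : ∀ S : (gridTree α N).StopCell (stopRel α N ℓ f b K),
      μ ((gridTree α N).cell S.1) ≤ A * μ ((gridTree α N).coreSet (stopRel α N ℓ f b K) S.1))
    {a : ℤ → ℝ≥0∞} {Ψ : ℝ → ℝ≥0∞} (hΨ : ∀ k : ℤ, ∑' t : ℕ, a (k - t) ^ θ ≤ Ψ (2 ^ k) ^ θ)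
    (hb : ∀ j, LocallyIntegrable (b j)) (hK : ∀ j, bmoNorm (b j) ≤ K) :
    ∫⁻ x, (∑' t : ℕ, a (N - t) * gridTerm α ℓ f b (N - t) x) ^ p ∂μ ≤
      gridTermConst n m m' K ^ p * ((ENNReal.ofReal (p / θ) * A) ^ (p / θ) *
        ((ENNReal.ofReal (p / θ) * A) ^ (p / θ) *
          ∫⁻ x, (∑' S : (gridTree α N).StopCell (stopRel α N ℓ f b K),
            ((gridTree α N).coreSet (stopRel α N ℓ f b K) S.1).indicator
              (fun _ => stopCoeff Ψ θ α N ℓ f S.1) x) ^ (p / θ) ∂μ)) := by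
  have hs : 1 ≤ p / θ := (one_le_div hθ).2 hp
  have hs0 : 0 ≤ p / θ := zero_le_one.trans hs
  have hDtop : (gridTermConst n m m' K : ℝ≥0∞) ^ p ≠ ∞ :=
    ENNReal.rpow_ne_top_of_nonneg (hθ.le.trans hp) ENNReal.coe_ne_top
  refine le_trans (lintegral_mono_ae ?_) ((lintegral_const_mul' _ _ hDtop).trans_le
    (mul_le_mul_right (CellTree.lintegral_tsum_indicator_cell_mul_stopCount_rpow_le
      (measurable_gridTree_label α N) hA (fun S => stopCoeff Ψ θ α N ℓ f S.1) hs) _))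
  filter_upwards [hμ.ae_le (ae_tendsto_treeAvg (α := α) (N := N) hb)] with x hx
  have hpow := ENNReal.rpow_le_rpow
    (tsum_mul_gridTerm_rpow_le (ℓ := ℓ) (f := f) hθ hθ1 hΨ hb hK hx) hs0
  rwa [ENNReal.mul_rpow_of_nonneg _ _ hs0, ← ENNReal.rpow_mul, ← ENNReal.rpow_mul,
    mul_div_cancel₀ p hθ.ne'] at hpow

lemma aemeasurable_gridTerm (α : Fin n → Fin 2) (ℓ : ℕ) (f : Fin m → Rn n → ℝ)
    {b : Fin m' → Rn n → ℝ} (hb : ∀ j, LocallyIntegrable (b j)) (k : ℤ) :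
    AEMeasurable (gridTerm α ℓ f b k) := by
  have hcomp : ∀ {Y : Type} [MeasurableSpace Y] (F : (Fin n → ℤ) → Y),
      AEMeasurable fun x : Rn n => F (gridIndex α k x) := fun F =>
    ((measurable_of_countable F).comp (measurable_gridIndex α k)).aemeasurable
  refine AEMeasurable.mul (AEMeasurable.const_add (Finset.aemeasurable_fun_sum _ fun j _ => ?_) 1)
    (hcomp fun z => ∏ i, luxAvg (youngLog ℓ) (f i) (gridCube α k z))
  exact ((hb j).aestronglyMeasurable.aemeasurable.sub
    (hcomp fun z => ⨍ y in gridCube α k z, b j y ∂volume)).enorm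

lemma IsWeight.lintegral_withDensity {w : Rn n → ℝ} (hw : IsWeight w) {g : Rn n → ℝ≥0∞}
    (hg : AEMeasurable g) :
    ∫⁻ x, g x ∂volume.withDensity (fun x => ENNReal.ofReal (w x)) =
      ∫⁻ x, g x * ENNReal.ofReal (w x) := by
  rw [lintegral_withDensity_eq_lintegral_mul₀ hw.aemeasurable_ofReal hg]
  exact lintegral_congr fun x => mul_comm _ _

lemma MemAInfty.exists_lintegral_tsum_nat_mul_gridTerm_le (m m' : ℕ) {w : Rn n → ℝ}
    (hw : MemAInfty w) (K : ℝ≥0) {θ p : ℝ} (hθ : 0 < θ) (hθ1 : θ ≤ 1) (hp : θ ≤ p) : ∃ C : ℝ≥0,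
    ∀ (a : ℤ → ℝ≥0∞) (Ψ : ℝ → ℝ≥0∞), (∀ k : ℤ, ∑' t : ℕ, a (k - t) ^ θ ≤ Ψ (2 ^ k) ^ θ) →
    ∀ (α : Fin n → Fin 2) (ℓ : ℕ) (f : Fin m → Rn n → ℝ) (b : Fin m' → Rn n → ℝ),
      (∀ j, LocallyIntegrable (b j)) → (∀ j, bmoNorm (b j) ≤ K) → ∀ N : ℤ,
    ∫⁻ x, (∑' t : ℕ, a (N - t) * gridTerm α ℓ f b (N - t) x) ^ p
        ∂volume.withDensity (fun x => ENNReal.ofReal (w x)) ≤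
      C * ∫⁻ x, maximal Ψ (youngLog ℓ) f x ^ p * ENNReal.ofReal (w x) := by
  obtain ⟨A, hA⟩ := hw.exists_withDensity_cube_le
  obtain ⟨r, -, hwr, -⟩ := hw
  have hs : 1 ≤ p / θ := (one_le_div hθ).2 hp
  set B : ℝ≥0 := ((p / θ).toNNReal * A) ^ (p / θ)
  refine ⟨gridTermConst n m m' K ^ p * (B * B), fun a Ψ hΨ α ℓ f b hb hK N => ?_⟩
  set μ := (volume : Measure (Rn n)).withDensity fun x => ENNReal.ofReal (w x)
  have hcore : ∀ S : (gridTree α N).StopCell (stopRel α N ℓ f b K), μ ((gridTree α N).cell S.1) ≤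
      A * μ ((gridTree α N).coreSet (stopRel α N ℓ f b K) S.1) := by
    intro S
    refine (measure_mono (cell_subset_treeCube α N S.1)).trans (hA _ _ (by positivity) _
      ((CellTree.coreSet_subset_cell S.1).trans (cell_subset_treeCube α N S.1))
      (CellTree.measurableSet_coreSet (measurable_gridTree_label α N) S.1) ?_)
    have hcell := volume_cell_le_two_mul_coreSet (ℓ := ℓ) (f := f) hb hK S
    rwa [volume_cell] at hcell
  have hmaximal : ∫⁻ x, (∑' S : (gridTree α N).StopCell (stopRel α N ℓ f b K),
      ((gridTree α N).coreSet (stopRel α N ℓ f b K) S.1).indicator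
        (fun _ => stopCoeff Ψ θ α N ℓ f S.1) x) ^ (p / θ) ∂μ ≤
      ∫⁻ x, maximal Ψ (youngLog ℓ) f x ^ p * ENNReal.ofReal (w x) := by
    have hmeas : Measurable fun x => (∑' S : (gridTree α N).StopCell (stopRel α N ℓ f b K),
        ((gridTree α N).coreSet (stopRel α N ℓ f b K) S.1).indicator
          (fun _ => stopCoeff Ψ θ α N ℓ f S.1) x) ^ (p / θ) :=
      (Measurable.tsum fun S => measurable_const.indicator
        (CellTree.measurableSet_coreSet (measurable_gridTree_label α N) _)).pow_const _
    refine (hwr.lintegral_withDensity hmeas.aemeasurable).trans_le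
      (lintegral_mono fun x => mul_le_mul_left ?_ _)
    have hpow := ENNReal.rpow_le_rpow (tsum_indicator_coreSet_stopCoeff_le_maximal (α := α)
      (N := N) (ℓ := ℓ) (f := f) (b := b) (K := K) Ψ hθ.le x) (zero_le_one.trans hs)
    rwa [← ENNReal.rpow_mul, mul_div_cancel₀ p hθ.ne'] at hpow
  refine (lintegral_tsum_nat_mul_gridTerm_rpow_le (withDensity_absolutelyContinuous _ _) hθ hθ1 hp
    hcore hΨ hb hK).trans ((mul_le_mul_right (mul_le_mul_right (mul_le_mul_right hmaximal _) _)
      _).trans_eq ?_)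
  push_cast [B, ENNReal.coe_rpow_of_nonneg _ (zero_le_one.trans hs),
    ENNReal.coe_rpow_of_nonneg _ (hθ.le.trans hp)]
  rw [ENNReal.ofReal]
  ring

lemma tsum_int_eq_iSup_tsum_nat (g : ℤ → ℝ≥0∞) :
    ∑' k, g k = ⨆ N : ℕ, ∑' t : ℕ, g (N - t) := by
  classical
  refine le_antisymm ?_ (iSup_le fun N => ENNReal.tsum_comp_le_tsum_of_injective
    (f := fun t : ℕ => (N - t : ℤ)) (fun s t h => by simpa using h) g)
  rw [ENNReal.tsum_eq_iSup_sum]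
  refine iSup_le fun T => ?_
  obtain ⟨M, hM⟩ := T.bddAbove
  have hsub : ∀ k ∈ T, (M.toNat : ℤ) - ((M.toNat - k).toNat : ℕ) = k := by
    intro k hk
    have := hM hk
    omega
  calc ∑ k ∈ T, g k
      = ∑ t ∈ T.image fun k : ℤ => ((M.toNat : ℤ) - k).toNat, g ((M.toNat : ℤ) - t) := by
        rw [Finset.sum_image fun k hk l hl h => by rw [← hsub k hk, ← hsub l hl, h]]
        exact Finset.sum_congr rfl fun k hk => by rw [hsub k hk]
    _ ≤ ∑' t : ℕ, g (M.toNat - t) := ENNReal.sum_le_tsum _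
    _ ≤ ⨆ N : ℕ, ∑' t : ℕ, g (N - t) := le_iSup (fun N : ℕ => ∑' t : ℕ, g (N - t)) M.toNat

lemma monotone_tsum_nat_sub (g : ℤ → ℝ≥0∞) : Monotone fun N : ℕ => ∑' t : ℕ, g (N - t) := by
  intro N M hNM
  refine le_of_eq_of_le (tsum_congr fun t => ?_) (ENNReal.tsum_comp_le_tsum_of_injective
    (f := fun t => t + (M - N)) (add_left_injective _) fun t : ℕ => g (M - t))
  congr 1
  push_cast [Nat.cast_sub hNM]
  ring

lemma lintegral_tsum_int_rpow_le {X : Type*} [MeasurableSpace X] {μ : Measure X}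
    {g : ℤ → X → ℝ≥0∞} (hg : ∀ k, AEMeasurable (g k) μ) {p : ℝ} (hp : 0 < p) {B : ℝ≥0∞}
    (hB : ∀ N : ℕ, ∫⁻ x, (∑' t : ℕ, g (N - t) x) ^ p ∂μ ≤ B) :
    ∫⁻ x, (∑' k, g k x) ^ p ∂μ ≤ B := by
  have hsup : ∀ x, (∑' k, g k x) ^ p = ⨆ N : ℕ, (∑' t : ℕ, g (N - t) x) ^ p := fun x => by
    rw [tsum_int_eq_iSup_tsum_nat, ← ENNReal.orderIsoRpow_apply p hp, OrderIso.map_iSup]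
    rfl
  simp_rw [hsup]
  rw [lintegral_iSup' (fun N => (AEMeasurable.tsum fun t => hg _).pow_const p)
    (.of_forall fun x N M hNM => ENNReal.rpow_le_rpow
      (monotone_tsum_nat_sub (fun k => g k x) hNM) hp.le)]
  exact iSup_le hB

lemma MemAInfty.exists_lintegral_tsum_int_mul_gridTerm_le (m m' : ℕ) {w : Rn n → ℝ}
    (hw : MemAInfty w) (K : ℝ≥0) {θ p : ℝ} (hθ : 0 < θ) (hθ1 : θ ≤ 1) (hp : θ ≤ p) : ∃ C : ℝ≥0,
    ∀ (a : ℤ → ℝ≥0∞) (Ψ : ℝ → ℝ≥0∞), (∀ k : ℤ, ∑' t : ℕ, a (k - t) ^ θ ≤ Ψ (2 ^ k) ^ θ) →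
    ∀ (α : Fin n → Fin 2) (ℓ : ℕ) (f : Fin m → Rn n → ℝ) (b : Fin m' → Rn n → ℝ),
      (∀ j, LocallyIntegrable (b j)) → (∀ j, bmoNorm (b j) ≤ K) →
    ∫⁻ x, (∑' k : ℤ, a k * gridTerm α ℓ f b k x) ^ p * ENNReal.ofReal (w x) ≤
      C * ∫⁻ x, maximal Ψ (youngLog ℓ) f x ^ p * ENNReal.ofReal (w x) := by
  obtain ⟨C, hC⟩ := hw.exists_lintegral_tsum_nat_mul_gridTerm_le m m' K hθ hθ1 hp
  obtain ⟨r, -, hwr, -⟩ := hw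
  refine ⟨C, fun a Ψ hΨ α ℓ f b hb hK => ?_⟩
  have hmeas : ∀ k, AEMeasurable fun x => a k * gridTerm α ℓ f b k x := fun k =>
    (aemeasurable_gridTerm α ℓ f hb k).const_mul _
  rw [← hwr.lintegral_withDensity ((AEMeasurable.tsum hmeas).pow_const p)]
  exact lintegral_tsum_int_rpow_le
    (fun k => (hmeas k).mono_ac (withDensity_absolutelyContinuous _ _)) (hθ.trans_le hp)
    fun N => hC a Ψ hΨ α ℓ f b hb hK N

end Domination

section Discretization

lemma enorm_finset_prod {ι R : Type*} [NormedField R] (s : Finset ι) (u : ι → R) :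
    ‖∏ i ∈ s, u i‖ₑ = ∏ i ∈ s, ‖u i‖ₑ := by
  simp only [enorm_eq_nnnorm, nnnorm_prod, ENNReal.ofNNReal_finsetProd]

lemma aemeasurable_prod_comp_eval {ι E : Type*} [Fintype ι] [MeasurableSpace E] {μ : ι → Measure E}
    [∀ i, SigmaFinite (μ i)] {g : ι → E → ℝ≥0∞} (hg : ∀ i, AEMeasurable (g i) (μ i)) :
    AEMeasurable (fun y : ι → E => ∏ i, g i (y i)) (Measure.pi μ) :=
  Finset.aemeasurable_fun_prod _ fun i _ =>
    (hg i).comp_quasiMeasurePreserving (Measure.quasiMeasurePreserving_eval μ i)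

lemma lintegral_fin_prod_eq_prod {E : Type*} [MeasurableSpace E] : ∀ {m : ℕ} {μ : Fin m → Measure E}
    [∀ i, SigmaFinite (μ i)] {g : Fin m → E → ℝ≥0∞}, (∀ i, AEMeasurable (g i) (μ i)) →
    ∫⁻ y, ∏ i, g i (y i) ∂(Measure.pi μ) = ∏ i, ∫⁻ y, g i y ∂(μ i)
  | 0, μ, _, g, _ => by simp
  | m + 1, μ, _, g, hg => by
    rw [← ((measurePreserving_piFinSuccAbove μ 0).symm).lintegral_comp_emb
      (MeasurableEquiv.measurableEmbedding _)]
    simp_rw [MeasurableEquiv.piFinSuccAbove_symm_apply, Fin.insertNthEquiv,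
      Fin.prod_univ_succ, Fin.insertNth_zero, Equiv.coe_fn_mk, Fin.cons_succ,
      Fin.zero_succAbove, cast_eq, Fin.cons_zero]
    rw [lintegral_prod_mul (hg 0) (aemeasurable_prod_comp_eval fun i : Fin m => hg i.succ),
      lintegral_fin_prod_eq_prod fun i => hg i.succ]

variable {n m : ℕ} {φ : (Fin m → Rn n) → ℝ} {δ ε : ℝ}

/-- The integral of the kernel over the annulus at scale `2ᵏ`. -/
def annulusMass (φ : (Fin m → Rn n) → ℝ) (δ ε : ℝ) (k : ℤ) : ℝ≥0∞ :=
  ∫⁻ y in annulus n m ((2 : ℝ) ^ k) δ ε, ENNReal.ofReal (φ y)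

lemma tsum_annulusMass_le_Phi (φ : (Fin m → Rn n) → ℝ) (δ ε : ℝ) {θ : ℝ} (hθ : θ ≠ 0) (k : ℤ) :
    ∑' t : ℕ, annulusMass φ δ ε (k - t - 4) ^ θ ≤ Phi φ δ ε θ (2 ^ k) ^ θ := by
  rw [Phi, ← ENNReal.rpow_mul, one_div_mul_cancel hθ, ENNReal.rpow_one]
  let scale : ℕ → {ν : ℤ // (2 : ℝ) ^ (-ν) ≤ 2 ^ k} := fun t =>
    ⟨-(k - t - 4), zpow_le_zpow_right₀ one_le_two (by omega)⟩
  have hscale : Function.Injective scale := fun s t h => by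
    have := congrArg Subtype.val h
    simp only [scale] at this
    omega
  refine le_of_eq_of_le (tsum_congr fun t => ?_)
    (ENNReal.tsum_comp_le_tsum_of_injective hscale _)
  simp only [scale, neg_neg, annulusMass]

lemma measurableSet_annulus (t δ ε : ℝ) : MeasurableSet (annulus n m t δ ε) := by
  have hsum : Measurable fun y : Fin m → Rn n => ∑ i, ‖y i‖ :=
    Finset.measurable_fun_sum _ fun i _ => (measurable_pi_apply i).norm
  exact (measurableSet_lt measurable_const hsum).inter (measurableSet_le hsum measurable_const)

/-- The points `y` for which `(x - y₁, …, x - y_m)` lies in the annulus `𝒜(2ᵏ,1,0)`. -/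
def annulusAround (m : ℕ) (x : Rn n) (k : ℤ) : Set (Fin m → Rn n) :=
  (fun y i => x - y i) ⁻¹' annulus n m (2 ^ k) 1 0

lemma measurableSet_annulusAround (x : Rn n) (k : ℤ) : MeasurableSet (annulusAround m x k) := by
  have hsub : Measurable fun (y : Fin m → Rn n) (i : Fin m) => x - y i :=
    measurable_pi_lambda _ fun i => measurable_const.sub (measurable_pi_apply i)
  exact hsub (measurableSet_annulus _ _ _)

lemma norm_sub_le_of_mem_annulusAround {x : Rn n} {k : ℤ} {y : Fin m → Rn n}
    (hy : y ∈ annulusAround m x k) (i : Fin m) : ‖x - y i‖ ≤ 2 * 2 ^ k := by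
  have hsum : ∑ i, ‖x - y i‖ ≤ 1 * (1 + 0) * (2 * 2 ^ k) := hy.2
  have hterm := Finset.single_le_sum (f := fun i => ‖x - y i‖) (fun i _ => norm_nonneg _)
    (Finset.mem_univ i)
  linarith

lemma exists_mem_annulus_two_zpow {v : Fin m → Rn n} (hv : v ≠ 0) :
    ∃ k : ℤ, v ∈ annulus n m (2 ^ k) 1 0 := by
  obtain ⟨i, hi⟩ := Function.ne_iff.1 hv
  have hpos : 0 < ∑ i, ‖v i‖ := Finset.sum_pos' (fun i _ => norm_nonneg _)
    ⟨i, Finset.mem_univ i, norm_pos_iff.2 hi⟩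
  obtain ⟨k, hlt, hle⟩ := exists_mem_Ioc_zpow hpos (one_lt_two (α := ℝ))
  refine ⟨k, by simpa using hlt, ?_⟩
  rw [zpow_add_one₀ two_ne_zero] at hle
  linarith

lemma iUnion_annulusAround_ae_eq_univ (hn : 0 < n) (hm : 0 < m) (x : Rn n) :
    (⋃ k, annulusAround m x k) =ᵐ[volume] Set.univ := by
  have : NeZero n := ⟨hn.ne'⟩
  have : NeZero m := ⟨hm.ne'⟩
  have : NullSingletonClass (volume : Measure (Rn n)) := inferInstance
  rw [ae_eq_univ]
  refine measure_mono_null (t := {fun _ => x}) (fun y hy => ?_) (measure_singleton _)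
  by_contra hne
  obtain ⟨k, hk⟩ := exists_mem_annulus_two_zpow (v := fun i => x - y i) fun h =>
    hne (funext fun i => (sub_eq_zero.1 (congrFun h i)).symm)
  exact hy (Set.mem_iUnion.2 ⟨k, hk⟩)

lemma CondD.exists_ofReal_le_annulusMass (hφ : CondD φ δ ε) : ∃ C : ℝ≥0, ∀ k : ℤ,
    ∀ v ∈ annulus n m (2 ^ k) 1 0, ∀ (α : Fin n → Fin 2) (z : Fin n → ℤ),
      ENNReal.ofReal (φ v) ≤ C * annulusMass φ δ ε k / volume (gridCube α (k + 4) z) ^ m := by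
  obtain ⟨C, hC0, hC⟩ := hφ.growth
  refine ⟨C.toNNReal * 16 ^ (n * m), fun k v hv α z => ?_⟩
  have hmass : ENNReal.ofReal (∫ y in annulus n m (2 ^ k) δ ε, φ y) ≤ annulusMass φ δ ε k := by
    rw [integral_eq_lintegral_of_nonneg_ae (.of_forall hφ.nonneg)
      hφ.locallyIntegrable.aestronglyMeasurable.restrict]
    exact ENNReal.ofReal_toReal_le
  have hvolume : volume (gridCube α (k + 4) z) ^ m =
      ENNReal.ofReal ((2 : ℝ) ^ (k * n * m) * 16 ^ (n * m)) := by
    rw [gridCube, volume_cube, ← ENNReal.ofReal_pow (by positivity),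
      ← ENNReal.ofReal_pow (by positivity), zpow_add₀ two_ne_zero, ← pow_mul, mul_pow, mul_assoc,
      zpow_mul, ← Nat.cast_mul, zpow_natCast]
    norm_num
  have hconst : ENNReal.ofReal (C / (2 : ℝ) ^ (k * n * m)) =
      (C.toNNReal * 16 ^ (n * m) : ℝ≥0) / volume (gridCube α (k + 4) z) ^ m := by
    have hreal : C / (2 : ℝ) ^ (k * n * m) =
        C * 16 ^ (n * m) / ((2 : ℝ) ^ (k * n * m) * 16 ^ (n * m)) := by field_simp
    rw [hvolume, hreal, ENNReal.ofReal_div_of_pos (by positivity), ENNReal.ofReal_mul hC0.le,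
      ENNReal.ofReal_pow (by norm_num), ENNReal.ofReal_ofNat]
    push_cast
    rfl
  calc ENNReal.ofReal (φ v)
      ≤ ENNReal.ofReal (C / (2 : ℝ) ^ (k * n * m)) *
          ENNReal.ofReal (∫ y in annulus n m (2 ^ k) δ ε, φ y) := by
        rw [← ENNReal.ofReal_mul (by positivity)]
        exact ENNReal.ofReal_le_ofReal (hC k v hv)
    _ ≤ ENNReal.ofReal (C / (2 : ℝ) ^ (k * n * m)) * annulusMass φ δ ε k := by gcongr
    _ = _ := by rw [hconst, ENNReal.mul_div_right_comm]

lemma CondD.exists_setLIntegral_annulus_le (hφ : CondD φ δ ε) : ∃ C : ℝ≥0,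
    ∀ (g : Fin m → Rn n → ℝ≥0∞), (∀ i, AEMeasurable (g i)) → ∀ (x : Rn n) (k : ℤ),
      ∃ α : Fin n → Fin 2,
    ∫⁻ y in annulusAround m x k,
        ENNReal.ofReal (φ fun i => x - y i) * ∏ i, g i (y i) ≤
      C * (annulusMass φ δ ε k *
        ∏ i, ⨍⁻ y in gridCube α (k + 4) (gridIndex α (k + 4) x), g i y ∂volume) := by
  obtain ⟨C, hC⟩ := hφ.exists_ofReal_le_annulusMass
  refine ⟨C, fun g hg x k => ?_⟩
  obtain ⟨α, hα⟩ := exists_forall_norm_sub_le_gridIndex_eq k x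
  refine ⟨α, ?_⟩
  set cell : Set (Rn n) := {y | gridIndex α (k + 4) y = gridIndex α (k + 4) x}
  set Q := gridCube α (k + 4) (gridIndex α (k + 4) x)
  have hsubset : annulusAround m x k ⊆ Set.univ.pi fun _ => cell := fun y hy i _ =>
    hα (y i) (norm_sub_le_of_mem_annulusAround hy i)
  have hcell : volume.restrict cell = volume.restrict Q :=
    Measure.restrict_congr_set (setOf_gridIndex_ae_eq α (k + 4) _)
  calc ∫⁻ y in annulusAround m x k,
        ENNReal.ofReal (φ fun i => x - y i) * ∏ i, g i (y i)
      ≤ ∫⁻ y in annulusAround m x k,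
          (C * annulusMass φ δ ε k / volume Q ^ m) * ∏ i, g i (y i) :=
        setLIntegral_mono' (measurableSet_annulusAround x k) fun y hy =>
          mul_le_mul_left (hC k _ hy α _) _
    _ ≤ ∫⁻ y in Set.univ.pi fun _ => cell,
          (C * annulusMass φ δ ε k / volume Q ^ m) * ∏ i, g i (y i) := lintegral_mono_set hsubset
    _ = (C * annulusMass φ δ ε k / volume Q ^ m) * ∏ i, ∫⁻ y in Q, g i y := by
        rw [volume_pi, Measure.restrict_pi_pi, hcell, lintegral_const_mul'' _
          (aemeasurable_prod_comp_eval fun i => (hg i).restrict),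
          lintegral_fin_prod_eq_prod fun i => (hg i).restrict]
    _ = _ := by
        simp_rw [setLAverage_eq, div_eq_mul_inv]
        rw [Finset.prod_mul_distrib, Finset.prod_const, Finset.card_univ, Fintype.card_fin,
          ENNReal.inv_pow]
        ring

lemma CondD.exists_lintegral_mul_prod_le (hn : 0 < n) (hm : 0 < m) (hφ : CondD φ δ ε) :
    ∃ C : ℝ≥0, ∀ (g : Fin m → Rn n → ℝ≥0∞), (∀ i, AEMeasurable (g i)) → ∀ x : Rn n,
      ∫⁻ y : Fin m → Rn n, ENNReal.ofReal (φ fun i => x - y i) * ∏ i, g i (y i) ≤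
        C * ∑ α : Fin n → Fin 2, ∑' k : ℤ, annulusMass φ δ ε (k - 4) *
          ∏ i, ⨍⁻ y in gridCube α k (gridIndex α k x), g i y ∂volume := by
  obtain ⟨C, hC⟩ := hφ.exists_setLIntegral_annulus_le
  refine ⟨C, fun g hg x => ?_⟩
  set average : (Fin n → Fin 2) → ℤ → ℝ≥0∞ := fun α k =>
    annulusMass φ δ ε (k - 4) * ∏ i, ⨍⁻ y in gridCube α k (gridIndex α k x), g i y ∂volume
  calc ∫⁻ y : Fin m → Rn n, ENNReal.ofReal (φ fun i => x - y i) * ∏ i, g i (y i)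
      = ∫⁻ y in ⋃ k, annulusAround m x k, ENNReal.ofReal (φ fun i => x - y i) * ∏ i, g i (y i) := by
        rw [setLIntegral_congr (iUnion_annulusAround_ae_eq_univ hn hm x), setLIntegral_univ]
    _ ≤ ∑' k, ∫⁻ y in annulusAround m x k, ENNReal.ofReal (φ fun i => x - y i) * ∏ i, g i (y i) :=
        lintegral_iUnion_le _ _
    _ ≤ ∑' k : ℤ, C * ∑ α, average α (k + 4) := by
        refine ENNReal.tsum_le_tsum fun k => ?_
        obtain ⟨α, hα⟩ := hC g hg x k
        refine hα.trans (mul_le_mul_right ?_ _)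
        simpa only [average, add_sub_cancel_right] using Finset.single_le_sum
          (f := fun α => average α (k + 4)) (fun _ _ => bot_le) (Finset.mem_univ α)
    _ = C * ∑ α, ∑' k, average α k := by
        rw [ENNReal.tsum_mul_left, Summable.tsum_finsetSum fun _ _ => ENNReal.summable]
        congr 1
        exact Finset.sum_congr rfl fun α _ => (Equiv.addRight (4 : ℤ)).tsum_eq (average α)

end Discretization

section Pointwise

lemma prod_update_mul_apply {ι X M : Type*} [Fintype ι] [DecidableEq ι] [CommMonoid M]
    (g : ι → X → M) (j : ι) (u : X → M) (y : ι → X) :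
    ∏ i, Function.update g j (fun t => u t * g j t) i (y i) = u (y j) * ∏ i, g i (y i) := by
  rw [← Finset.mul_prod_erase _ _ (Finset.mem_univ j),
    ← Finset.mul_prod_erase _ (fun i => g i (y i)) (Finset.mem_univ j), ← mul_assoc,
    Function.update_self]
  congr 1
  exact Finset.prod_congr rfl fun i hi => by rw [Function.update_of_ne (Finset.ne_of_mem_erase hi)]

variable {n m m' : ℕ} {φ : (Fin m → Rn n) → ℝ} {δ ε : ℝ} {f : Fin m → Rn n → ℝ}

lemma CondD.enorm_mul_prod (hφ : CondD φ δ ε) (v y : Fin m → Rn n) (f : Fin m → Rn n → ℝ) :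
    ‖φ v * ∏ i, f i (y i)‖ₑ = ENNReal.ofReal (φ v) * ∏ i, ‖f i (y i)‖ₑ := by
  rw [enorm_mul, Real.enorm_of_nonneg (hφ.nonneg _), enorm_finset_prod]

lemma aestronglyMeasurable_comp_eval {g : Rn n → ℝ} (hg : AEStronglyMeasurable g) (i : Fin m) :
    AEStronglyMeasurable fun y : Fin m → Rn n => g (y i) :=
  hg.comp_quasiMeasurePreserving (Measure.quasiMeasurePreserving_eval (fun _ => volume) i)

lemma CondD.aestronglyMeasurable_mul_prod (hφ : CondD φ δ ε)
    (hf : ∀ i, AEStronglyMeasurable (f i)) (x : Rn n) :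
    AEStronglyMeasurable fun y : Fin m → Rn n => φ (fun i => x - y i) * ∏ i, f i (y i) :=
  (hφ.locallyIntegrable.aestronglyMeasurable.comp_quasiMeasurePreserving
    (volume_preserving_pi fun _ : Fin m =>
      Measure.measurePreserving_sub_left (volume : Measure (Rn n)) x).quasiMeasurePreserving).mul
    (Finset.aestronglyMeasurable_fun_prod _ fun i _ => aestronglyMeasurable_comp_eval (hf i) i)

/-- The dyadic model of `𝒯_φ` and its commutators: the sum over the `2ⁿ` grids and over all scales
of the kernel mass times the averages of the `fᵢ` and the oscillation of the symbols at `x`. A cube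
of side `2ᵏ` is paired with the annulus of radius `2ᵏ⁻⁴`, whose translates fit into it. -/
def gridMajorant (φ : (Fin m → Rn n) → ℝ) (δ ε : ℝ) (ℓ : ℕ) (f : Fin m → Rn n → ℝ)
    (b : Fin m' → Rn n → ℝ) (x : Rn n) : ℝ≥0∞ :=
  ∑ α : Fin n → Fin 2, ∑' k : ℤ, annulusMass φ δ ε (k - 4) * gridTerm α ℓ f b k x

lemma CondD.exists_lintegral_enorm_le_gridMajorant (hn : 0 < n) (hm : 0 < m)
    (hφ : CondD φ δ ε) : ∃ C : ℝ≥0, ∀ (ℓ : ℕ) (f : Fin m → Rn n → ℝ) {m' : ℕ}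
      (b : Fin m' → Rn n → ℝ), (∀ i, AEStronglyMeasurable (f i)) → ∀ x : Rn n,
    ∫⁻ y : Fin m → Rn n, ‖φ (fun i => x - y i) * ∏ i, f i (y i)‖ₑ ≤
      C * gridMajorant φ δ ε ℓ f b x := by
  obtain ⟨C, hC⟩ := hφ.exists_lintegral_mul_prod_le hn hm
  refine ⟨C, fun ℓ f _ b hf x => ?_⟩
  simp_rw [hφ.enorm_mul_prod]
  refine (hC (fun i y => ‖f i y‖ₑ) (fun i => (hf i).enorm) x).trans ?_
  unfold gridMajorant gridTerm
  gcongr with α _ k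
  exact (Finset.prod_le_prod' fun i _ => laverage_enorm_le_luxAvg ℓ (f i) _).trans
    (le_mul_of_one_le_left bot_le le_self_add)

lemma exists_laverage_enorm_sub_mul_le_luxAvg (K : ℝ≥0) : ∃ C : ℝ≥0, ∀ b : Rn n → ℝ,
    LocallyIntegrable b → bmoNorm b ≤ K → ∀ f : Rn n → ℝ, AEStronglyMeasurable f →
      ∀ (α : Fin n → Fin 2) (k : ℤ) (z : Fin n → ℤ) (c : ℝ),
    ⨍⁻ y in gridCube α k z, ‖c - b y‖ₑ * ‖f y‖ₑ ∂volume ≤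
      (‖c - ⨍ u in gridCube α k z, b u‖ₑ + C) * luxAvg (youngLog 1) f (gridCube α k z) := by
  obtain ⟨C, hC⟩ := exists_setLIntegral_sub_average_mul_le_luxAvg (n := n) K
  refine ⟨C, fun b hb hK f hf α k z c => ?_⟩
  set Q := gridCube α k z
  set a := ⨍ u in Q, b u
  have hV0 : volume Q ≠ 0 := volume_cube_ne_zero _ (by positivity)
  have hVtop : volume Q ≠ ∞ := volume_cube_ne_top _ _
  have hf_avg : ∫⁻ y in Q, ‖f y‖ₑ ≤ luxAvg (youngLog 1) f Q * volume Q := by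
    rw [← ENNReal.div_le_iff hV0 hVtop, ← setLAverage_eq]
    exact laverage_enorm_le_luxAvg 1 f Q
  rw [setLAverage_eq, ENNReal.div_le_iff hV0 hVtop]
  calc ∫⁻ y in Q, ‖c - b y‖ₑ * ‖f y‖ₑ
      ≤ ∫⁻ y in Q, (‖c - a‖ₑ * ‖f y‖ₑ + ‖b y - a‖ₑ * ‖f y‖ₑ) := by
        refine lintegral_mono fun y => ?_
        rw [← add_mul, ← sub_sub_sub_cancel_right c (b y) a]
        exact mul_le_mul_left enorm_sub_le _
    _ = ‖c - a‖ₑ * (∫⁻ y in Q, ‖f y‖ₑ) + ∫⁻ y in Q, ‖b y - a‖ₑ * ‖f y‖ₑ := by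
        rw [lintegral_add_left' (hf.enorm.restrict.const_mul _),
          lintegral_const_mul' _ _ enorm_ne_top]
    _ ≤ ‖c - a‖ₑ * (luxAvg (youngLog 1) f Q * volume Q) +
          C * luxAvg (youngLog 1) f Q * volume Q :=
        add_le_add (mul_le_mul_right hf_avg _) (hC b hb hK f α k z)
    _ = _ := by ring

lemma prod_laverage_update_le_mul_gridTerm {C : ℝ≥0} {b : Fin m → Rn n → ℝ} (α : Fin n → Fin 2)
    (k : ℤ) (x : Rn n) (j : Fin m)
    (hC : ⨍⁻ y in gridCube α k (gridIndex α k x), ‖b j x - b j y‖ₑ * ‖f j y‖ₑ ∂volume ≤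
      (‖b j x - ⨍ u in gridCube α k (gridIndex α k x), b j u‖ₑ + C) *
        luxAvg (youngLog 1) (f j) (gridCube α k (gridIndex α k x))) :
    ∏ i, ⨍⁻ y in gridCube α k (gridIndex α k x), Function.update (fun i y => ‖f i y‖ₑ) j
        (fun y => ‖b j x - b j y‖ₑ * ‖f j y‖ₑ) i y ∂volume ≤
      (1 + C) * gridTerm α 1 f b k x := by
  set Q := gridCube α k (gridIndex α k x)
  set osc : Fin m → ℝ≥0∞ := fun j => ‖b j x - ⨍ u in Q, b j u‖ₑ
  have hosc : osc j + C ≤ (1 + C) * (1 + ∑ j, osc j) :=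
    calc osc j + C ≤ ∑ j, osc j + C := by
          gcongr
          exact Finset.single_le_sum (fun _ _ => bot_le) (Finset.mem_univ j)
      _ ≤ ∑ j, osc j + C + (1 + C * ∑ j, osc j) := le_self_add
      _ = _ := by ring
  calc _ ≤ (osc j + C) * ∏ i, luxAvg (youngLog 1) (f i) Q := by
        rw [← Finset.mul_prod_erase _ _ (Finset.mem_univ j),
          ← Finset.mul_prod_erase _ (fun i => luxAvg (youngLog 1) (f i) Q) (Finset.mem_univ j),
          ← mul_assoc]
        refine mul_le_mul' (by simpa only [Function.update_self] using hC)
          (Finset.prod_le_prod' fun i hi => ?_)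
        simpa only [Function.update_of_ne (Finset.ne_of_mem_erase hi)] using
          laverage_enorm_le_luxAvg 1 (f i) Q
    _ ≤ (1 + C) * (1 + ∑ j, osc j) * ∏ i, luxAvg (youngLog 1) (f i) Q := by gcongr
    _ = _ := mul_assoc _ _ _

lemma CondD.exists_lintegral_enorm_sub_mul_le_gridMajorant (hn : 0 < n) (hm : 0 < m)
    (hφ : CondD φ δ ε) (K : ℝ≥0) : ∃ C : ℝ≥0, ∀ b f : Fin m → Rn n → ℝ,
    (∀ j, LocallyIntegrable (b j)) → (∀ j, bmoNorm (b j) ≤ K) →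
    (∀ i, AEStronglyMeasurable (f i)) → ∀ (j : Fin m) (x : Rn n),
      ∫⁻ y : Fin m → Rn n,
          ‖(b j x - b j (y j)) * (φ (fun i => x - y i) * ∏ i, f i (y i))‖ₑ ≤
        C * gridMajorant φ δ ε 1 f b x := by
  obtain ⟨C, hC⟩ := hφ.exists_lintegral_mul_prod_le hn hm
  obtain ⟨C₁, hC₁⟩ := exists_laverage_enorm_sub_mul_le_luxAvg (n := n) K
  refine ⟨C * (1 + C₁), fun b f hb hK hf j x => ?_⟩
  set g : Fin m → Rn n → ℝ≥0∞ := fun i y => ‖f i y‖ₑ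
  set G : Fin m → Rn n → ℝ≥0∞ := Function.update g j fun y => ‖b j x - b j y‖ₑ * g j y
  have hG : ∀ i, AEMeasurable (G i) := by
    refine (Function.forall_update_iff g fun _ h => AEMeasurable h).2
      ⟨?_, fun i _ => (hf i).enorm⟩
    exact (aestronglyMeasurable_const.sub (hb j).aestronglyMeasurable).enorm.mul (hf j).enorm
  calc _ = ∫⁻ y : Fin m → Rn n, ENNReal.ofReal (φ fun i => x - y i) * ∏ i, G i (y i) := by
        refine lintegral_congr fun y => ?_
        rw [enorm_mul, hφ.enorm_mul_prod, mul_left_comm]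
        congr 1
        exact (prod_update_mul_apply g j (fun t => ‖b j x - b j t‖ₑ) y).symm
    _ ≤ C * ∑ α : Fin n → Fin 2, ∑' k : ℤ, annulusMass φ δ ε (k - 4) *
          ∏ i, ⨍⁻ y in gridCube α k (gridIndex α k x), G i y ∂volume := hC G hG x
    _ ≤ C * ∑ α : Fin n → Fin 2, ∑' k : ℤ, annulusMass φ δ ε (k - 4) *
          ((1 + C₁) * gridTerm α 1 f b k x) := by
        gcongr with α _ k
        exact prod_laverage_update_le_mul_gridTerm α k x j
          (hC₁ (b j) (hb j) (hK j) (f j) (hf j) α k _ _)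
    _ = _ := by
        simp_rw [mul_left_comm _ (1 + (C₁ : ℝ≥0∞)), ENNReal.tsum_mul_left, ← Finset.mul_sum]
        push_cast
        rw [mul_assoc, gridMajorant]

lemma mul_potential_sub_potential_update (c : ℝ) (β : Rn n → ℝ) (j : Fin m) (x : Rn n)
    (hint : Integrable fun y : Fin m → Rn n => φ (fun i => x - y i) * ∏ i, f i (y i))
    (hsub : Integrable fun y : Fin m → Rn n =>
      (c - β (y j)) * (φ (fun i => x - y i) * ∏ i, f i (y i))) :
    c * potential φ f x - potential φ (Function.update f j fun y => β y * f j y) x =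
      ∫ y : Fin m → Rn n, (c - β (y j)) * (φ (fun i => x - y i) * ∏ i, f i (y i)) := by
  have hupdate : potential φ (Function.update f j fun y => β y * f j y) x =
      ∫ y : Fin m → Rn n, (c * (φ (fun i => x - y i) * ∏ i, f i (y i)) -
        (c - β (y j)) * (φ (fun i => x - y i) * ∏ i, f i (y i))) := by
    refine integral_congr_ae (.of_forall fun y => ?_)
    simp only [prod_update_mul_apply]
    ring
  rw [hupdate, integral_sub (hint.const_mul c) hsub, integral_const_mul, potential, sub_sub_cancel]

lemma CondD.exists_enorm_commutator_le_gridMajorant (hn : 0 < n) (hm : 0 < m)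
    (hφ : CondD φ δ ε) (K : ℝ≥0) : ∃ C : ℝ≥0, ∀ b f : Fin m → Rn n → ℝ,
    (∀ j, LocallyIntegrable (b j)) → (∀ j, bmoNorm (b j) ≤ K) →
    (∀ i, AEStronglyMeasurable (f i)) → ∀ x : Rn n,
      ‖commutator b φ f x‖ₑ ≤ C * gridMajorant φ δ ε 1 f b x := by
  obtain ⟨C₀, hC₀⟩ := hφ.exists_lintegral_enorm_le_gridMajorant hn hm
  obtain ⟨C₁, hC₁⟩ := hφ.exists_lintegral_enorm_sub_mul_le_gridMajorant hn hm K
  refine ⟨m * (C₁ + 1), fun b f hb hK hf x => ?_⟩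
  have hterm : ∀ j, ‖b j x * potential φ f x
      - potential φ (Function.update f j fun y => b j y * f j y) x‖ₑ ≤
      (C₁ + 1) * gridMajorant φ δ ε 1 f b x := by
    intro j
    by_cases htop : gridMajorant φ δ ε 1 f b x = ∞
    · rw [htop, ENNReal.mul_top (by simp)]
      exact le_top
    have hFmeas := hφ.aestronglyMeasurable_mul_prod hf x
    have hF : Integrable fun y : Fin m → Rn n => φ (fun i => x - y i) * ∏ i, f i (y i) :=
      ⟨hFmeas, (hC₀ 1 f b hf x).trans_lt
        (ENNReal.mul_lt_top ENNReal.coe_lt_top (lt_top_iff_ne_top.2 htop))⟩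
    have hD : Integrable fun y : Fin m → Rn n =>
        (b j x - b j (y j)) * (φ (fun i => x - y i) * ∏ i, f i (y i)) :=
      ⟨(aestronglyMeasurable_const.sub
          (aestronglyMeasurable_comp_eval (hb j).aestronglyMeasurable j)).mul hFmeas,
        (hC₁ b f hb hK hf j x).trans_lt
          (ENNReal.mul_lt_top ENNReal.coe_lt_top (lt_top_iff_ne_top.2 htop))⟩
    rw [mul_potential_sub_potential_update _ _ j x hF hD]
    refine (enorm_integral_le_lintegral_enorm _).trans ((hC₁ b f hb hK hf j x).trans ?_)
    gcongr
    exact le_self_add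
  calc ‖commutator b φ f x‖ₑ
      ≤ ∑ _j : Fin m, (C₁ + 1) * gridMajorant φ δ ε 1 f b x :=
        (enorm_sum_le _ _).trans (Finset.sum_le_sum fun j _ => hterm j)
    _ = _ := by
        rw [Finset.sum_const, Finset.card_univ, Fintype.card_fin, nsmul_eq_mul, ← mul_assoc]
        push_cast
        rfl

end Pointwise

section WeightedEstimates

variable {n m : ℕ} {φ : (Fin m → Rn n) → ℝ} {δ ε : ℝ}

lemma sum_univ_rpow_le_card_rpow_mul_sum {ι : Type*} [Fintype ι] [Nonempty ι] (u : ι → ℝ≥0∞)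
    {p : ℝ} (hp : 0 ≤ p) :
    (∑ i, u i) ^ p ≤ (Fintype.card ι : ℝ≥0∞) ^ p * ∑ i, u i ^ p := by
  obtain ⟨j, hj⟩ := Finite.exists_max u
  calc (∑ i, u i) ^ p ≤ (Fintype.card ι * u j) ^ p := by
        gcongr
        simpa using Finset.sum_le_card_nsmul Finset.univ u (u j) fun i _ => hj i
    _ = (Fintype.card ι : ℝ≥0∞) ^ p * u j ^ p := ENNReal.mul_rpow_of_nonneg _ _ hp
    _ ≤ (Fintype.card ι : ℝ≥0∞) ^ p * ∑ i, u i ^ p := by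
        gcongr
        exact Finset.single_le_sum (f := fun i => u i ^ p) (fun _ _ => bot_le) (Finset.mem_univ j)

lemma lintegral_rpow_mul_le_of_le_const_mul {X : Type*} [MeasurableSpace X] {μ : Measure X}
    {u v ω : X → ℝ≥0∞} {C : ℝ≥0} (huv : ∀ x, u x ≤ C * v x) {p : ℝ} (hp : 0 ≤ p) :
    ∫⁻ x, u x ^ p * ω x ∂μ ≤ (C ^ p : ℝ≥0) * ∫⁻ x, v x ^ p * ω x ∂μ := by
  rw [← lintegral_const_mul' _ _ ENNReal.coe_ne_top]
  refine lintegral_mono fun x => ?_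
  rw [ENNReal.coe_rpow_of_nonneg _ hp, ← mul_assoc, ← ENNReal.mul_rpow_of_nonneg _ _ hp]
  gcongr
  exact huv x

lemma MemAInfty.exists_lintegral_gridMajorant_le {w : Rn n → ℝ} (hw : MemAInfty w) (m' : ℕ)
    (φ : (Fin m → Rn n) → ℝ) (δ ε : ℝ) (K : ℝ≥0) {θ p : ℝ} (hθ : 0 < θ) (hθ1 : θ ≤ 1)
    (hp : θ ≤ p) : ∃ C : ℝ≥0, ∀ (ℓ : ℕ) (f : Fin m → Rn n → ℝ) (b : Fin m' → Rn n → ℝ),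
    (∀ j, LocallyIntegrable (b j)) → (∀ j, bmoNorm (b j) ≤ K) →
      ∫⁻ x, gridMajorant φ δ ε ℓ f b x ^ p * ENNReal.ofReal (w x) ≤
        C * ∫⁻ x, maximal (Phi φ δ ε θ) (youngLog ℓ) f x ^ p * ENNReal.ofReal (w x) := by
  obtain ⟨C, hC⟩ := hw.exists_lintegral_tsum_int_mul_gridTerm_le m m' K hθ hθ1 hp
  obtain ⟨r, -, hwr, -⟩ := hw
  have hp0 : 0 ≤ p := hθ.le.trans hp
  set c : ℝ≥0 := (Fintype.card (Fin n → Fin 2) : ℝ≥0)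
  refine ⟨c ^ p * (c * C), fun ℓ f b hb hK => ?_⟩
  set h : (Fin n → Fin 2) → Rn n → ℝ≥0∞ := fun α x =>
    ∑' k : ℤ, annulusMass φ δ ε (k - 4) * gridTerm α ℓ f b k x
  have hmeas : ∀ α, AEMeasurable fun x => h α x ^ p * ENNReal.ofReal (w x) := fun α =>
    ((AEMeasurable.tsum fun k => (aemeasurable_gridTerm α ℓ f hb k).const_mul _).pow_const p).mul
      hwr.aemeasurable_ofReal
  calc ∫⁻ x, gridMajorant φ δ ε ℓ f b x ^ p * ENNReal.ofReal (w x)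
      ≤ ∫⁻ x, (c ^ p : ℝ≥0) * ∑ α, h α x ^ p * ENNReal.ofReal (w x) := by
        refine lintegral_mono fun x => ?_
        rw [← Finset.sum_mul, ← mul_assoc, ENNReal.coe_rpow_of_nonneg _ hp0]
        exact mul_le_mul_left (sum_univ_rpow_le_card_rpow_mul_sum (fun α => h α x) hp0) _
    _ = (c ^ p : ℝ≥0) * ∑ α, ∫⁻ x, h α x ^ p * ENNReal.ofReal (w x) := by
        rw [lintegral_const_mul' _ _ ENNReal.coe_ne_top, lintegral_finsetSum' _ fun α _ => hmeas α]
    _ ≤ (c ^ p : ℝ≥0) * ∑ _α : Fin n → Fin 2, C *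
          ∫⁻ x, maximal (Phi φ δ ε θ) (youngLog ℓ) f x ^ p * ENNReal.ofReal (w x) := by
        gcongr with α
        exact hC (fun k => annulusMass φ δ ε (k - 4)) (Phi φ δ ε θ)
          (tsum_annulusMass_le_Phi φ δ ε hθ.ne') α ℓ f b hb hK
    _ = _ := by
        rw [Finset.sum_const, Finset.card_univ, nsmul_eq_mul, ENNReal.coe_mul, ENNReal.coe_mul,
          mul_assoc, mul_assoc]
        rfl

lemma CondD.exists_lintegral_potential_le (hn : 0 < n) (hm : 0 < m) (hφ : CondD φ δ ε)
    {w : Rn n → ℝ} (hw : MemAInfty w) {θ p : ℝ} (hθ : 0 < θ) (hθ1 : θ ≤ 1) (hp : θ ≤ p) :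
    ∃ C : ℝ≥0, ∀ f : Fin m → Rn n → ℝ, (∀ i, AEStronglyMeasurable (f i)) →
      ∫⁻ x, ‖potential φ f x‖ₑ ^ p * ENNReal.ofReal (w x) ≤
        C * ∫⁻ x, maximal (Phi φ δ ε θ) (youngLog 0) f x ^ p * ENNReal.ofReal (w x) := by
  obtain ⟨C₀, hC₀⟩ := hφ.exists_lintegral_enorm_le_gridMajorant hn hm
  obtain ⟨C, hC⟩ := hw.exists_lintegral_gridMajorant_le 0 φ δ ε 0 hθ hθ1 hp
  refine ⟨C₀ ^ p * C, fun f hf => ?_⟩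
  rw [ENNReal.coe_mul, mul_assoc]
  exact (lintegral_rpow_mul_le_of_le_const_mul (fun x => (enorm_integral_le_lintegral_enorm _).trans
    (hC₀ 0 f Fin.elim0 hf x)) (hθ.le.trans hp)).trans
    (mul_le_mul_right (hC 0 f Fin.elim0 (fun j => j.elim0) fun j => j.elim0) _)

lemma CondD.exists_lintegral_commutator_le (hn : 0 < n) (hm : 0 < m) (hφ : CondD φ δ ε)
    {w : Rn n → ℝ} (hw : MemAInfty w) {θ p : ℝ} (hθ : 0 < θ) (hθ1 : θ ≤ 1) (hp : θ ≤ p)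
    (K : ℝ≥0) : ∃ C : ℝ≥0, ∀ b f : Fin m → Rn n → ℝ, (∀ j, LocallyIntegrable (b j)) →
      bmoNormVec b ≤ K → (∀ i, AEStronglyMeasurable (f i)) →
      ∫⁻ x, ‖commutator b φ f x‖ₑ ^ p * ENNReal.ofReal (w x) ≤
        C * ∫⁻ x, maximal (Phi φ δ ε θ) (youngLog 1) f x ^ p * ENNReal.ofReal (w x) := by
  obtain ⟨C₀, hC₀⟩ := hφ.exists_enorm_commutator_le_gridMajorant hn hm K
  obtain ⟨C, hC⟩ := hw.exists_lintegral_gridMajorant_le m φ δ ε K hθ hθ1 hp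
  refine ⟨C₀ ^ p * C, fun b f hb hK hf => ?_⟩
  have hKj : ∀ j, bmoNorm (b j) ≤ K := fun j => (le_iSup (fun j => bmoNorm (b j)) j).trans hK
  rw [ENNReal.coe_mul, mul_assoc]
  exact (lintegral_rpow_mul_le_of_le_const_mul (hC₀ b f hb hKj hf) (hθ.le.trans hp)).trans
    (mul_le_mul_right (hC 1 f b hb hKj) _)

end WeightedEstimates

end MultilinearPotential

end

theorem mainTheorem2_general {n m : ℕ} (hn : 0 < n) (hm : 0 < m)
    {φ : (Fin m → MultilinearPotential.Rn n) → ℝ} {δ ε : ℝ}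
    (hφ : MultilinearPotential.CondD φ δ ε)
    {w : MultilinearPotential.Rn n → ℝ} (hw : MultilinearPotential.MemAInfty w)
    {θ p : ℝ} (hθ : 0 < θ) (hθ1 : θ ≤ 1) (hp : θ ≤ p) :
    (∃ C : ℝ≥0, ∀ f : Fin m → MultilinearPotential.Rn n → ℝ,
      (∀ i, AEStronglyMeasurable (f i)) →
        ∫⁻ x, ‖MultilinearPotential.potential φ f x‖ₑ ^ p * ENNReal.ofReal (w x) ≤
          C * ∫⁻ x, MultilinearPotential.maximal (MultilinearPotential.Phi φ δ ε θ)
            (MultilinearPotential.youngLog 0) f x ^ p * ENNReal.ofReal (w x)) ∧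
    (∀ K : ℝ≥0, ∃ C : ℝ≥0, ∀ b f : Fin m → MultilinearPotential.Rn n → ℝ,
      (∀ j, LocallyIntegrable (b j)) → MultilinearPotential.bmoNormVec b ≤ K →
      (∀ i, AEStronglyMeasurable (f i)) →
        ∫⁻ x, ‖MultilinearPotential.commutator b φ f x‖ₑ ^ p * ENNReal.ofReal (w x) ≤
          C * ∫⁻ x, MultilinearPotential.maximal (MultilinearPotential.Phi φ δ ε θ)
            (MultilinearPotential.youngLog 1) f x ^ p * ENNReal.ofReal (w x)) :=
  ⟨hφ.exists_lintegral_potential_le hn hm hw hθ hθ1 hp,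
    hφ.exists_lintegral_commutator_le hn hm hw hθ hθ1 hp⟩

theorem mainTheorem2 (n m : ℕ) (hn : 0 < n) (hm : 0 < m)
    (φ : (Fin m → MultilinearPotential.Rn n) → ℝ) (δ ε : ℝ)
    (hφ : MultilinearPotential.CondD φ δ ε)
    (w : MultilinearPotential.Rn n → ℝ) (hw : MultilinearPotential.MemAInfty w) :
    (∀ p : ℝ, 0 < p → p ≤ 1 →
      ∃ C : ℝ≥0, ∀ f : Fin m → MultilinearPotential.Rn n → ℝ,
        MultilinearPotential.BddCompactSupp f →
        ∫⁻ x, ‖MultilinearPotential.potential φ f x‖ₑ ^ p * ENNReal.ofReal (w x) ≤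
          C * ∫⁻ x, MultilinearPotential.maximal (MultilinearPotential.Phi φ δ ε p)
            (MultilinearPotential.youngLog 0) f x ^ p * ENNReal.ofReal (w x)) ∧
    (∀ p : ℝ, 0 < p → p ≤ 1 → MultilinearPotential.MemRH (1 / p) w →
      ∀ K : ℝ≥0, ∃ C : ℝ≥0, ∀ b f : Fin m → MultilinearPotential.Rn n → ℝ,
        (∀ j, MultilinearPotential.MemBMO (b j)) →
        MultilinearPotential.bmoNormVec b ≤ K →
        MultilinearPotential.BddCompactSupp f →
        ∫⁻ x, ‖MultilinearPotential.commutator b φ f x‖ₑ ^ p * ENNReal.ofReal (w x) ≤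
          C * ∫⁻ x, MultilinearPotential.maximal (MultilinearPotential.Phi φ δ ε p)
            (MultilinearPotential.youngLog 1) f x ^ p * ENNReal.ofReal (w x)) ∧
    (∀ p : ℝ, 1 < p → ∀ ℓ : Fin 2,
      ∀ K : ℝ≥0, ∃ C : ℝ≥0, ∀ b f : Fin m → MultilinearPotential.Rn n → ℝ,
        (∀ j, MultilinearPotential.MemBMO (b j)) →
        MultilinearPotential.bmoNormVec b ≤ K →
        MultilinearPotential.BddCompactSupp f →
        ∫⁻ x, ‖MultilinearPotential.potentialComm ℓ b φ f x‖ₑ ^ p * ENNReal.ofReal (w x) ≤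
          C * ∫⁻ x, MultilinearPotential.maximal (MultilinearPotential.Phi φ δ ε 1)
            (MultilinearPotential.youngLog (ℓ : ℕ)) f x ^ p * ENNReal.ofReal (w x)) := by
  have general {θ p : ℝ} (hθ : 0 < θ) (hθ1 : θ ≤ 1) (hp : θ ≤ p) :=
    mainTheorem2_general hn hm hφ hw hθ hθ1 hp
  refine ⟨fun p hp hp1 => (general hp hp1 le_rfl).1.imp fun _ hC f hf => hC f fun i => (hf i).1,
    fun p hp hp1 _ K => ((general hp hp1 le_rfl).2 K).imp fun _ hC b f hb hK hf =>
      hC b f (fun j => (hb j).1) hK fun i => (hf i).1, fun p hp => Fin.forall_fin_two.2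
    ⟨fun _ => (general one_pos le_rfl hp.le).1.imp fun _ hC _ f _ _ hf => hC f fun i => (hf i).1,
      fun K => ((general one_pos le_rfl hp.le).2 K).imp fun _ hC b f hb hK hf =>
        hC b f (fun j => (hb j).1) hK fun i => (hf i).1⟩⟩
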